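/- Let $d\ge2$, $\beta>0$, and let $\mathcal V\in C^\infty_c(\mathbb R^d)$ be real-valued and radially symmetric, with Fourier transform $\hat{\mathcal V}(k)=\int e^{-ik\cdot x}\mathcal V(x)\,dx$. Let $M(v)=(\frac{\beta}{2\pi})^{d/2}e^{-\frac\beta2|v|^2}$ and define the Landau tensor $$A_0=B_0*M,\qquad B_0(v)=\frac{\Lambda_{\mathcal V}}{|v|}\Big(\mathrm{Id}-\frac{v\otimes v}{|v|^2}\Big),\qquad \Lambda_{\mathcal V}=\frac{\omega_{d-1}}{d\,\omega_d}\int_{\mathbb R^d}|k|\,\pi\hat{\mathcal V}(k)^2\frac{dk}{(2\pi)^d},$$ with $\omega_n$ the volume of the unit ball of $\mathbb R^n$. For $\kappa>0$, $N\ge1$ and $\alpha\in\mathbb R$ define the hat operator $$H_\alpha^Nu(v_0)=-\int_{\mathbb R^d\times\mathbb R^d}\sqrt M(v_1)\,\hat{\mathcal V}(k)\,k\cdot\nabla_{v_0}\Big(\tfrac{1+i\alpha}N+ik\cdot(v_1-v_0)-\tfrac\kappa N(\Delta_{v_0}+\Delta_{v_1})\Big)^{-1}\Big[\sqrt M(v_1)\,\hat{\mathcal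 V}(k)\,k\cdot\nabla u(v_0)\Big]\,dv_1\frac{dk}{(2\pi)^d},$$ the inverse being taken in $L^2(\mathbb R^d\times\mathbb R^d)$, and let $\mathcal L\varphi(\alpha)=\int_0^\infty\varphi(\tau)e^{-(1+i\alpha)\tau}\,d\tau$. Let $\mathfrak g\in H^2(\mathbb R^d)$. Let $\tilde g_0^N$ be the function of $\tau\ge0$ with values in $L^2(\mathbb R^d)$ with $\int_0^\infty e^{-\tau}\|\tilde g_0^N(\tau)\|_{L^2}\,d\tau<\infty$ such that, for all $\alpha\in\mathbb R$, $\mathcal L\tilde g_0^N(\alpha)\in H^1(\mathbb R^d)$ satisfies, in the weak sense, $$\big(1+i\alpha-\kappa\Delta+H_\alpha^N\big)\mathcal L\tilde g_0^N(\alpha)=\mathfrak g,$$ and let $g_0\in C([0,\infty);L^2(\mathbb R^d))$, with $\int_0^\infty e^{-\tau}(\|g_0\|_{L^2}+\|\nabla g_0\|_{L^2})\,d\tau<\infty$, be the weak solution of the Fokker–Planck equation $$\partial_\tau g_0=\operatorname{div}\big((\kappa\,\mathrm{Id}+A_0)\nabla g_0\big),\qquad g_0|_{\tau=0}=\mathfrak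 g.$$ Then for every $\kappa_0>0$ there is a constant $C$ depending only on $d,\beta,\mathcal V,\kappa_0$ such that, for all $\kappa\ge\kappa_0$, all integers $N\ge1$ and all such $\mathfrak g$, $\tilde g_0^N$, $g_0$, $$\Big(\int_{\mathbb R}\|\mathcal L\tilde g_0^N(\alpha)-\mathcal Lg_0(\alpha)\|_{L^2(\mathbb R^d)}^2\,d\alpha\Big)^{1/2}\le\frac CN\,\|\langle\nabla\rangle^2\mathfrak g\|_{L^2(\mathbb R^d)},\qquad \langle\nabla\rangle^2=1-\Delta.$$ -/

import Mathlib

open MeasureTheory Set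
open scoped SchwartzMap LineDeriv FourierTransform ContDiff ENNReal

noncomputable section

namespace Thermalization

/-- Velocity space (and its Fourier-dual position space) `ℝ^d`. -/
abbrev Vel (d : ℕ) : Type := EuclideanSpace ℝ (Fin d)

/-- `L²(ℝ^d; ℂ)`, functions of the velocity `v₀` of the tagged particle. -/
abbrev L2 (d : ℕ) : Type := Lp ℂ 2 (volume : Measure (Vel d))

/-- `L²(ℝ^d × ℝ^d; ℂ)`, functions of the velocities `(v₀, v₁)`. -/
abbrev L2Pair (d : ℕ) : Type := Lp ℂ 2 (volume : Measure (Vel d × Vel d))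

/-- The `j`-th vector of the standard basis. -/
abbrev basisVec {d : ℕ} (j : Fin d) : Vel d := EuclideanSpace.single j (1 : ℝ)

/-- The Maxwellian `M(v) = (β / 2π)^{d/2} exp (-β |v|² / 2)`. -/
def maxwellian (d : ℕ) (β : ℝ) (v : Vel d) : ℝ :=
  (β / (2 * Real.pi)) ^ ((d : ℝ) / 2) * Real.exp (-(β / 2) * ‖v‖ ^ 2)

/-- The Fourier transform `∫ exp (-i k · x) V(x) dx` of the potential. -/
def potHat {d : ℕ} (V : Vel d → ℝ) (k : Vel d) : ℂ :=
  ∫ x : Vel d, Complex.exp (-(Complex.I * ((inner ℝ k x : ℝ) : ℂ))) * ((V x : ℝ) : ℂ)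

/-- `ω_n`, the volume of the unit ball of `ℝ^n`. -/
def unitBallVolume (n : ℕ) : ℝ :=
  (volume : Measure (EuclideanSpace ℝ (Fin n))).real (Metric.ball 0 1)

/-- `Λ_V = ω_{d-1} / (d ω_d) ∫ |k| π V̂(k)² dk / (2π)^d`
(for radial `V` the transform `V̂` is real-valued, so that `V̂(k)² = ‖V̂(k)‖²`). -/
def landauPrefactor {d : ℕ} (V : Vel d → ℝ) : ℝ :=
  unitBallVolume (d - 1) / ((d : ℝ) * unitBallVolume d) *
    (((2 * Real.pi) ^ d)⁻¹ * ∫ k : Vel d, ‖k‖ * Real.pi * ‖potHat V k‖ ^ 2)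

/-- The Landau kernel `B₀(w) = (Λ_V / |w|) (Id - w ⊗ w / |w|²)`. -/
def landauKernel {d : ℕ} (V : Vel d → ℝ) (w : Vel d) : Matrix (Fin d) (Fin d) ℝ :=
  fun i j => landauPrefactor V / ‖w‖ * ((if i = j then 1 else 0) - w i * w j / ‖w‖ ^ 2)

/-- The Landau tensor `A₀ = B₀ * M`. -/
def landauTensor {d : ℕ} (β : ℝ) (V : Vel d → ℝ) (v : Vel d) : Matrix (Fin d) (Fin d) ℝ :=
  fun i j => ∫ w : Vel d, landauKernel V (v - w) i j * maxwellian d β w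

/-- `G = ∇ u` in the sense of tempered distributions. Together with `u, G ∈ L²` this says that
`u ∈ H¹(ℝ^d)`. -/
def IsWeakGradient {d : ℕ} (u : L2 d) (G : Fin d → L2 d) : Prop :=
  ∀ j : Fin d, ∂_{basisVec j} (u : 𝓢'(Vel d, ℂ)) = (G j : 𝓢'(Vel d, ℂ))

/-- `‖⟨∇⟩^s u‖` in `L²`, where `⟨∇⟩ = (1 - Δ)^{1/2}` is the Fourier multiplier with symbol
`(1 + |2πξ|²)^{1/2}` for the Fourier transform of kernel `exp (-2πi ξ · v)`. -/
def japaneseNorm {d : ℕ} (s : ℝ) (u : L2 d) : ℝ≥0∞ :=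
  eLpNorm (fun ξ : Vel d =>
    (((1 + (2 * Real.pi * ‖ξ‖) ^ 2) ^ (s / 2) : ℝ) : ℂ) * (𝓕 u : L2 d) ξ) 2 volume

/-- The Laplacian in `(v₀, v₁)` of a test function. -/
def pairLaplacian {d : ℕ} (φ : 𝓢(Vel d × Vel d, ℂ)) : 𝓢(Vel d × Vel d, ℂ) :=
  ∑ j : Fin d,
    (∂_{((basisVec j, 0) : Vel d × Vel d)} (∂_{((basisVec j, 0) : Vel d × Vel d)} φ) +
      ∂_{((0, basisVec j) : Vel d × Vel d)} (∂_{((0, basisVec j) : Vel d × Vel d)} φ))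

/-- `h = (z + i k · (v₁ - v₀) - σ Δ_{v₀, v₁})⁻¹ f`: the function `h` of `L²(ℝ^d × ℝ^d)` solves
`(z + i k · (v₁ - v₀) - σ Δ_{v₀, v₁}) h = f` in the sense of tempered distributions. -/
def IsResolvent {d : ℕ} (z : ℂ) (σ : ℝ) (k : Vel d) (f : Vel d × Vel d → ℂ) (h : L2Pair d) :
    Prop :=
  ∀ φ : 𝓢(Vel d × Vel d, ℂ),
    ∫ p : Vel d × Vel d,
        h p * (z * φ p + Complex.I * ((inner ℝ k (p.2 - p.1) : ℝ) : ℂ) * φ p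
          - (σ : ℂ) * pairLaplacian φ p)
      = ∫ p : Vel d × Vel d, f p * φ p

/-- The operator `Ŝ⁻` from functions `u` of `v₀` to functions of `(k, v₀, v₁)`, the Fourier
variables of the two particles being `-k` and `k`; it is expressed by the gradient `G = ∇u`:
`Ŝ⁻ u (k, v₀, v₁) = - √M(v₁) V̂(k) k · ∇u(v₀)`. -/
def sMinus {d : ℕ} (β : ℝ) (V : Vel d → ℝ) (G : Fin d → L2 d) (k : Vel d)
    (p : Vel d × Vel d) : ℂ :=
  -((Real.sqrt (maxwellian d β p.2) : ℝ) : ℂ) * potHat V k * ∑ j : Fin d, ((k j : ℝ) : ℂ) * G j p.1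

/-- The operator `Ŝ⁺ h (v₀) = ∫ √M(v₁) V̂(k) k · ∇_{v₀} h(k, v₀, v₁) dk dv₁ / (2π)^d`, as a
distribution in `v₀`, evaluated at the test function `φ` (the derivative is moved onto `φ`). -/
def sPlus {d : ℕ} (β : ℝ) (V : Vel d → ℝ) (h : Vel d → L2Pair d) (φ : 𝓢(Vel d, ℂ)) : ℂ :=
  ((((2 * Real.pi) ^ d)⁻¹ : ℝ) : ℂ) *
    ∫ k : Vel d, ∫ p : Vel d × Vel d,
      -(((Real.sqrt (maxwellian d β p.2) : ℝ) : ℂ) * potHat V k *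
        (∑ j : Fin d, ((k j : ℝ) : ℂ) * (∂_{basisVec j} φ) p.1) * h k p)

/-- `u ∈ H¹(ℝ^d)` is the weak solution of
`(1 + iα - κ (t_N / N) Δ + (t_N / N) H_α) u = 𝔤`, where `H_α` is the hat operator
`H_α = Ŝ⁺ ((1 + iα) / t_N + i k · (v₁ - v₀) - (κ / N) Δ_{v₀, v₁})⁻¹ Ŝ⁻`. -/
def SolvesHatEquation {d : ℕ} (β κ : ℝ) (V : Vel d → ℝ) (tN N : ℝ) (𝔤 : L2 d) (α : ℝ)
    (u : L2 d) : Prop :=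
  ∃ (G : Fin d → L2 d) (h : Vel d → L2Pair d),
    IsWeakGradient u G ∧
    (∀ k : Vel d,
      IsResolvent ((1 + Complex.I * (α : ℂ)) / (tN : ℂ)) (κ / N) k (sMinus β V G k) (h k)) ∧
    ∀ φ : 𝓢(Vel d, ℂ),
      (1 + Complex.I * (α : ℂ)) * (∫ v : Vel d, u v * φ v)
        + ((κ * tN / N : ℝ) : ℂ) * (∑ j : Fin d, ∫ v : Vel d, G j v * (∂_{basisVec j} φ) v)
        + ((tN / N : ℝ) : ℂ) * sPlus β V h φ
      = ∫ v : Vel d, 𝔤 v * φ v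

/-- The Laplace integral of `g` converges absolutely on the line `1 + iℝ`:
`∫₀^∞ e^{-τ} ‖g(τ)‖ dτ < ∞`. -/
def LaplaceTransformable {d : ℕ} (g : ℝ → L2 d) : Prop :=
  IntegrableOn (fun τ : ℝ => Real.exp (-τ) • g τ) (Ioi 0)

/-- `ℒ g (α) = ∫₀^∞ g(τ) e^{-(1 + iα) τ} dτ`. -/
def laplace {d : ℕ} (g : ℝ → L2 d) (α : ℝ) : L2 d :=
  ∫ τ in Ioi (0 : ℝ), Complex.exp (-((1 + Complex.I * (α : ℂ)) * (τ : ℂ))) • g τ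

/-- The ansatz for the tagged particle density: its Laplace transform solves the non-Markovian
equation with initial datum `𝔤`. -/
structure IsAnsatz {d : ℕ} (β κ : ℝ) (V : Vel d → ℝ) (tN N : ℝ) (𝔤 : L2 d)
    (g : ℝ → L2 d) : Prop where
  transformable : LaplaceTransformable g
  equation : ∀ α : ℝ, SolvesHatEquation β κ V tN N 𝔤 α (laplace g α)

/-- `g ∈ C([0, ∞); L²)`, with gradient in `L¹(e^{-τ} dτ; L²)`, is a weak solution of
`∂_τ g = div ((κ Id + A) ∇ g)`, `g(0) = 𝔤`. The growth condition is weaker than boundedness of the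
energy `sup_τ ‖g(τ)‖² + ∫₀^∞ ‖∇g(τ)‖² dτ`. -/
def IsFokkerPlanckSolution {d : ℕ} (κ : ℝ) (A : Vel d → Matrix (Fin d) (Fin d) ℝ) (𝔤 : L2 d)
    (g : ℝ → L2 d) : Prop :=
  ContinuousOn g (Ici 0) ∧ g 0 = 𝔤 ∧ LaplaceTransformable g ∧
  ∃ G : ℝ → Fin d → L2 d,
    (∀ j : Fin d, LaplaceTransformable (fun τ => G τ j)) ∧
    (∀ᵐ τ ∂(volume.restrict (Ioi (0 : ℝ))), IsWeakGradient (g τ) (G τ)) ∧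
    ∀ φ : 𝓢(Vel d, ℂ), ∀ τ : ℝ, 0 ≤ τ →
      ∫ v : Vel d, g τ v * φ v
        = (∫ v : Vel d, 𝔤 v * φ v)
          - ∫ s in (0 : ℝ)..τ, ∫ v : Vel d, ∑ i : Fin d, ∑ j : Fin d,
              (((if i = j then κ else 0) + A v i j : ℝ) : ℂ) * G s j v * (∂_{basisVec i} φ) v

end Thermalization

end

noncomputable section

namespace Thermalization

variable {d : ℕ}

/-! After a Fourier transform in the velocities both equations take the same shape, and the theorem
becomes a perturbation estimate between them. The transform turns multiplication by `i k · (v₁ -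
v₀)` into a generator of translations and the Laplacian into multiplication by a quadratic weight.
The two-particle resolvent is therefore the Laplace transform of an explicit contraction semigroup:
translation along `t k`, damped by `exp (-s ∫₀ᵗ ‖ξ - r k‖² dr)` (`IsResolvent.tensorPairing_eq`).
Once `v₁` is integrated out against `√M`, the hat operator is a superposition over `(k, t)` of
damped translations, with parameters `z = (1 + iα) / N` and `s = 8π³κ / N` (`sPlus_fourier`). At `z
= 0`, `s = 0` the same superposition is the Landau operator `-div (A₀ ∇ ·)`
(`landauTensor_eq_integral`, `sum_integral_landauTensor`). Hence the transforms `U` and `U₀` of the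
two Laplace transforms solve `symbol · U + collisionOp U = 𝓕 𝔤` with parameters `(z, s)` and `(0,
0)`.

Three properties of the bilinear form of `collisionOp` carry the estimate. It is bounded on `H¹`
(`form_bound`). Its real part is nonnegative on the diagonal, being built from resolvents of
contraction semigroups (`re_form_nonneg`). Replacing `(z, s)` by `(0, 0)` costs `‖z‖` in `L²` and
`s` in `H¹` on the test function, and three derivatives on the other argument
(`exists_form_sub_bound`). Testing the difference of the equations with the conjugate of `w = U -
U₀` then bounds `w` by `1 / N` times three derivatives of `U₀` (`exists_energy_bound`). The growth
of `z` in `α` is harmless because the imaginary part of the energy identity controls `|α| ‖w‖²`.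

Three derivatives of `U₀` are bounded by those of `𝓕 𝔤 / symbol`: the weight `μ² + ‖ξ‖²` commutes
with the translations up to a relative error `O(1 / μ)`, which the diffusion absorbs for large `μ`
(`exists_weighted_bound`). Finally the integral of `1 / (a² + α²)` over `α` is `π / a`, which
recovers one derivative together with the factor `κ` and leaves two derivatives on `𝔤`
(`lintegral_dirichlet_div_symbol`). -/

/-! ### Fourier duality and weak gradients in `L²` -/

theorem integral_mul_fourier (u : L2 d) (χ : 𝓢(Vel d, ℂ)) :
    ∫ v, u v * (𝓕 χ) v = ∫ ξ, (𝓕 u : L2 d) ξ * χ ξ := by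
  have h := congrArg (fun T : 𝓢'(Vel d, ℂ) => T χ) (Lp.fourier_toTemperedDistribution_eq u)
  simp only [TemperedDistribution.fourier_apply, Lp.toTemperedDistribution_apply, smul_eq_mul] at h
  simpa only [mul_comm] using h

theorem inner_basisVec (ξ : Vel d) (j : Fin d) : inner ℝ ξ (basisVec j) = ξ j := by
  simp [basisVec, EuclideanSpace.inner_single_right]

theorem lineDeriv_fourier_apply (χ : 𝓢(Vel d, ℂ)) (m : Vel d) :
    ∂_{m} (𝓕 χ) = 𝓕 (-(2 * Real.pi * Complex.I) •
      SchwartzMap.smulLeftCLM ℂ (fun ξ : Vel d => ((inner ℝ ξ m : ℝ) : ℂ)) χ) := by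
  rw [SchwartzMap.lineDerivOp_fourier_eq]
  congr 2
  exact (SchwartzMap.smulLeftCLM_ofReal ℂ (by fun_prop) χ).symm

theorem integral_mul_lineDeriv_fourier (u : L2 d) (χ : 𝓢(Vel d, ℂ)) (m : Vel d) :
    ∫ v, u v * (∂_{m} (𝓕 χ)) v =
      ∫ ξ, (𝓕 u : L2 d) ξ * (-(2 * Real.pi * Complex.I) * (inner ℝ ξ m : ℝ) * χ ξ) := by
  rw [lineDeriv_fourier_apply, integral_mul_fourier]
  congr 1; ext ξ
  have : (fun ξ : Vel d => ((inner ℝ ξ m : ℝ) : ℂ)).HasTemperateGrowth := by fun_prop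
  rw [smul_apply, SchwartzMap.smulLeftCLM_apply_apply this]
  simp only [smul_eq_mul]
  ring

theorem L2.locallyIntegrable (u : L2 d) : LocallyIntegrable u volume :=
  (Lp.memLp u).locallyIntegrable (by norm_num)

/-- The distributional identity is tested on Fourier transforms of smooth compactly supported
functions; these already determine a locally integrable function almost everywhere. -/
theorem fourier_weakGradient {u : L2 d} {G : Fin d → L2 d} (h : IsWeakGradient u G) (j : Fin d) :
    ∀ᵐ ξ : Vel d, (𝓕 (G j) : L2 d) ξ = 2 * Real.pi * Complex.I * (ξ j : ℂ) * (𝓕 u : L2 d) ξ := by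
  have hl : LocallyIntegrable (fun ξ : Vel d =>
      2 * Real.pi * Complex.I * (ξ j : ℂ) * (𝓕 u : L2 d) ξ) := by
    have := (locallyIntegrableOn_univ.2 (L2.locallyIntegrable (𝓕 u : L2 d))).continuousOn_mul
      (g := fun ξ : Vel d => 2 * Real.pi * Complex.I * (ξ j : ℂ)) (by fun_prop) isOpen_univ.isLocallyClosed
    exact locallyIntegrableOn_univ.1 this
  refine ae_eq_of_integral_contDiff_smul_eq (L2.locallyIntegrable _) hl fun g hg hgc => ?_
  have hg' : ContDiff ℝ ∞ (fun x => (g x : ℂ)) := Complex.ofRealCLM.contDiff.comp hg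
  have hgc' : HasCompactSupport (fun x => (g x : ℂ)) := hgc.comp_left (g := Complex.ofReal) rfl
  set χ : 𝓢(Vel d, ℂ) := hgc'.toSchwartzMap hg' with hχ
  have h1 := congrArg (fun T : 𝓢'(Vel d, ℂ) => T (𝓕 χ)) (h j)
  simp only [TemperedDistribution.lineDerivOp_apply_apply, Lp.toTemperedDistribution_apply,
    smul_eq_mul] at h1
  have h2 := integral_mul_lineDeriv_fourier u χ (basisVec j)
  have h3 := integral_mul_fourier (G j) χ
  simp only [inner_basisVec] at h2
  calc ∫ x, g x • (𝓕 (G j) : L2 d) x = ∫ ξ, (𝓕 (G j) : L2 d) ξ * χ ξ := by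
        congr 1; ext ξ; simp [hχ, mul_comm]
    _ = ∫ v, (𝓕 χ) v * G j v := by rw [← h3]; simp only [mul_comm]
    _ = -∫ v, u v * (∂_{basisVec j} (𝓕 χ)) v := by
        rw [← h1, ← integral_neg]; congr 1; ext v; simp [mul_comm]
    _ = _ := by
        rw [h2, ← integral_neg]; congr 1; ext ξ; simp [hχ]; ring

/-! ### Tensor products and Laplacians of Schwartz functions -/

/-- The tensor product of two Schwartz functions. -/
def tensor (f g : 𝓢(Vel d, ℂ)) : 𝓢(Vel d × Vel d, ℂ) where
  toFun p := f p.1 * g p.2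
  smooth' := ((f.smooth ⊤).comp contDiff_fst).mul ((g.smooth ⊤).comp contDiff_snd)
  decay' k n := by
    have hf : ∀ i (p : Vel d × Vel d), ‖iteratedFDeriv ℝ i (fun p : Vel d × Vel d => f p.1) p‖
        ≤ ‖iteratedFDeriv ℝ i f p.1‖ := by
      intro i p
      have h := (ContinuousLinearMap.fst ℝ (Vel d) (Vel d)).iteratedFDeriv_comp_right
        (f.smooth ⊤) p (i := i) (by exact_mod_cast le_top)
      have h2 := ContinuousMultilinearMap.norm_compContinuousLinearMap_le
        (iteratedFDeriv ℝ i f p.1) (fun _ : Fin i => ContinuousLinearMap.fst ℝ (Vel d) (Vel d))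
      calc _ = ‖iteratedFDeriv ℝ i (f ∘ ContinuousLinearMap.fst ℝ (Vel d) (Vel d)) p‖ := rfl
        _ ≤ _ := by
          rw [h]
          refine h2.trans (mul_le_of_le_one_right (norm_nonneg _) ?_)
          exact Finset.prod_le_one (fun _ _ => norm_nonneg _)
            (fun _ _ => ContinuousLinearMap.norm_fst_le ℝ _ _)
    have hg : ∀ i (p : Vel d × Vel d), ‖iteratedFDeriv ℝ i (fun p : Vel d × Vel d => g p.2) p‖
        ≤ ‖iteratedFDeriv ℝ i g p.2‖ := by
      intro i p
      have h := (ContinuousLinearMap.snd ℝ (Vel d) (Vel d)).iteratedFDeriv_comp_right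
        (g.smooth ⊤) p (i := i) (by exact_mod_cast le_top)
      have h2 := ContinuousMultilinearMap.norm_compContinuousLinearMap_le
        (iteratedFDeriv ℝ i g p.2) (fun _ : Fin i => ContinuousLinearMap.snd ℝ (Vel d) (Vel d))
      calc _ = ‖iteratedFDeriv ℝ i (g ∘ ContinuousLinearMap.snd ℝ (Vel d) (Vel d)) p‖ := rfl
        _ ≤ _ := by
          rw [h]
          refine h2.trans (mul_le_of_le_one_right (norm_nonneg _) ?_)
          exact Finset.prod_le_one (fun _ _ => norm_nonneg _)
            (fun _ _ => ContinuousLinearMap.norm_snd_le ℝ _ _)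
    choose Cf hCf using fun k i => f.decay k i
    choose Cg hCg using fun k i => g.decay k i
    refine ⟨∑ i ∈ Finset.range (n + 1), (n.choose i : ℝ) *
      (Cf k i * Cg 0 (n - i) + Cf 0 i * Cg k (n - i)), fun p => ?_⟩
    have h1 := norm_iteratedFDeriv_mul_le (𝕜 := ℝ) (n := n) (N := (⊤ : ℕ∞))
      ((f.smooth ⊤).comp contDiff_fst : ContDiff ℝ _ (fun p : Vel d × Vel d => f p.1))
      ((g.smooth ⊤).comp contDiff_snd : ContDiff ℝ _ (fun p : Vel d × Vel d => g p.2)) p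
      (by exact_mod_cast le_top)
    -- The product carries the maximum norm, so a single factor accounts for the whole power.
    have hmax : ‖p‖ ^ k ≤ ‖p.1‖ ^ k + ‖p.2‖ ^ k := by
      rcases max_choice ‖p.1‖ ‖p.2‖ with h | h <;> rw [Prod.norm_def, h] <;>
        nlinarith [pow_nonneg (norm_nonneg p.1) k, pow_nonneg (norm_nonneg p.2) k]
    calc _ ≤ ‖p‖ ^ k * ∑ i ∈ Finset.range (n + 1), (n.choose i : ℝ) *
          ‖iteratedFDeriv ℝ i f p.1‖ * ‖iteratedFDeriv ℝ (n - i) g p.2‖ := by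
          refine mul_le_mul_of_nonneg_left (h1.trans ?_) (by positivity)
          gcongr with i hi
          · exact hf i p
          · exact hg _ p
      _ = ∑ i ∈ Finset.range (n + 1), (n.choose i : ℝ) * (‖p‖ ^ k *
          (‖iteratedFDeriv ℝ i f p.1‖ * ‖iteratedFDeriv ℝ (n - i) g p.2‖)) := by
          rw [Finset.mul_sum]; congr 1; ext i; ring
      _ ≤ _ := by
          gcongr with i hi
          have a1 := (hCf k i).2 p.1
          have a2 := (hCf 0 i).2 p.1
          have b1 := (hCg k (n - i)).2 p.2
          have b2 := (hCg 0 (n - i)).2 p.2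
          simp only [pow_zero, one_mul] at a2 b2
          calc _ ≤ (‖p.1‖ ^ k + ‖p.2‖ ^ k) *
              (‖iteratedFDeriv ℝ i f p.1‖ * ‖iteratedFDeriv ℝ (n - i) g p.2‖) := by gcongr
            _ = (‖p.1‖ ^ k * ‖iteratedFDeriv ℝ i f p.1‖) * ‖iteratedFDeriv ℝ (n - i) g p.2‖ +
              ‖iteratedFDeriv ℝ i f p.1‖ * (‖p.2‖ ^ k * ‖iteratedFDeriv ℝ (n - i) g p.2‖) := by
                ring
            _ ≤ _ := by
                have := (hCf 0 i).1.le
                have := (hCf k i).1.le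
                gcongr

@[simp]
theorem tensor_apply (f g : 𝓢(Vel d, ℂ)) (p : Vel d × Vel d) : tensor f g p = f p.1 * g p.2 := rfl

theorem lineDeriv_tensor_left (f g : 𝓢(Vel d, ℂ)) (m : Vel d) :
    ∂_{((m, 0) : Vel d × Vel d)} (tensor f g) = tensor (∂_{m} f) g := by
  ext p
  rw [SchwartzMap.lineDerivOp_apply, tensor_apply, SchwartzMap.lineDerivOp_apply]
  simp only [lineDeriv, tensor_apply, Prod.fst_add, Prod.snd_add, Prod.smul_fst, Prod.smul_snd,
    smul_zero, add_zero, deriv_mul_const_field']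

theorem lineDeriv_tensor_right (f g : 𝓢(Vel d, ℂ)) (m : Vel d) :
    ∂_{((0, m) : Vel d × Vel d)} (tensor f g) = tensor f (∂_{m} g) := by
  ext p
  rw [SchwartzMap.lineDerivOp_apply, tensor_apply, SchwartzMap.lineDerivOp_apply]
  simp only [lineDeriv, tensor_apply, Prod.fst_add, Prod.snd_add, Prod.smul_fst, Prod.smul_snd,
    smul_zero, add_zero, deriv_const_mul_field']

/-- The Laplacian of a Schwartz function, in coordinates. -/
def coordLaplacian (f : 𝓢(Vel d, ℂ)) : 𝓢(Vel d, ℂ) :=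
  ∑ j : Fin d, ∂_{(basisVec j : Vel d)} (∂_{(basisVec j : Vel d)} f)

theorem pairLaplacian_tensor (f g : 𝓢(Vel d, ℂ)) (p : Vel d × Vel d) :
    pairLaplacian (tensor f g) p = coordLaplacian f p.1 * g p.2 +
      f p.1 * coordLaplacian g p.2 := by
  simp only [pairLaplacian, coordLaplacian, lineDeriv_tensor_left, lineDeriv_tensor_right, sum_apply,
    add_apply, tensor_apply, Finset.sum_add_distrib, Finset.sum_mul, Finset.mul_sum]

/-- Multiplication of a Schwartz function by `‖ξ‖ ^ 2`. -/
def normSqMul (χ : 𝓢(Vel d, ℂ)) : 𝓢(Vel d, ℂ) :=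
  SchwartzMap.smulLeftCLM ℂ (fun ξ : Vel d => ((‖ξ‖ ^ 2 : ℝ) : ℂ)) χ

theorem normSqMul_apply (χ : 𝓢(Vel d, ℂ)) (ξ : Vel d) :
    normSqMul χ ξ = ((‖ξ‖ ^ 2 : ℝ) : ℂ) * χ ξ := by
  have : (fun ξ : Vel d => ((‖ξ‖ ^ 2 : ℝ) : ℂ)).HasTemperateGrowth := by fun_prop
  rw [normSqMul, SchwartzMap.smulLeftCLM_apply_apply this, smul_eq_mul]

theorem coordLaplacian_fourier (χ : 𝓢(Vel d, ℂ)) :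
    coordLaplacian (𝓕 χ) = (-(4 * Real.pi ^ 2 : ℝ) : ℂ) • 𝓕 (normSqMul χ) := by
  rw [← FourierTransform.fourier_smul]
  simp only [coordLaplacian, lineDeriv_fourier_apply]
  rw [← FourierTransform.fourier_sum]
  congr 1
  ext ξ
  rw [sum_apply, smul_apply, normSqMul_apply]
  have : ∀ (j : Fin d) (χ : 𝓢(Vel d, ℂ)) (ξ : Vel d), SchwartzMap.smulLeftCLM ℂ
      (fun ξ : Vel d => ((inner ℝ ξ (basisVec j) : ℝ) : ℂ)) χ ξ = (ξ j : ℂ) * χ ξ := fun j χ ξ => by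
    rw [SchwartzMap.smulLeftCLM_apply_apply (by fun_prop), inner_basisVec, smul_eq_mul]
  simp only [smul_apply, this,
    EuclideanSpace.norm_sq_eq, smul_eq_mul, Complex.ofReal_sum, Finset.sum_mul, Finset.mul_sum]
  refine Finset.sum_congr rfl fun j _ => ?_
  have hI := Complex.I_sq
  simp only [Real.norm_eq_abs, sq_abs, Complex.ofReal_mul, Complex.ofReal_pow, Complex.ofReal_ofNat]
  linear_combination (4 * Real.pi ^ 2 * (ξ j : ℂ) ^ 2 * χ ξ) * hI

theorem fourier_lineDeriv_apply (χ : 𝓢(Vel d, ℂ)) (m v : Vel d) :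
    𝓕 (∂_{m} χ) v = 2 * Real.pi * Complex.I * (inner ℝ v m : ℝ) * 𝓕 χ v := by
  rw [SchwartzMap.fourier_lineDerivOp_eq, smul_apply,
    SchwartzMap.smulLeftCLM_apply_apply (by fun_prop)]
  simp only [smul_eq_mul, Complex.real_smul]
  ring

/-! ### Time derivatives of curves in `L²` -/

theorem eLpNorm_le_of_support_closedBall {f : Vel d → ℂ} {ε R : ℝ}
    (h : ∀ ξ, ‖f ξ‖ ≤ ε) (hs : ∀ ξ, R < ‖ξ‖ → f ξ = 0) :
    eLpNorm f 2 volume ≤ ENNReal.ofReal ε *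
      (volume (Metric.closedBall (0 : Vel d) R)) ^ (2⁻¹ : ℝ) := by
  have : f = (Metric.closedBall (0 : Vel d) R).indicator f := by
    ext ξ
    by_cases hξ : ξ ∈ Metric.closedBall (0 : Vel d) R
    · rw [indicator_of_mem hξ]
    · rw [indicator_of_notMem hξ]
      exact hs ξ (by simpa using hξ)
  rw [this, eLpNorm_indicator_eq_eLpNorm_restrict measurableSet_closedBall]
  refine (eLpNorm_le_of_ae_bound (C := ε) (ae_of_all _ h)).trans ?_
  rw [mul_comm]
  simp

/-- By compactness the time derivative is, on the common ball, uniformly close to its value at `t₀`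
for `t` near `t₀`. The mean value inequality makes the difference quotients converge uniformly, and
the finite volume of the ball turns this into convergence in `L²`. -/
theorem hasDerivAt_toLp (X X' : ℝ → 𝓢(Vel d, ℂ))
    (hX : ∀ t ξ, HasDerivAt (fun t => X t ξ) (X' t ξ) t)
    (hcont : Continuous (fun p : ℝ × Vel d => X' p.1 p.2)) (t₀ R : ℝ)
    (hsupp : ∀ t ∈ Metric.ball t₀ 1, ∀ ξ, R < ‖ξ‖ → X t ξ = 0) :
    HasDerivAt (fun t => ((X t).toLp 2 : L2 d)) ((X' t₀).toLp 2) t₀ := by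
  have hsupp' : ∀ t ∈ Metric.ball t₀ 1, ∀ ξ, R < ‖ξ‖ → X' t ξ = 0 := by
    intro t ht ξ hξ
    have h0 : HasDerivAt (fun t => X t ξ) 0 t := by
      refine (hasDerivAt_const t (0 : ℂ)).congr_of_eventuallyEq ?_
      filter_upwards [Metric.isOpen_ball.mem_nhds ht] with s hs using hsupp s hs ξ hξ
    exact (hX t ξ).unique h0
  set V : ℝ := ((volume (Metric.closedBall (0 : Vel d) R)) ^ (2⁻¹ : ℝ)).toReal with hV
  have hVfin : (volume (Metric.closedBall (0 : Vel d) R)) ^ (2⁻¹ : ℝ) ≠ ⊤ :=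
    ENNReal.rpow_ne_top_of_nonneg (by norm_num) measure_closedBall_lt_top.ne
  rw [hasDerivAt_iff_isLittleO, Asymptotics.isLittleO_iff]
  intro c hc
  obtain ⟨ε, hε, hεc⟩ : ∃ ε : ℝ, 0 < ε ∧ ε * V ≤ c := by
    refine ⟨c / (V + 1), by positivity, ?_⟩
    rw [div_mul_eq_mul_div, div_le_iff₀ (by positivity)]
    nlinarith [show 0 ≤ V from ENNReal.toReal_nonneg]
  have hunif : ∀ᶠ t in nhds t₀, ∀ ξ ∈ Metric.closedBall (0 : Vel d) R,
      ‖X' t ξ - X' t₀ ξ‖ < ε := by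
    refine (isCompact_closedBall (0 : Vel d) R).eventually_forall_of_forall_eventually ?_
    intro ξ _
    have hc2 : Continuous fun p : ℝ × Vel d => ‖X' p.1 p.2 - X' t₀ p.2‖ := by
      have : Continuous fun p : ℝ × Vel d => X' t₀ p.2 := (X' t₀).continuous.comp continuous_snd
      fun_prop
    have := hc2.tendsto (t₀, ξ)
    simp only [sub_self, norm_zero] at this
    exact this.eventually_lt_const hε
  obtain ⟨δ, hδ, hδu⟩ := Metric.eventually_nhds_iff_ball.1 hunif
  filter_upwards [Metric.ball_mem_nhds t₀ (lt_min hδ one_pos)] with t ht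
  have hpt : ∀ ξ, ‖X t ξ - X t₀ ξ - ((t - t₀ : ℝ) : ℂ) * X' t₀ ξ‖ ≤ ε * |t - t₀| := by
    intro ξ
    by_cases hξ : ξ ∈ Metric.closedBall (0 : Vel d) R
    · have hconv : Convex ℝ (Metric.ball t₀ (min δ 1)) := convex_ball _ _
      have h := hconv.norm_image_sub_le_of_norm_hasDerivWithin_le (𝕜 := ℝ)
        (f := fun s => X s ξ - ((s - t₀ : ℝ) : ℂ) * X' t₀ ξ)
        (f' := fun s => X' s ξ - X' t₀ ξ) (C := ε) (x := t₀) (y := t)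
        (fun s _ => by
          have h1 : HasDerivAt (fun s : ℝ => ((s - t₀ : ℝ) : ℂ) * X' t₀ ξ) (X' t₀ ξ) s := by
            simpa using ((hasDerivAt_id s).sub_const t₀).ofReal_comp.mul_const (X' t₀ ξ)
          exact ((hX s ξ).sub h1).hasDerivWithinAt)
        (fun s hs => (hδu s (Metric.ball_subset_ball (min_le_left _ _) hs) ξ hξ).le)
        (Metric.mem_ball_self (lt_min hδ one_pos)) ht
      simp only [sub_self, Complex.ofReal_zero, zero_mul, sub_zero, Real.norm_eq_abs] at h
      calc _ = ‖X t ξ - ((t - t₀ : ℝ) : ℂ) * X' t₀ ξ - X t₀ ξ‖ := by congr 1; ring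
        _ ≤ _ := h
    · have hξ' : R < ‖ξ‖ := by simpa using hξ
      have ht1 : t ∈ Metric.ball t₀ 1 := Metric.ball_subset_ball (min_le_right _ _) ht
      have ht0 : t₀ ∈ Metric.ball t₀ 1 := Metric.mem_ball_self one_pos
      rw [hsupp t ht1 ξ hξ', hsupp t₀ ht0 ξ hξ', hsupp' t₀ ht0 ξ hξ']
      simp; positivity
  have hrep : (X t).toLp 2 volume - (X t₀).toLp 2 volume - (t - t₀) • (X' t₀).toLp 2 volume =
      (X t - X t₀ - (t - t₀) • X' t₀).toLp 2 (volume : Measure (Vel d)) := by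
    have e : ∀ f : 𝓢(Vel d, ℂ), f.toLp 2 =
      SchwartzMap.toLpCLM ℝ ℂ 2 (volume : Measure (Vel d)) f := fun f => rfl
    simp only [e, map_sub, map_smul]
  rw [hrep, SchwartzMap.norm_toLp]
  have hle : eLpNorm (X t - X t₀ - (t - t₀) • X' t₀ : 𝓢(Vel d, ℂ)) 2 volume ≤ _ :=
    eLpNorm_le_of_support_closedBall (ε := ε * |t - t₀|) (R := R) (fun ξ => by
      simpa using hpt ξ) (fun ξ hξ => by
      have ht1 : t ∈ Metric.ball t₀ 1 := Metric.ball_subset_ball (min_le_right _ _) ht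
      have ht0 : t₀ ∈ Metric.ball t₀ 1 := Metric.mem_ball_self one_pos
      simp [hsupp t ht1 ξ hξ, hsupp t₀ ht0 ξ hξ, hsupp' t₀ ht0 ξ hξ])
  calc _ ≤ (ENNReal.ofReal (ε * |t - t₀|) *
        (volume (Metric.closedBall (0 : Vel d) R)) ^ (2⁻¹ : ℝ)).toReal :=
        ENNReal.toReal_mono (ENNReal.mul_ne_top ENNReal.ofReal_ne_top hVfin) hle
    _ = ε * |t - t₀| * V := by
        rw [ENNReal.toReal_mul, ENNReal.toReal_ofReal (by positivity)]
    _ ≤ c * ‖t - t₀‖ := by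
        rw [Real.norm_eq_abs]
        nlinarith [abs_nonneg (t - t₀)]

/-! ### Damped transport and its phase -/

/-- `∫_0^t ‖ξ - r k‖ ^ 2 dr`. -/
def phase (t : ℝ) (k ξ : Vel d) : ℝ := t * ‖ξ‖ ^ 2 - t ^ 2 * inner ℝ ξ k + t ^ 3 * ‖k‖ ^ 2 / 3

/-- The trapezoidal rule with its exact error term. Positivity follows since the parallelogram
identity gives `‖ξ‖² + ‖ξ - t k‖² ≥ t² ‖k‖² / 2`; the upper bound `phase_le` follows by dropping the
error. -/
theorem phase_eq (t : ℝ) (k ξ : Vel d) :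
    phase t k ξ = t * ((‖ξ‖ ^ 2 + ‖ξ - t • k‖ ^ 2) / 2 - t ^ 2 * ‖k‖ ^ 2 / 6) := by
  rw [norm_sub_sq_real, inner_smul_right, norm_smul, mul_pow, Real.norm_eq_abs, sq_abs, phase]
  ring

theorem phase_nonneg {t : ℝ} (ht : 0 ≤ t) (k ξ : Vel d) : 0 ≤ phase t k ξ := by
  rw [phase_eq]
  refine mul_nonneg ht ?_
  have h := parallelogram_law_with_norm ℝ ξ (t • k - ξ)
  rw [add_sub_cancel, norm_smul, Real.norm_eq_abs, norm_sub_rev (t • k) ξ] at h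
  have h2 : |t| * ‖k‖ * (|t| * ‖k‖) = t ^ 2 * ‖k‖ ^ 2 := by rw [← sq_abs t]; ring
  nlinarith [mul_self_nonneg ‖ξ - (t • k - ξ)‖]

theorem phase_le {t : ℝ} (ht : 0 ≤ t) (k ξ : Vel d) :
    phase t k ξ ≤ t * (‖ξ‖ ^ 2 + ‖ξ - t • k‖ ^ 2) := by
  rw [phase_eq]
  refine mul_le_mul_of_nonneg_left ?_ ht
  nlinarith [sq_nonneg ‖ξ‖, sq_nonneg ‖ξ - t • k‖, sq_nonneg (t * ‖k‖)]

@[fun_prop]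
theorem continuous_phase : Continuous fun p : ℝ × Vel d × Vel d => phase p.1 p.2.1 p.2.2 := by
  unfold phase; fun_prop

theorem phase_zero (k ξ : Vel d) : phase 0 k ξ = 0 := by simp [phase]

/-- Splitting the time integral at `r`: this cocycle identity is what makes damped transport a
semigroup. -/
theorem phase_add (t r : ℝ) (k ξ : Vel d) :
    phase (t + r) k ξ = phase r k ξ + phase t k (ξ - r • k) := by
  simp only [phase, norm_sub_sq_real, inner_sub_left, inner_smul_left, inner_smul_right, norm_smul, mul_pow,
    Real.norm_eq_abs, sq_abs, real_inner_self_eq_norm_sq, RCLike.conj_to_real]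
  ring

/-- The function `χ` transported by `t k` and damped at rate `s ‖ξ‖ ^ 2`. -/
def transport (s : ℝ) (k : Vel d) (χ : Vel d → ℂ) (t : ℝ) (ξ : Vel d) : ℂ :=
  (Real.exp (-(s * phase t k ξ)) : ℂ) * χ (ξ - t • k)

theorem contDiff_transport (s : ℝ) (k : Vel d) {χ : Vel d → ℂ} (hχ : ContDiff ℝ ∞ χ) :
    ContDiff ℝ ∞ (fun p : ℝ × Vel d => transport s k χ p.1 p.2) := by
  unfold transport phase
  refine ContDiff.mul ?_ (hχ.comp (by fun_prop))
  refine Complex.ofRealCLM.contDiff.comp (Real.contDiff_exp.comp ?_)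
  have : ContDiff ℝ ∞ fun p : ℝ × Vel d => ‖p.2‖ ^ 2 := (contDiff_norm_sq ℝ).comp contDiff_snd
  have : ContDiff ℝ ∞ fun p : ℝ × Vel d => inner ℝ p.2 k := contDiff_snd.inner ℝ contDiff_const
  fun_prop

theorem transport_eq_zero {s : ℝ} {k : Vel d} {χ : Vel d → ℂ} {R : ℝ}
    (hR : ∀ ξ, R < ‖ξ‖ → χ ξ = 0) {t : ℝ} {ξ : Vel d} (h : R + |t| * ‖k‖ < ‖ξ‖) :
    transport s k χ t ξ = 0 := by
  rw [transport, hR, mul_zero]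
  have := norm_sub_norm_le ξ (t • k)
  rw [norm_smul, Real.norm_eq_abs] at this
  linarith

theorem hasCompactSupport_of_eq_zero {χ : Vel d → ℂ} {R : ℝ} (hR : ∀ ξ, R < ‖ξ‖ → χ ξ = 0) :
    HasCompactSupport χ :=
  HasCompactSupport.intro (isCompact_closedBall (0 : Vel d) R) fun ξ hξ => hR ξ (by simpa using hξ)

theorem exists_eq_zero_of_hasCompactSupport {χ : Vel d → ℂ} (h : HasCompactSupport χ) :
    ∃ R : ℝ, ∀ ξ, R < ‖ξ‖ → χ ξ = 0 := by
  obtain ⟨R, hR⟩ := h.isCompact.isBounded.subset_closedBall (0 : Vel d)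
  refine ⟨R, fun ξ hξ => ?_⟩
  by_contra h0
  have := hR (subset_tsupport χ h0)
  simp at this
  linarith

theorem hasCompactSupport_transport (s : ℝ) (k : Vel d) {χ : Vel d → ℂ} (h : HasCompactSupport χ)
    (t : ℝ) : HasCompactSupport (transport s k χ t) := by
  obtain ⟨R, hR⟩ := exists_eq_zero_of_hasCompactSupport h
  exact hasCompactSupport_of_eq_zero fun ξ hξ => transport_eq_zero hR hξ

/-- `transport` of a smooth compactly supported function, as a Schwartz function. -/
def transportS (s : ℝ) (k : Vel d) (χ : 𝓢(Vel d, ℂ)) (h : HasCompactSupport χ) (t : ℝ) :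
    𝓢(Vel d, ℂ) :=
  (hasCompactSupport_transport s k h t).toSchwartzMap
    ((contDiff_transport s k (χ.smooth ⊤)).comp (contDiff_prodMk_right t))

theorem transportS_apply (s : ℝ) (k : Vel d) (χ : 𝓢(Vel d, ℂ)) (h : HasCompactSupport χ) (t : ℝ)
    (ξ : Vel d) : transportS s k χ h t ξ = transport s k χ t ξ := rfl

/-- The time derivative of `transportS`. -/
def transportDeriv (s : ℝ) (k : Vel d) (χ : 𝓢(Vel d, ℂ)) (h : HasCompactSupport χ) (t : ℝ) :
    𝓢(Vel d, ℂ) :=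
  -∂_{k} (transportS s k χ h t) - (s : ℂ) • normSqMul (transportS s k χ h t)

theorem hasDerivAt_phase (t : ℝ) (k ξ : Vel d) :
    HasDerivAt (fun t => phase t k ξ) (‖ξ - t • k‖ ^ 2) t := by
  unfold phase
  have h := (((hasDerivAt_id t).mul_const (‖ξ‖ ^ 2)).sub
    ((hasDerivAt_pow 2 t).mul_const (inner ℝ ξ k))).add
    (((hasDerivAt_pow 3 t).mul_const (‖k‖ ^ 2)).div_const 3)
  refine h.congr_deriv ?_
  rw [norm_sub_sq_real, inner_smul_right, norm_smul, mul_pow, Real.norm_eq_abs, sq_abs]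
  push_cast; ring

theorem hasDerivAt_phase_line (t r : ℝ) (k ξ : Vel d) :
    HasDerivAt (fun r : ℝ => phase t k (ξ + r • k))
      (‖ξ + r • k‖ ^ 2 - ‖ξ + r • k - t • k‖ ^ 2) r := by
  unfold phase
  simp only [norm_add_sq_real, norm_sub_sq_real, inner_add_left, inner_smul_left, inner_smul_right,
    norm_smul, mul_pow, Real.norm_eq_abs, sq_abs, real_inner_self_eq_norm_sq, RCLike.conj_to_real]
  have h := ((((hasDerivAt_id r).const_mul 2 |>.mul_const (inner ℝ ξ k)).const_add (‖ξ‖ ^ 2)).add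
    ((hasDerivAt_pow 2 r).mul_const (‖k‖ ^ 2)) |>.const_mul t).sub
    (((hasDerivAt_id r).mul_const (‖k‖ ^ 2)).const_add (inner ℝ ξ k) |>.const_mul (t ^ 2))
    |>.add_const (t ^ 3 * ‖k‖ ^ 2 / 3)
  refine (h.congr_of_eventuallyEq (Filter.Eventually.of_forall fun r => ?_)).congr_deriv ?_
  · simp only [Pi.sub_apply, Pi.add_apply, id]; ring
  · push_cast; ring

/-- The transport equation `∂ₜ X = -k · ∇X - s ‖ξ‖² X`. The phase grows at rate `‖ξ - t k‖²` in time
and at rate `‖ξ‖² - ‖ξ - t k‖²` in the direction `k`; the two rates add up to `‖ξ‖²`. -/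
theorem hasDerivAt_transportS (s : ℝ) (k : Vel d) (χ : 𝓢(Vel d, ℂ)) (h : HasCompactSupport χ)
    (t : ℝ) (ξ : Vel d) :
    HasDerivAt (fun t => transportS s k χ h t ξ) (transportDeriv s k χ h t ξ) t := by
  have hd : ∂_{k} (transportS s k χ h t) ξ =
      ((-(s * (‖ξ‖ ^ 2 - ‖ξ - t • k‖ ^ 2)) : ℝ) : ℂ) * transport s k χ t ξ +
      (Real.exp (-(s * phase t k ξ)) : ℂ) * (fderiv ℝ χ (ξ - t • k)) k := by
    rw [SchwartzMap.lineDerivOp_apply]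
    have h1 := hasDerivAt_phase_line t 0 k ξ
    have h2 : HasDerivAt (fun r : ℝ => χ (ξ + r • k - t • k)) ((fderiv ℝ χ (ξ - t • k)) k) 0 := by
      have h3 : HasDerivAt (fun r : ℝ => ξ + r • k - t • k) k 0 := by
        simpa using (((hasDerivAt_id (0 : ℝ)).smul_const k).const_add ξ).sub_const (t • k)
      have h4 := (χ.hasFDerivAt (ξ + (0 : ℝ) • k - t • k)).comp_hasDerivAt (0 : ℝ) h3
      simp only [zero_smul, add_zero] at h4
      exact h4
    have h5 := ((h1.const_mul s).neg.exp.ofReal_comp).mul h2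
    simp only [zero_smul, add_zero] at h5
    rw [lineDeriv]
    refine (HasDerivAt.deriv h5).trans ?_
    simp only [transport, Pi.neg_apply, zero_smul, add_zero]
    push_cast; ring
  have h3 : HasDerivAt (fun t : ℝ => ξ - t • k) (-k) t := by
    simpa using ((hasDerivAt_id t).smul_const k).const_sub ξ
  have h4 := (χ.hasFDerivAt (ξ - t • k)).comp_hasDerivAt t h3
  have h5 := ((hasDerivAt_phase t k ξ).const_mul s).neg.exp.ofReal_comp.mul h4
  refine h5.congr_deriv ?_
  simp only [transportDeriv, sub_apply, neg_apply, smul_apply, hd, normSqMul_apply,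
    transportS_apply, transport, map_neg, smul_eq_mul]
  simp only [Function.comp, Pi.neg_apply]
  push_cast
  ring

theorem hasDerivAt_toLp_transportS (s : ℝ) (k : Vel d) (χ : 𝓢(Vel d, ℂ)) (h : HasCompactSupport χ)
    (t : ℝ) : HasDerivAt (fun t => ((transportS s k χ h t).toLp 2 : L2 d))
      ((transportDeriv s k χ h t).toLp 2) t := by
  obtain ⟨R, hR⟩ := exists_eq_zero_of_hasCompactSupport h
  refine hasDerivAt_toLp _ _ (fun t ξ => hasDerivAt_transportS s k χ h t ξ) ?_ t
    (R + (|t| + 1) * ‖k‖) ?_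
  -- Joint continuity of the time derivative is read off from smoothness in `(t, ξ)` jointly.
  · have hF := contDiff_transport s k (χ.smooth ⊤)
    have hF' : Continuous fun p : ℝ × Vel d =>
        fderiv ℝ (fun p : ℝ × Vel d => transport s k χ p.1 p.2) p ((1 : ℝ), (0 : Vel d)) :=
      (hF.continuous_fderiv (by simp)).clm_apply continuous_const
    refine hF'.congr fun p => ?_
    have h1 := (hF.differentiable (by simp) p).hasFDerivAt
    have h2 : HasDerivAt (fun t : ℝ => (t, p.2)) ((1 : ℝ), (0 : Vel d)) p.1 :=
      (hasDerivAt_id p.1).prodMk (hasDerivAt_const p.1 p.2)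
    have h3 : HasDerivAt (fun t : ℝ => transport s k χ t p.2) _ p.1 :=
      HasFDerivAt.comp_hasDerivAt (f := fun t : ℝ => (t, p.2)) p.1 h1 h2
    exact h3.unique (hasDerivAt_transportS s k χ h p.1 p.2)
  · intro r hr ξ hξ
    refine transport_eq_zero hR (lt_of_le_of_lt ?_ hξ)
    have : |r| ≤ |t| + 1 := by
      rw [Metric.mem_ball, Real.dist_eq] at hr
      linarith [abs_sub_abs_le_abs_sub r t]
    gcongr

theorem norm_toLp_transportS_le {s : ℝ} (hs : 0 ≤ s) (k : Vel d) (χ : 𝓢(Vel d, ℂ))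
    (h : HasCompactSupport χ) {t : ℝ} (ht : 0 ≤ t) :
    ‖((transportS s k χ h t).toLp 2 : L2 d)‖ ≤ ‖(χ.toLp 2 : L2 d)‖ := by
  rw [SchwartzMap.norm_toLp, SchwartzMap.norm_toLp]
  refine ENNReal.toReal_mono (χ.memLp 2 volume).2.ne ?_
  have hmp := measurePreserving_sub_right (volume : Measure (Vel d)) (t • k)
  rw [← eLpNorm_comp_measurePreserving χ.continuous.aestronglyMeasurable hmp]
  refine eLpNorm_mono fun ξ => ?_
  rw [transportS_apply, transport, norm_mul, Complex.norm_real, Real.norm_eq_abs, Real.abs_exp]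
  refine mul_le_of_le_one_left (norm_nonneg _) (Real.exp_le_one_iff.2 ?_)
  have := phase_nonneg ht k ξ
  nlinarith

/-! ### Tensor products and bilinear pairings in `L²` -/

theorem memLp_tensor (a b : L2 d) :
    MemLp (fun p : Vel d × Vel d => a p.1 * b p.2) 2 volume := by
  have ha := Lp.aestronglyMeasurable a
  have hb := Lp.aestronglyMeasurable b
  have hm : AEStronglyMeasurable (fun p : Vel d × Vel d => a p.1 * b p.2) volume :=
    ha.comp_fst.mul hb.comp_snd
  rw [memLp_two_iff_integrable_sq_norm hm]
  have h := ((memLp_two_iff_integrable_sq_norm ha).1 (Lp.memLp a)).mul_prod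
    ((memLp_two_iff_integrable_sq_norm hb).1 (Lp.memLp b))
  refine h.congr (ae_of_all _ fun p => ?_)
  simp [mul_pow]

theorem L2_norm_sq {X : Type*} [MeasurableSpace X] {μ : Measure X} (a : Lp ℂ 2 μ) :
    ‖a‖ ^ 2 = ∫ x, ‖a x‖ ^ 2 ∂μ := by
  have h := L2.inner_def (𝕜 := ℂ) a a
  rw [inner_self_eq_norm_sq_to_K] at h
  have h2 : ∀ x, inner ℂ (a x) (a x) = ((‖a x‖ ^ 2 : ℝ) : ℂ) := fun x => by
    rw [inner_self_eq_norm_sq_to_K]; simp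
  simp only [h2, integral_complex_ofReal] at h
  rw [← Complex.ofReal_inj, ← h]
  simp

theorem norm_tensor (a b : L2 d) : ‖(memLp_tensor a b).toLp‖ = ‖a‖ * ‖b‖ := by
  have h : ‖(memLp_tensor a b).toLp‖ ^ 2 = (‖a‖ * ‖b‖) ^ 2 := by
    rw [L2_norm_sq, mul_pow, L2_norm_sq, L2_norm_sq, ← integral_prod_mul]
    refine integral_congr_ae ?_
    filter_upwards [(memLp_tensor a b).coeFn_toLp] with p hp
    rw [hp, norm_mul, mul_pow]
  exact (sq_eq_sq₀ (norm_nonneg _) (by positivity)).1 h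

theorem integrable_mul {X : Type*} [MeasurableSpace X] {μ : Measure X} (a b : Lp ℂ 2 μ) :
    Integrable (fun x => a x * b x) μ := (Lp.memLp a).integrable_mul (Lp.memLp b)

theorem norm_integral_mul_le {X : Type*} [MeasurableSpace X] {μ : Measure X} (a b : Lp ℂ 2 μ) :
    ‖∫ x, a x * b x ∂μ‖ ≤ ‖a‖ * ‖b‖ := by
  have h := norm_inner_le_norm (𝕜 := ℂ) (star a) b
  have hs : ‖star a‖ = ‖a‖ := by
    rw [Lp.norm_def, Lp.norm_def]
    congr 1
    refine eLpNorm_congr_norm_ae ?_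
    filter_upwards [Lp.coeFn_star a] with x hx
    rw [hx, Pi.star_apply, norm_star]
  rw [L2.inner_def, hs] at h
  have e : ∫ x, a x * b x ∂μ = ∫ x, inner ℂ ((star a : Lp ℂ 2 μ) x) (b x) ∂μ := by
    refine integral_congr_ae ?_
    filter_upwards [Lp.coeFn_star a] with x hx
    rw [hx]; simp [mul_comm]
  rw [e]
  exact h

/-- The bilinear pairing `∫ a b` with `a ∈ L²`. -/
def pairing {X : Type*} [MeasurableSpace X] {μ : Measure X} (a : Lp ℂ 2 μ) : Lp ℂ 2 μ →L[ℂ] ℂ :=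
  LinearMap.mkContinuous
    { toFun := fun b => ∫ x, a x * b x ∂μ
      map_add' := fun b c => by
        rw [← integral_add (integrable_mul a b) (integrable_mul a c)]
        refine integral_congr_ae ?_
        filter_upwards [Lp.coeFn_add b c] with x hx
        rw [hx, Pi.add_apply, mul_add]
      map_smul' := fun r b => by
        rw [RingHom.id_apply, smul_eq_mul, ← integral_const_mul (μ := μ) r]
        refine integral_congr_ae ?_
        filter_upwards [Lp.coeFn_smul r b] with x hx
        rw [hx, Pi.smul_apply, smul_eq_mul]; ring } ‖a‖ (norm_integral_mul_le a)

theorem pairing_apply {X : Type*} [MeasurableSpace X] {μ : Measure X} (a b : Lp ℂ 2 μ) :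
    pairing a b = ∫ x, a x * b x ∂μ := rfl

theorem ae_fst {p : Vel d → Prop} (h : ∀ᵐ x, p x) : ∀ᵐ x : Vel d × Vel d, p x.1 :=
  Measure.quasiMeasurePreserving_fst.ae h

theorem ae_snd {p : Vel d → Prop} (h : ∀ᵐ x, p x) : ∀ᵐ x : Vel d × Vel d, p x.2 :=
  Measure.quasiMeasurePreserving_snd.ae h

/-- The pairing of `h ∈ L²(ℝ^d × ℝ^d)` with tensor products. -/
def tensorPairing (h : L2Pair d) : L2 d →L[ℂ] L2 d →L[ℂ] ℂ :=
  LinearMap.mkContinuous₂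
    (LinearMap.mk₂ ℂ (fun a b => pairing h (memLp_tensor a b).toLp)
      (fun a a' b => by
        rw [← map_add]; congr 1; apply Lp.ext
        filter_upwards [(memLp_tensor (a + a') b).coeFn_toLp, (memLp_tensor a b).coeFn_toLp,
          (memLp_tensor a' b).coeFn_toLp, Lp.coeFn_add (memLp_tensor a b).toLp
          (memLp_tensor a' b).toLp, ae_fst (Lp.coeFn_add a a')] with p h1 h2 h3 h4 h5
        rw [h1, h4, Pi.add_apply, h2, h3, h5, Pi.add_apply, add_mul])
      (fun c a b => by
        rw [← map_smul]; congr 1; apply Lp.ext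
        filter_upwards [(memLp_tensor (c • a) b).coeFn_toLp, (memLp_tensor a b).coeFn_toLp,
          Lp.coeFn_smul c (memLp_tensor a b).toLp, ae_fst (Lp.coeFn_smul c a)] with p h1 h2 h3 h4
        rw [h1, h3, Pi.smul_apply, h2, h4, Pi.smul_apply, smul_mul_assoc])
      (fun a b b' => by
        rw [← map_add]; congr 1; apply Lp.ext
        filter_upwards [(memLp_tensor a (b + b')).coeFn_toLp, (memLp_tensor a b).coeFn_toLp,
          (memLp_tensor a b').coeFn_toLp, Lp.coeFn_add (memLp_tensor a b).toLp
          (memLp_tensor a b').toLp, ae_snd (Lp.coeFn_add b b')] with p h1 h2 h3 h4 h5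
        rw [h1, h4, Pi.add_apply, h2, h3, h5, Pi.add_apply, mul_add])
      (fun c a b => by
        rw [← map_smul]; congr 1; apply Lp.ext
        filter_upwards [(memLp_tensor a (c • b)).coeFn_toLp, (memLp_tensor a b).coeFn_toLp,
          Lp.coeFn_smul c (memLp_tensor a b).toLp, ae_snd (Lp.coeFn_smul c b)] with p h1 h2 h3 h4
        rw [h1, h3, Pi.smul_apply, h2, h4, Pi.smul_apply, mul_smul_comm]))
    ‖h‖ (fun a b => by
      rw [LinearMap.mk₂_apply, mul_assoc, ← norm_tensor]
      exact norm_integral_mul_le _ _)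

theorem tensorPairing_apply (h : L2Pair d) (a b : L2 d) :
    tensorPairing h a b = ∫ p, h p * (a p.1 * b p.2) := by
  change pairing h (memLp_tensor a b).toLp = _
  rw [pairing_apply]
  refine integral_congr_ae ?_
  filter_upwards [(memLp_tensor a b).coeFn_toLp] with p hp
  rw [hp]

theorem tensorPairing_toLp (h : L2Pair d) (f g : 𝓢(Vel d, ℂ)) :
    tensorPairing h (f.toLp 2) (g.toLp 2) = ∫ p, h p * tensor f g p := by
  rw [tensorPairing_apply]
  refine integral_congr_ae ?_
  filter_upwards [ae_fst (f.coeFn_toLp 2 volume), ae_snd (g.coeFn_toLp 2 volume)] with p hf hg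
  rw [hf, hg, tensor_apply]

theorem pairing_toLp (a : L2 d) (f : 𝓢(Vel d, ℂ)) :
    pairing a (f.toLp 2) = ∫ x, a x * f x := by
  rw [pairing_apply]
  refine integral_congr_ae ?_
  filter_upwards [f.coeFn_toLp 2] with p hf
  rw [hf]

/-! ### The resolvent as a Laplace transform -/

/-- In the velocity variable the transport generator is `-2πi v · k + (s / 4π²) Δ`. For `s = 8π³σ`
it equals `2π` times `-i k · v + σΔ`, which is one particle's share of the operator in the resolvent
equation. This explains the value of `s` used throughout. -/
theorem fourier_transportDeriv (s : ℝ) (k : Vel d) (χ : 𝓢(Vel d, ℂ)) (h : HasCompactSupport χ)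
    (t : ℝ) (v : Vel d) :
    𝓕 (transportDeriv s k χ h t) v =
      -(2 * Real.pi * Complex.I * (inner ℝ v k : ℝ) * 𝓕 (transportS s k χ h t) v) +
      (s / (4 * Real.pi ^ 2) : ℝ) * coordLaplacian (𝓕 (transportS s k χ h t)) v := by
  rw [transportDeriv, sub_eq_add_neg, FourierTransform.fourier_add, FourierTransform.fourier_neg,
    FourierTransform.fourier_neg, FourierTransform.fourier_smul, add_apply, neg_apply, neg_apply, fourier_lineDeriv_apply, smul_apply,
    coordLaplacian_fourier, smul_apply]
  have : (Real.pi : ℂ) ≠ 0 := by exact_mod_cast Real.pi_ne_zero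
  simp only [smul_eq_mul]
  push_cast
  field_simp

instance : (volume : Measure (Vel d × Vel d)).IsAddHaarMeasure := by
  rw [Measure.volume_eq_prod]; infer_instance

instance : (volume : Measure (Vel d × Vel d)).HasTemperateGrowth :=
  inferInstance

/-- Variation of constants for the scalar equation `β' = w β - g`. -/
theorem eq_integral_exp_of_hasDerivAt {w : ℂ} (hw : 0 < w.re) {β β' g : ℝ → ℂ} {M M' : ℝ}
    (hβ : ∀ t, HasDerivAt β (β' t) t) (hM : ∀ t, 0 ≤ t → ‖β t‖ ≤ M) (hg : Continuous g)
    (hM' : ∀ t, 0 ≤ t → ‖g t‖ ≤ M') (h : ∀ t, -w * β t + β' t = -g t) :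
    β 0 = ∫ t in Ioi (0 : ℝ), Complex.exp (-(w * t)) * g t := by
  have hexp : ∀ t : ℝ, ‖Complex.exp (-(w * t))‖ = Real.exp (-w.re * t) := by
    intro t
    rw [Complex.norm_exp]
    simp
  -- The integrating factor removes `w β`; what is left is integrated from `0` to `∞`, where the
  -- boundedness of `β` and `0 < w.re` kill the boundary term.
  have hderiv : ∀ t : ℝ, HasDerivAt (fun t : ℝ => Complex.exp (-(w * t)) * β t)
      (-(Complex.exp (-(w * t)) * g t)) t := by
    intro t
    have e : HasDerivAt (fun t : ℝ => -(w * (t : ℂ))) (-w) t :=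
      ((hasDerivAt_id t).ofReal_comp.const_mul w).neg.congr_deriv (by simp)
    refine (e.cexp.mul (hβ t)).congr_deriv ?_
    linear_combination Complex.exp (-(w * t)) * h t
  have hint : IntegrableOn (fun t : ℝ => Complex.exp (-(w * t)) * g t) (Ioi 0) := by
    refine Integrable.mono' ((exp_neg_integrableOn_Ioi 0 hw).mul_const M')
      (by fun_prop : Continuous _).aestronglyMeasurable.restrict ?_
    filter_upwards [ae_restrict_mem measurableSet_Ioi] with t ht
    rw [norm_mul, hexp]
    exact mul_le_mul_of_nonneg_left (hM' t (le_of_lt ht)) (Real.exp_nonneg _)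
  have hlim : Filter.Tendsto (fun t : ℝ => Complex.exp (-(w * t)) * β t) Filter.atTop (nhds 0) := by
    have hb : Filter.Tendsto (fun t : ℝ => Real.exp (-w.re * t) * M) Filter.atTop (nhds 0) := by
      rw [show (0 : ℝ) = 0 * M by ring]
      refine Filter.Tendsto.mul_const _ (Real.tendsto_exp_atBot.comp ?_)
      exact Filter.tendsto_id.const_mul_atTop_of_neg (by linarith)
    refine squeeze_zero_norm' ?_ hb
    filter_upwards [Filter.eventually_ge_atTop 0] with t ht
    rw [norm_mul, hexp]
    exact mul_le_mul_of_nonneg_left (hM t ht) (Real.exp_nonneg _)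
  have hfin := integral_Ioi_of_hasDerivAt_of_tendsto' (fun t _ => hderiv t) hint.neg hlim
  rw [integral_neg, zero_sub, neg_inj] at hfin
  rw [hfin]
  simp

/-- `transportS` as an element of `L²`. -/
def transportL2 (s : ℝ) (k : Vel d) (χ : 𝓢(Vel d, ℂ)) (h : HasCompactSupport χ) (t : ℝ) : L2 d :=
  (transportS s k χ h t).toLp 2 volume

theorem pairing_transportL2 (a : L2 d) (s : ℝ) (k : Vel d) (χ : 𝓢(Vel d, ℂ))
    (h : HasCompactSupport χ) (t : ℝ) :
    pairing a (transportL2 s k χ h t) = ∫ ξ, a ξ * transport s k χ t ξ :=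
  pairing_toLp a _

/-- The test function is a product of transported functions, moving with `-k` for `v₀` and with `k`
for `v₁`. On it `i k · (v₁ - v₀) - σΔ` acts as `-(2π)⁻¹ ∂ₜ`, so the weak resolvent equation becomes
a scalar differential equation in `t`, of the kind solved by `eq_integral_exp_of_hasDerivAt`. -/
theorem IsResolvent.tensorPairing_deriv_eq {z : ℂ} {σ : ℝ} {k : Vel d}
    {f : Vel d × Vel d → ℂ} {h : L2Pair d} (hh : IsResolvent z σ k f h) {a b : L2 d} {c : ℂ}
    (hf : ∀ᵐ p, f p = c * (a p.1 * b p.2)) (χ₀ χ₁ : 𝓢(Vel d, ℂ)) (h₀ : HasCompactSupport χ₀)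
    (h₁ : HasCompactSupport χ₁) (t s : ℝ) (hs : s = 8 * Real.pi ^ 3 * σ) :
    -(2 * Real.pi * z) * (∫ p, h p * tensor (𝓕 (transportS s (-k) χ₀ h₀ t))
        (𝓕 (transportS s k χ₁ h₁ t)) p) +
      ((∫ p, h p * tensor (𝓕 (transportDeriv s (-k) χ₀ h₀ t)) (𝓕 (transportS s k χ₁ h₁ t)) p) +
       ∫ p, h p * tensor (𝓕 (transportS s (-k) χ₀ h₀ t)) (𝓕 (transportDeriv s k χ₁ h₁ t)) p) =
      -(2 * Real.pi * c * (pairing (𝓕 a : L2 d) (transportL2 s (-k) χ₀ h₀ t) *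
        pairing (𝓕 b : L2 d) (transportL2 s k χ₁ h₁ t))) := by
  have hint : ∀ (f g : 𝓢(Vel d, ℂ)), Integrable (fun p => h p * tensor f g p) := fun f g =>
    (Lp.memLp h).integrable_mul ((tensor f g).memLp 2)
  rw [transportL2, transportL2, pairing_toLp, pairing_toLp, ← integral_mul_fourier,
    ← integral_mul_fourier, ← integral_prod_mul, mul_assoc]
  have h1 := hh (tensor (𝓕 (transportS s (-k) χ₀ h₀ t)) (𝓕 (transportS s k χ₁ h₁ t)))
  have h2 : ∫ p, f p * tensor (𝓕 (transportS s (-k) χ₀ h₀ t))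
      (𝓕 (transportS s k χ₁ h₁ t)) p =
      c * ∫ p : Vel d × Vel d, (a p.1 * 𝓕 (transportS s (-k) χ₀ h₀ t) p.1) *
        (b p.2 * 𝓕 (transportS s k χ₁ h₁ t) p.2) := by
    rw [← integral_const_mul]
    refine integral_congr_ae ?_
    filter_upwards [hf] with p hp
    rw [hp, tensor_apply]; ring
  have hD : Integrable (fun p : Vel d × Vel d =>
      h p * tensor (𝓕 (transportDeriv s (-k) χ₀ h₀ t)) (𝓕 (transportS s k χ₁ h₁ t)) p +
      h p * tensor (𝓕 (transportS s (-k) χ₀ h₀ t)) (𝓕 (transportDeriv s k χ₁ h₁ t)) p) :=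
    (hint _ _).add (hint _ _)
  rw [← integral_add (hint _ _) (hint _ _), mul_assoc (2 * (Real.pi : ℂ)) c]
  refine Eq.trans ?_ (congrArg (fun x : ℂ => -(2 * (Real.pi : ℂ) * x)) (h1.trans h2))
  rw [← integral_const_mul, ← integral_const_mul, ← integral_neg,
    ← integral_add ((hint _ _).const_mul _) hD]
  congr 1; ext p
  rw [pairLaplacian_tensor]
  simp only [tensor_apply, fourier_transportDeriv, inner_neg_right,
    inner_sub_right, real_inner_comm k, hs]
  have : (Real.pi : ℂ) ≠ 0 := by exact_mod_cast Real.pi_ne_zero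
  push_cast
  field_simp
  ring

theorem hasDerivAt_fourier {x : ℝ → L2 d} {x' : L2 d} {t : ℝ} (h : HasDerivAt x x' t) :
    HasDerivAt (fun t => (𝓕 (x t) : L2 d)) (𝓕 x') t :=
  ((FourierTransform.fourierCLM ℂ (L2 d)).restrictScalars ℝ).hasFDerivAt.comp_hasDerivAt t h

theorem hasDerivAt_bilinear {X Y : Type*} [NormedAddCommGroup X] [NormedSpace ℂ X]
    [NormedAddCommGroup Y] [NormedSpace ℂ Y] (B : X →L[ℂ] Y →L[ℂ] ℂ) {x : ℝ → X} {y : ℝ → Y}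
    {x' : X} {y' : Y} {t : ℝ} (hx : HasDerivAt x x' t) (hy : HasDerivAt y y' t) :
    HasDerivAt (fun t => B (x t) (y t)) (B x' (y t) + B (x t) y') t := by
  have h := ((B.bilinearRestrictScalars ℝ).isBoundedBilinearMap.hasFDerivAt
    (x t, y t)).comp_hasDerivAt (f := fun t => (x t, y t)) t (hx.prodMk hy)
  refine h.congr_deriv ?_
  simp [IsBoundedBilinearMap.deriv_apply, add_comm]

theorem norm_pairing_transportL2_le {s : ℝ} (hs : 0 ≤ s) (u : L2 d) (k : Vel d)
    (χ : 𝓢(Vel d, ℂ)) (h : HasCompactSupport χ) {t : ℝ} (ht : 0 ≤ t) :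
    ‖pairing u (transportL2 s k χ h t)‖ ≤ ‖u‖ * ‖(χ.toLp 2 : L2 d)‖ :=
  (norm_integral_mul_le _ _).trans
    (mul_le_mul_of_nonneg_left (norm_toLp_transportS_le hs k χ h ht) (norm_nonneg _))

theorem continuous_transportL2 (s : ℝ) (k : Vel d) (χ : 𝓢(Vel d, ℂ)) (h : HasCompactSupport χ) :
    Continuous (transportL2 s k χ h) :=
  continuous_iff_continuousAt.2 fun t => (hasDerivAt_toLp_transportS _ k χ h t).continuousAt

theorem transportL2_zero (s : ℝ) (k : Vel d) (χ : 𝓢(Vel d, ℂ)) (h : HasCompactSupport χ) :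
    transportL2 s k χ h 0 = χ.toLp 2 := by
  rw [transportL2]
  congr 1
  ext ξ; simp [transportS_apply, transport, phase_zero]

theorem tensorPairing_fourier_toLp (h : L2Pair d) (f g : 𝓢(Vel d, ℂ)) :
    tensorPairing h (𝓕 (f.toLp 2 volume) : L2 d) (𝓕 (g.toLp 2 volume) : L2 d) =
      ∫ p, h p * tensor (𝓕 f) (𝓕 g) p := by
  rw [SchwartzMap.toLp_fourier_eq, SchwartzMap.toLp_fourier_eq, tensorPairing_toLp]

/-- The resolvent is the Laplace transform of the semigroup, tested against tensor products. -/
theorem IsResolvent.tensorPairing_eq {z : ℂ} (hz : 0 < z.re) {σ : ℝ} (hσ : 0 ≤ σ) {k : Vel d}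
    {f : Vel d × Vel d → ℂ} {h : L2Pair d} (hh : IsResolvent z σ k f h) {a b : L2 d} {c : ℂ}
    (hf : ∀ᵐ p, f p = c * (a p.1 * b p.2)) (χ₀ χ₁ : 𝓢(Vel d, ℂ)) (h₀ : HasCompactSupport χ₀)
    (h₁ : HasCompactSupport χ₁) (s : ℝ) (hs : s = 8 * Real.pi ^ 3 * σ) :
    tensorPairing h (𝓕 (χ₀.toLp 2 volume) : L2 d) (𝓕 (χ₁.toLp 2 volume) : L2 d) =
      ∫ t in Ioi (0 : ℝ), Complex.exp (-(2 * Real.pi * z * t)) * (2 * Real.pi * c *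
        (pairing (𝓕 a : L2 d) (transportL2 s (-k) χ₀ h₀ t) *
        pairing (𝓕 b : L2 d) (transportL2 s k χ₁ h₁ t))) := by
  have hs0 : 0 ≤ s := by rw [hs]; positivity
  have hw : 0 < (2 * Real.pi * z).re := by
    have : (2 * Real.pi * z).re = 2 * Real.pi * z.re := by simp
    rw [this]; positivity
  have main := eq_integral_exp_of_hasDerivAt hw
    (β := fun t => tensorPairing h (𝓕 (transportL2 s (-k) χ₀ h₀ t) : L2 d)
      (𝓕 (transportL2 s k χ₁ h₁ t) : L2 d))
    (g := fun t => 2 * Real.pi * c * (pairing (𝓕 a : L2 d) (transportL2 s (-k) χ₀ h₀ t) *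
        pairing (𝓕 b : L2 d) (transportL2 s k χ₁ h₁ t)))
    (M := ‖tensorPairing h‖ * ‖(χ₀.toLp 2 : L2 d)‖ * ‖(χ₁.toLp 2 : L2 d)‖)
    (M' := ‖2 * (Real.pi : ℂ) * c‖ * ((‖(𝓕 a : L2 d)‖ * ‖(χ₀.toLp 2 : L2 d)‖) *
      (‖(𝓕 b : L2 d)‖ * ‖(χ₁.toLp 2 : L2 d)‖)))
    (fun t => hasDerivAt_bilinear _
      (hasDerivAt_fourier (hasDerivAt_toLp_transportS _ (-k) χ₀ h₀ t))
      (hasDerivAt_fourier (hasDerivAt_toLp_transportS _ k χ₁ h₁ t)))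
    (fun t ht => by
      refine (ContinuousLinearMap.le_opNorm₂ _ _ _).trans ?_
      rw [Lp.norm_fourier_eq, Lp.norm_fourier_eq]
      exact mul_le_mul (mul_le_mul_of_nonneg_left
        (norm_toLp_transportS_le hs0 (-k) χ₀ h₀ ht) (norm_nonneg (tensorPairing h)))
        (norm_toLp_transportS_le hs0 k χ₁ h₁ ht) (norm_nonneg _) (by positivity))
    (continuous_const.mul (((pairing _).continuous.comp (continuous_transportL2 _ _ _ _)).mul
      ((pairing _).continuous.comp (continuous_transportL2 _ _ _ _))))
    (fun t ht => by
      rw [norm_mul, norm_mul (pairing _ _)]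
      exact mul_le_mul_of_nonneg_left (mul_le_mul (norm_pairing_transportL2_le hs0 _ _ _ _ ht)
        (norm_pairing_transportL2_le hs0 _ _ _ _ ht)
        (norm_nonneg _) (by positivity)) (by positivity))
    (fun t => by
      rw [transportL2, transportL2, tensorPairing_fourier_toLp, tensorPairing_fourier_toLp,
        tensorPairing_fourier_toLp]
      exact hh.tensorPairing_deriv_eq hf χ₀ χ₁ h₀ h₁ t s hs)
  simp only [transportL2_zero] at main
  exact main

/-! ### Gaussians and their overlaps under damped transport -/

theorem integrable_rexp_neg_mul_norm_sq {a : ℝ} (ha : 0 < a) :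
    Integrable fun v : Vel d => Real.exp (-a * ‖v‖ ^ 2) := by
  have h := (GaussianFourier.integrable_cexp_neg_mul_sq_norm_add (V := Vel d) (b := (a : ℂ))
    (by simpa using ha) 0 0).re
  refine h.congr (ae_of_all _ fun v => ?_)
  simp only [inner_zero_left, Complex.ofReal_zero, mul_zero, add_zero]
  rw [show -(a : ℂ) * (‖v‖ : ℂ) ^ 2 = ((-a * ‖v‖ ^ 2 : ℝ) : ℂ) by push_cast; ring, ← Complex.ofReal_exp]
  rfl

/-- The Gaussian `A exp (-a ‖v‖ ^ 2)`. -/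
def gauss (A a : ℝ) (v : Vel d) : ℝ := A * Real.exp (-a * ‖v‖ ^ 2)

@[fun_prop]
theorem continuous_gauss (A a : ℝ) : Continuous (gauss A a : Vel d → ℝ) := by
  unfold gauss; fun_prop

theorem integrable_gauss (A : ℝ) {a : ℝ} (ha : 0 < a) : Integrable (gauss A a : Vel d → ℝ) :=
  (integrable_rexp_neg_mul_norm_sq ha).const_mul A

theorem memLp_gauss (A : ℝ) {a : ℝ} (ha : 0 < a) :
    MemLp (fun v : Vel d => ((gauss A a v : ℝ) : ℂ)) 2 volume := by
  rw [memLp_two_iff_integrable_sq_norm (by fun_prop : Continuous _).aestronglyMeasurable]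
  refine ((integrable_gauss (d := d) (A ^ 2) (a := 2 * a) (by positivity))).congr
    (ae_of_all _ fun v => ?_)
  simp only [Complex.norm_real, Real.norm_eq_abs, sq_abs, gauss, mul_pow, ← Real.exp_nat_mul]
  push_cast
  ring_nf

/-- The Gaussian as an element of `L²`. -/
def gaussL2 (A : ℝ) {a : ℝ} (ha : 0 < a) : L2 d := (memLp_gauss A ha).toLp

theorem coeFn_gaussL2 (A : ℝ) {a : ℝ} (ha : 0 < a) :
    (gaussL2 A ha : L2 d) =ᵐ[volume] fun v => ((gauss A a v : ℝ) : ℂ) := MemLp.coeFn_toLp _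

/-- The classical formula holds for the Fourier integral; duality with smooth compactly supported
functions transfers it to the `L²` transform. -/
theorem fourier_gaussL2 (A : ℝ) {a : ℝ} (ha : 0 < a) :
    (𝓕 (gaussL2 A ha : L2 d) : L2 d) =ᵐ[volume]
      fun v => ((gauss (A * (Real.pi / a) ^ ((d : ℝ) / 2)) (Real.pi ^ 2 / a) v : ℝ) : ℂ) := by
  have hloc : LocallyIntegrable (fun v : Vel d =>
      ((gauss (A * (Real.pi / a) ^ ((d : ℝ) / 2)) (Real.pi ^ 2 / a) v : ℝ) : ℂ)) :=
    (by fun_prop : Continuous _).locallyIntegrable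
  refine ae_eq_of_integral_contDiff_smul_eq (L2.locallyIntegrable _) hloc fun g hg hgc => ?_
  have hg' : ContDiff ℝ ∞ (fun x => (g x : ℂ)) := Complex.ofRealCLM.contDiff.comp hg
  have hgc' : HasCompactSupport (fun x => (g x : ℂ)) := hgc.comp_left (g := Complex.ofReal) rfl
  set χ : 𝓢(Vel d, ℂ) := hgc'.toSchwartzMap hg' with hχ
  have hF : ∀ ξ : Vel d, 𝓕 (fun v : Vel d => ((gauss A a v : ℝ) : ℂ)) ξ =
      ((gauss (A * (Real.pi / a) ^ ((d : ℝ) / 2)) (Real.pi ^ 2 / a) ξ : ℝ) : ℂ) := by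
    intro ξ
    have h1 := fourier_gaussian_innerProductSpace (V := Vel d) (b := (a : ℂ)) (by simpa using ha) ξ
    have h2 : (fun v : Vel d => ((gauss A a v : ℝ) : ℂ)) =
        (A : ℂ) • fun v : Vel d => Complex.exp (-(a : ℂ) * ‖v‖ ^ 2) := by
      ext v; simp [gauss]
    have h4 : 𝓕 ((A : ℂ) • fun v : Vel d => Complex.exp (-(a : ℂ) * ‖v‖ ^ 2)) ξ =
        (A : ℂ) * 𝓕 (fun v : Vel d => Complex.exp (-(a : ℂ) * ‖v‖ ^ 2)) ξ :=
      congrFun (VectorFourier.fourierIntegral_const_smul _ _ _ _ _) ξ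
    rw [h2, h4, h1, finrank_euclideanSpace_fin, gauss]
    have hpa : 0 ≤ Real.pi / a := by positivity
    push_cast [Complex.ofReal_cpow hpa]
    rw [mul_assoc]
    congr 3
    ring
  have h3 := VectorFourier.integral_fourierIntegral_smul_eq_flip (L := innerₗ (Vel d))
    (μ := volume) (ν := volume) Real.continuous_fourierChar continuous_inner
    ((integrable_gauss A ha).ofReal (𝕜 := ℂ)) χ.integrable
  calc ∫ x, g x • (𝓕 (gaussL2 A ha : L2 d) : L2 d) x
      = ∫ ξ, (𝓕 (gaussL2 A ha : L2 d) : L2 d) ξ * χ ξ := by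
        congr 1; ext ξ; simp [hχ, mul_comm]
    _ = ∫ v, (gauss A a v : ℂ) • (𝓕 χ) v := by
        rw [← integral_mul_fourier]
        refine integral_congr_ae ?_
        filter_upwards [coeFn_gaussL2 (d := d) A ha] with v hv
        rw [hv, smul_eq_mul]
    _ = ∫ ξ, 𝓕 (fun v : Vel d => ((gauss A a v : ℝ) : ℂ)) ξ • χ ξ := by
        rw [flip_innerₗ (Vel d)] at h3
        exact h3.symm
    _ = _ := by
        congr 1; ext ξ; rw [hF]; simp [hχ, mul_comm]

/-- `∫ g(ξ) exp (-s ∫_0^t ‖ξ - r k‖ ^ 2 dr) g(ξ - t k) dξ` for a Gaussian `g`. -/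
def corr (A a s t : ℝ) (k : Vel d) : ℝ :=
  ∫ ξ : Vel d, gauss A a ξ * (Real.exp (-(s * phase t k ξ)) * gauss A a (ξ - t • k))

theorem norm_sq_add_norm_sub_sq (ξ η : Vel d) :
    ‖ξ‖ ^ 2 + ‖ξ - η‖ ^ 2 = 2 * ‖ξ - (2⁻¹ : ℝ) • η‖ ^ 2 + ‖η‖ ^ 2 / 2 := by
  rw [norm_sub_sq_real, norm_sub_sq_real, inner_smul_right, norm_smul, mul_pow]
  norm_num
  ring

theorem gauss_mul_gauss (A a : ℝ) (ξ η : Vel d) :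
    gauss A a ξ * gauss A a (ξ - η) = A ^ 2 * Real.exp (-a * ‖η‖ ^ 2 / 2) *
      Real.exp (-(2 * a) * ‖ξ - (2⁻¹ : ℝ) • η‖ ^ 2) := by
  have h := norm_sq_add_norm_sub_sq ξ η
  rw [gauss, gauss, mul_mul_mul_comm, ← Real.exp_add, mul_assoc (A ^ 2), ← Real.exp_add, ← sq]
  congr 2
  linear_combination -a * h

theorem integrable_gauss_mul_gauss (A : ℝ) {a : ℝ} (ha : 0 < a) (η : Vel d) :
    Integrable fun ξ => gauss A a ξ * gauss A a (ξ - η) := by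
  simp only [gauss_mul_gauss]
  exact ((integrable_rexp_neg_mul_norm_sq (by positivity)).comp_sub_right _).const_mul _

theorem integral_gauss_mul_gauss (A : ℝ) {a : ℝ} (ha : 0 < a) (η : Vel d) :
    ∫ ξ, gauss A a ξ * gauss A a (ξ - η) =
      A ^ 2 * (Real.pi / (2 * a)) ^ ((d : ℝ) / 2) * Real.exp (-(a / 2) * ‖η‖ ^ 2) := by
  simp only [gauss_mul_gauss]
  rw [integral_const_mul, integral_sub_right_eq_self (fun ξ : Vel d => Real.exp (-(2 * a) * ‖ξ‖ ^ 2)),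
    GaussianFourier.integral_rexp_neg_mul_sq_norm (by positivity), finrank_euclideanSpace_fin]
  ring_nf

theorem corr_zero (A : ℝ) {a : ℝ} (ha : 0 < a) (t : ℝ) (k : Vel d) :
    corr A a 0 t k = A ^ 2 * (Real.pi / (2 * a)) ^ ((d : ℝ) / 2) *
      Real.exp (-(a / 2) * (t ^ 2 * ‖k‖ ^ 2)) := by
  rw [corr]
  simp only [zero_mul, neg_zero, Real.exp_zero, one_mul, integral_gauss_mul_gauss A ha, norm_smul,
    mul_pow, Real.norm_eq_abs, sq_abs]

theorem gauss_nonneg {A : ℝ} (hA : 0 ≤ A) (a : ℝ) (ξ : Vel d) : 0 ≤ gauss A a ξ :=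
  mul_nonneg hA (Real.exp_nonneg _)

theorem corr_nonneg {A : ℝ} (hA : 0 ≤ A) (a s t : ℝ) (k : Vel d) : 0 ≤ corr A a s t k :=
  integral_nonneg fun _ => mul_nonneg (gauss_nonneg hA _ _)
    (mul_nonneg (Real.exp_nonneg _) (gauss_nonneg hA _ _))

theorem exp_phase_le_one {s : ℝ} (hs : 0 ≤ s) {t : ℝ} (ht : 0 ≤ t) (k ξ : Vel d) :
    Real.exp (-(s * phase t k ξ)) ≤ 1 :=
  Real.exp_le_one_iff.2 (neg_nonpos.2 (mul_nonneg hs (phase_nonneg ht k ξ)))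

theorem integrable_corr {A a : ℝ} (hA : 0 ≤ A) (ha : 0 < a) {s : ℝ} (hs : 0 ≤ s) {t : ℝ}
    (ht : 0 ≤ t) (k : Vel d) : Integrable fun ξ : Vel d =>
      gauss A a ξ * (Real.exp (-(s * phase t k ξ)) * gauss A a (ξ - t • k)) := by
  refine (integrable_gauss_mul_gauss A ha (t • k)).mono' (by fun_prop : Continuous _).aestronglyMeasurable
    (ae_of_all _ fun ξ => ?_)
  have h1 := gauss_nonneg hA a ξ
  have h2 := gauss_nonneg hA a (ξ - t • k)
  rw [Real.norm_of_nonneg (by positivity)]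
  have := exp_phase_le_one hs ht k ξ
  exact mul_le_mul_of_nonneg_left (mul_le_of_le_one_left h2 this) h1

theorem corr_le {A a : ℝ} (hA : 0 ≤ A) (ha : 0 < a) {s : ℝ} (hs : 0 ≤ s) {t : ℝ}
    (ht : 0 ≤ t) (k : Vel d) : corr A a s t k ≤ corr A a 0 t k := by
  refine integral_mono (integrable_corr hA ha hs ht k) (integrable_corr hA ha le_rfl ht k) fun ξ => ?_
  have h1 := gauss_nonneg hA a ξ
  have h2 := gauss_nonneg hA a (ξ - t • k)
  have h3 := exp_phase_le_one hs ht k ξ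
  simp only [zero_mul, neg_zero, Real.exp_zero]
  gcongr

/-- Since `1 - exp (-x) ≤ x`, the damping costs at most `s t X` with `X = ‖ξ‖² + ‖ξ - t k‖²`. Half
of the Gaussian rate absorbs `X`, by `X exp (-a X / 2) ≤ 2 / a`; the other half integrates to the
Gaussian on the right. -/
theorem corr_sub_le {A a : ℝ} (hA : 0 ≤ A) (ha : 0 < a) {s : ℝ} (hs : 0 ≤ s) {t : ℝ}
    (ht : 0 ≤ t) (k : Vel d) : corr A a 0 t k - corr A a s t k ≤
      s * t * (2 / a * (A ^ 2 * (Real.pi / a) ^ ((d : ℝ) / 2))) *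
        Real.exp (-(a / 4) * (t ^ 2 * ‖k‖ ^ 2)) := by
  have h := integral_gauss_mul_gauss (d := d) A (a := a / 2) (by positivity) (t • k)
  rw [norm_smul, mul_pow, Real.norm_eq_abs, sq_abs, show 2 * (a / 2) = a by ring,
    show a / 2 / 2 = a / 4 by ring] at h
  rw [corr, corr, ← integral_sub (integrable_corr hA ha le_rfl ht k) (integrable_corr hA ha hs ht k)]
  calc _ ≤ ∫ ξ : Vel d, s * t * (2 / a) * (gauss A (a / 2) ξ * gauss A (a / 2) (ξ - t • k)) := by
        refine integral_mono ((integrable_corr hA ha le_rfl ht k).sub (integrable_corr hA ha hs ht k))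
          ((integrable_gauss_mul_gauss A (by positivity) _).const_mul _) fun ξ => ?_
        simp only [zero_mul, neg_zero, Real.exp_zero, gauss]
        set X := ‖ξ‖ ^ 2 + ‖ξ - t • k‖ ^ 2 with hX
        have hX0 : 0 ≤ X := by positivity
        have e1 : Real.exp (-a * ‖ξ‖ ^ 2) * Real.exp (-a * ‖ξ - t • k‖ ^ 2) = Real.exp (-(a / 2) * X) * Real.exp (-(a / 2) * X) := by
          rw [← Real.exp_add, ← Real.exp_add]; congr 1; rw [hX]; ring
        have e2 : Real.exp (-(a / 2) * ‖ξ‖ ^ 2) * Real.exp (-(a / 2) * ‖ξ - t • k‖ ^ 2) = Real.exp (-(a / 2) * X) := by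
          rw [← Real.exp_add]; congr 1; rw [hX]; ring
        have e3 : 1 - Real.exp (-(s * phase t k ξ)) ≤ s * (t * X) := by
          have := Real.add_one_le_exp (-(s * phase t k ξ))
          have := mul_le_mul_of_nonneg_left (phase_le ht k ξ) hs
          linarith
        have e4 : X * Real.exp (-(a / 2) * X) ≤ 2 / a := by
          have h5 : (a / 2) * X ≤ Real.exp ((a / 2) * X) := by
            linarith [Real.add_one_le_exp ((a / 2) * X)]
          rw [neg_mul, Real.exp_neg, le_div_iff₀ ha, ← div_eq_mul_inv, div_mul_eq_mul_div, div_le_iff₀ (Real.exp_pos _)]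
          linarith
        set Y := Real.exp (-(a / 2) * X) with hY
        have hY0 : 0 ≤ Y := Real.exp_nonneg _
        calc _ = A ^ 2 * (1 - Real.exp (-(s * phase t k ξ))) * (Real.exp (-a * ‖ξ‖ ^ 2) * Real.exp (-a * ‖ξ - t • k‖ ^ 2)) := by ring
          _ ≤ A ^ 2 * (s * (t * X)) * (Y * Y) := by rw [e1]; gcongr
          _ = A ^ 2 * (s * t) * Y * (X * Y) := by ring
          _ ≤ A ^ 2 * (s * t) * Y * (2 / a) := by gcongr
          _ = _ := by rw [← e2]; ring
    _ = _ := by rw [integral_const_mul, h]; ring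

/-! ### Damped transport as a contraction of `L²` -/

section WeightedComp

variable {X : Type*} [MeasurableSpace X] {μ : Measure X} {τ : X → X} {e : X → ℂ}

theorem memLp_weightedComp (hτ : MeasurePreserving τ μ μ) (he : AEStronglyMeasurable e μ)
    (h1 : ∀ x, ‖e x‖ ≤ 1) (f : Lp ℂ 2 μ) : MemLp (fun x => e x * f (τ x)) 2 μ := by
  refine ((Lp.memLp f).comp_measurePreserving hτ).of_le
    (he.mul ((Lp.aestronglyMeasurable f).comp_measurePreserving hτ)) (ae_of_all _ fun x => ?_)
  rw [norm_mul]
  exact mul_le_of_le_one_left (norm_nonneg _) (h1 x)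

/-- Composition with a measure preserving map, followed by multiplication by a weight of modulus at
most one, as an operator on `L²`. -/
def weightedComp (hτ : MeasurePreserving τ μ μ) (he : AEStronglyMeasurable e μ)
    (h1 : ∀ x, ‖e x‖ ≤ 1) : Lp ℂ 2 μ →L[ℂ] Lp ℂ 2 μ :=
  LinearMap.mkContinuous
    { toFun := fun f => (memLp_weightedComp hτ he h1 f).toLp
      map_add' := fun f g => by
        apply Lp.ext
        filter_upwards [(memLp_weightedComp hτ he h1 (f + g)).coeFn_toLp,
          (memLp_weightedComp hτ he h1 f).coeFn_toLp, (memLp_weightedComp hτ he h1 g).coeFn_toLp,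
          Lp.coeFn_add (memLp_weightedComp hτ he h1 f).toLp (memLp_weightedComp hτ he h1 g).toLp,
          hτ.quasiMeasurePreserving.ae (Lp.coeFn_add f g)] with x h1 h2 h3 h4 h5
        rw [h1, h4, Pi.add_apply, h2, h3, h5, Pi.add_apply, mul_add]
      map_smul' := fun c f => by
        apply Lp.ext
        filter_upwards [(memLp_weightedComp hτ he h1 (c • f)).coeFn_toLp,
          (memLp_weightedComp hτ he h1 f).coeFn_toLp,
          Lp.coeFn_smul c (memLp_weightedComp hτ he h1 f).toLp,
          hτ.quasiMeasurePreserving.ae (Lp.coeFn_smul c f)] with x h1 h2 h3 h4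
        rw [RingHom.id_apply, h1, h3, Pi.smul_apply, h2, h4, Pi.smul_apply, mul_smul_comm] } 1
    (fun f => by
      rw [one_mul]
      change ‖(memLp_weightedComp hτ he h1 f).toLp‖ ≤ ‖f‖
      rw [Lp.norm_toLp, Lp.norm_def]
      refine ENNReal.toReal_mono (Lp.memLp f).2.ne ?_
      rw [← eLpNorm_comp_measurePreserving (Lp.aestronglyMeasurable f) hτ]
      refine eLpNorm_mono fun x => ?_
      rw [norm_mul]
      exact mul_le_of_le_one_left (norm_nonneg _) (h1 x))

theorem coeFn_weightedComp (hτ : MeasurePreserving τ μ μ) (he : AEStronglyMeasurable e μ)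
    (h1 : ∀ x, ‖e x‖ ≤ 1) (f : Lp ℂ 2 μ) :
    weightedComp hτ he h1 f =ᵐ[μ] fun x => e x * f (τ x) :=
  (memLp_weightedComp hτ he h1 f).coeFn_toLp

theorem norm_weightedComp_le (hτ : MeasurePreserving τ μ μ) (he : AEStronglyMeasurable e μ)
    (h1 : ∀ x, ‖e x‖ ≤ 1) (f : Lp ℂ 2 μ) : ‖weightedComp hτ he h1 f‖ ≤ ‖f‖ := by
  have := (weightedComp hτ he h1).le_of_opNorm_le
    (LinearMap.mkContinuous_norm_le _ zero_le_one _) f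
  simpa using this

end WeightedComp

/-- The weight `exp (-s ∫_0^t ‖ξ - r k‖ ^ 2 dr)`. -/
def damp (s t : ℝ) (k ξ : Vel d) : ℂ := (Real.exp (-(s * phase t k ξ)) : ℂ)

theorem norm_damp_le_one {s : ℝ} (hs : 0 ≤ s) {t : ℝ} (ht : 0 ≤ t) (k ξ : Vel d) :
    ‖damp s t k ξ‖ ≤ 1 := by
  rw [damp, Complex.norm_real, Real.norm_of_nonneg (Real.exp_nonneg _)]
  exact exp_phase_le_one hs ht k ξ

@[fun_prop]
theorem continuous_damp (s : ℝ) :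
    Continuous fun p : ℝ × Vel d × Vel d => damp s p.1 p.2.1 p.2.2 := by
  unfold damp; fun_prop

/-- `transport` as a contraction of `L²`. -/
def transportOp {s : ℝ} (hs : 0 ≤ s) {t : ℝ} (ht : 0 ≤ t) (k : Vel d) : L2 d →L[ℂ] L2 d :=
  weightedComp (measurePreserving_sub_right volume (t • k))
    (by fun_prop : Continuous (damp s t k)).aestronglyMeasurable (norm_damp_le_one hs ht k)

theorem coeFn_transportOp {s : ℝ} (hs : 0 ≤ s) {t : ℝ} (ht : 0 ≤ t) (k : Vel d) (f : L2 d) :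
    transportOp hs ht k f =ᵐ[volume] transport s k f t :=
  coeFn_weightedComp _ _ _ f

theorem transportL2_eq {s : ℝ} (hs : 0 ≤ s) {t : ℝ} (ht : 0 ≤ t) (k : Vel d) (χ : 𝓢(Vel d, ℂ))
    (h : HasCompactSupport χ) : transportL2 s k χ h t = transportOp hs ht k (χ.toLp 2) := by
  apply Lp.ext
  filter_upwards [(transportS s k χ h t).coeFn_toLp 2, coeFn_transportOp hs ht k (χ.toLp 2),
    (measurePreserving_sub_right volume (t • k)).quasiMeasurePreserving.ae
      (χ.coeFn_toLp 2 (volume : Measure (Vel d)))] with x h1 h2 h3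
  rw [transportL2, h1, h2, transportS_apply, transport, transport, h3]

theorem exists_seq_schwartz_tendsto (f : L2 d) : ∃ χ : ℕ → 𝓢(Vel d, ℂ),
    (∀ n, HasCompactSupport (χ n)) ∧
    Filter.Tendsto (fun n => ((χ n).toLp 2 : L2 d)) Filter.atTop (nhds f) := by
  have h : ∀ n : ℕ, ∃ χ : 𝓢(Vel d, ℂ), HasCompactSupport χ ∧
      dist ((χ.toLp 2 : L2 d)) f ≤ 1 / ((n : ℝ) + 1) := by
    intro n
    have hε : (0 : ℝ) < 1 / ((n : ℝ) + 1) := by positivity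
    obtain ⟨g, hg₁, hg₂, hg₃⟩ := MemLp.exist_eLpNorm_sub_le (p := 2) (by norm_num) (by norm_num)
      (Lp.memLp f) hε
    refine ⟨hg₁.toSchwartzMap hg₂, hg₁, ?_⟩
    have : (f : Vel d → ℂ) - (((hg₁.toSchwartzMap hg₂).toLp 2 volume : L2 d) : Vel d → ℂ)
        =ᵐ[volume] (f : Vel d → ℂ) - g := by
      filter_upwards [(hg₁.toSchwartzMap hg₂).coeFn_toLp 2 (volume : Measure (Vel d))] with x hx
      simp [hx]
    rw [dist_comm, Lp.dist_def, eLpNorm_congr_ae this]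
    exact ENNReal.toReal_le_of_le_ofReal hε.le hg₃
  choose χ hχ hd using h
  refine ⟨χ, hχ, ?_⟩
  rw [tendsto_iff_dist_tendsto_zero]
  exact squeeze_zero (fun n => dist_nonneg) hd tendsto_one_div_add_atTop_nhds_zero_nat

/-- Extension by density of the test function in `v₁`. It is needed because `√M` is the transform of
a Gaussian, which has no compact support; the contraction property provides the dominating function.
-/
theorem IsResolvent.tensorPairing_eq_of_L2 {z : ℂ} (hz : 0 < z.re) {σ : ℝ} (hσ : 0 ≤ σ) {k : Vel d}
    {f : Vel d × Vel d → ℂ} {h : L2Pair d} (hh : IsResolvent z σ k f h) {a b : L2 d} {c : ℂ}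
    (hf : ∀ᵐ p, f p = c * (a p.1 * b p.2)) (χ₀ : 𝓢(Vel d, ℂ)) (h₀ : HasCompactSupport χ₀)
    (g : L2 d) (s : ℝ) (hs : s = 8 * Real.pi ^ 3 * σ) :
    tensorPairing h (𝓕 (χ₀.toLp 2 volume) : L2 d) (𝓕 g : L2 d) =
      ∫ t in Ioi (0 : ℝ), Complex.exp (-(2 * Real.pi * z * t)) * (2 * Real.pi * c *
        (pairing (𝓕 a : L2 d) (transportL2 s (-k) χ₀ h₀ t) *
        ∫ ξ, (𝓕 b : L2 d) ξ * transport s k g t ξ)) := by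
  obtain ⟨χ, hχ, hlim⟩ := exists_seq_schwartz_tendsto g
  have hs0 : 0 ≤ s := by rw [hs]; positivity
  have hpos : 0 < 2 * Real.pi * z.re := by positivity
  have hexp : ∀ t : ℝ, ‖Complex.exp (-(2 * Real.pi * z * t))‖ =
      Real.exp (-(2 * Real.pi * z.re) * t) := by
    intro t
    rw [Complex.norm_exp]
    simp
  have hcont : Continuous fun x : L2 d => tensorPairing h (𝓕 (χ₀.toLp 2 volume) : L2 d) (𝓕 x) :=
    (tensorPairing h (𝓕 (χ₀.toLp 2 volume) : L2 d)).continuous.comp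
      (FourierTransform.fourierCLM ℂ (L2 d)).continuous
  have l1 := (hcont.tendsto g).comp hlim
  obtain ⟨M, hM⟩ := hlim.norm.bddAbove_range
  have hM' : ∀ n, ‖((χ n).toLp 2 volume : L2 d)‖ ≤ M := fun n => hM ⟨n, rfl⟩
  set bound : ℝ → ℝ := fun t => Real.exp (-(2 * Real.pi * z.re) * t) * (‖2 * (Real.pi : ℂ) * c‖ *
      ((‖(𝓕 a : L2 d)‖ * ‖(χ₀.toLp 2 : L2 d)‖) * (‖(𝓕 b : L2 d)‖ * M))) with hbound
  set F : ℕ → ℝ → ℂ := fun n t => Complex.exp (-(2 * Real.pi * z * t)) * (2 * Real.pi * c *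
        (pairing (𝓕 a : L2 d) (transportL2 s (-k) χ₀ h₀ t) *
        pairing (𝓕 b : L2 d) (transportL2 s k (χ n) (hχ n) t))) with hF
  have m1 : ∀ n, Continuous (F n) := fun n => by
    have c1 := (pairing (𝓕 a : L2 d)).continuous.comp (continuous_transportL2 s (-k) χ₀ h₀)
    have c2 := (pairing (𝓕 b : L2 d)).continuous.comp (continuous_transportL2 s k (χ n) (hχ n))
    have c3 : Continuous fun t : ℝ => Complex.exp (-(2 * Real.pi * z * t)) := by fun_prop
    exact c3.mul (continuous_const.mul (c1.mul c2))
  have m2 : IntegrableOn bound (Ioi 0) := (exp_neg_integrableOn_Ioi 0 hpos).mul_const _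
  have m3 : ∀ n, ∀ᵐ t ∂volume.restrict (Ioi (0 : ℝ)), ‖F n t‖ ≤ bound t := fun n => by
    filter_upwards [ae_restrict_mem measurableSet_Ioi] with t ht
    have ht0 : 0 ≤ t := le_of_lt ht
    rw [hF, hbound]
    simp only [norm_mul (Complex.exp _), hexp, norm_mul (2 * (Real.pi : ℂ) * c), norm_mul (pairing _ _)]
    have i1 := norm_pairing_transportL2_le hs0 (𝓕 a : L2 d) (-k) χ₀ h₀ ht0
    have i2 := (norm_pairing_transportL2_le hs0 (𝓕 b : L2 d) k (χ n) (hχ n) ht0).trans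
      (mul_le_mul_of_nonneg_left (hM' n) (norm_nonneg _))
    exact mul_le_mul_of_nonneg_left (mul_le_mul_of_nonneg_left
      (mul_le_mul i1 i2 (norm_nonneg _) (by positivity)) (norm_nonneg _)) (Real.exp_nonneg _)
  have m4 : ∀ᵐ t ∂volume.restrict (Ioi (0 : ℝ)), Filter.Tendsto (fun n => F n t) Filter.atTop
      (nhds (Complex.exp (-(2 * Real.pi * z * t)) * (2 * Real.pi * c *
        (pairing (𝓕 a : L2 d) (transportL2 s (-k) χ₀ h₀ t) *
        ∫ ξ, (𝓕 b : L2 d) ξ * transport s k g t ξ)))) := by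
    filter_upwards [ae_restrict_mem measurableSet_Ioi] with t ht
    have ht0 : 0 ≤ t := le_of_lt ht
    have e1 : ∫ ξ, (𝓕 b : L2 d) ξ * transport s k g t ξ =
        pairing (𝓕 b : L2 d) (transportOp hs0 ht0 k g) := by
      rw [pairing_apply]
      refine integral_congr_ae ?_
      filter_upwards [coeFn_transportOp hs0 ht0 k g] with ξ hξ
      rw [hξ]
    have e2 : Filter.Tendsto (fun n => pairing (𝓕 b : L2 d) (transportL2 s k (χ n) (hχ n) t))
        Filter.atTop (nhds (pairing (𝓕 b : L2 d) (transportOp hs0 ht0 k g))) := by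
      simp only [transportL2_eq hs0 ht0]
      exact (((pairing (𝓕 b : L2 d)).comp (transportOp hs0 ht0 k)).continuous.tendsto g).comp hlim
    rw [e1]
    exact ((e2.const_mul _).const_mul _).const_mul _
  have l2 := tendsto_integral_of_dominated_convergence bound
    (fun n => (m1 n).aestronglyMeasurable) m2 m3 m4
  have l3 := l1.congr fun n => show _ = ∫ t in Ioi (0 : ℝ), F n t from
    hh.tensorPairing_eq hz hσ hf χ₀ (χ n) h₀ (hχ n) s hs
  exact tendsto_nhds_unique l3 l2

/-! ### The Maxwellian on the Fourier side -/

/-- The prefactor of `√M`. -/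
def maxwellAmp (d : ℕ) (β : ℝ) : ℝ := Real.sqrt ((β / (2 * Real.pi)) ^ ((d : ℝ) / 2))

theorem sqrt_maxwellian (β : ℝ) (v : Vel d) :
    Real.sqrt (maxwellian d β v) = gauss (maxwellAmp d β) (β / 4) v := by
  rw [maxwellian, Real.sqrt_mul' _ (Real.exp_nonneg _), gauss, maxwellAmp]
  congr 1
  rw [Real.sqrt_eq_iff_mul_self_eq (Real.exp_nonneg _) (Real.exp_nonneg _), ← Real.exp_add]
  congr 1
  ring

/-- The prefactor of the Fourier transform of `√M`. -/
def maxwellHatAmp (d : ℕ) (β : ℝ) : ℝ := maxwellAmp d β * (Real.pi / (β / 4)) ^ ((d : ℝ) / 2)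

theorem maxwellHatAmp_nonneg {β : ℝ} (hβ : 0 < β) : 0 ≤ maxwellHatAmp d β :=
  mul_nonneg (Real.sqrt_nonneg _) (by positivity)

theorem maxwellHat_rate_pos {β : ℝ} (hβ : 0 < β) : 0 < Real.pi ^ 2 / (β / 4) := by positivity

/-- The overlap of `√M` with its evolution under the two-particle flow. -/
def mcorr (β s t : ℝ) (k : Vel d) : ℝ :=
  corr (maxwellHatAmp d β) (Real.pi ^ 2 / (β / 4)) s t k

/-- The transform of `√M` convolved with itself is the transform of `M`: without damping, the
overlap is the characteristic function of the Maxwellian. This is how `M` enters the Landau tensor,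
see `integral_maxwellian_mul_cexp`. -/
theorem mcorr_zero {β : ℝ} (hβ : 0 < β) (t : ℝ) (k : Vel d) :
    mcorr β 0 t k = Real.exp (-(2 * Real.pi ^ 2 / β) * (t ^ 2 * ‖k‖ ^ 2)) := by
  rw [mcorr, corr_zero _ (maxwellHat_rate_pos hβ), maxwellHatAmp, mul_pow, maxwellAmp,
    Real.sq_sqrt (by positivity), ← Real.rpow_natCast ((Real.pi / (β / 4)) ^ ((d : ℝ) / 2)),
    ← Real.rpow_mul (by positivity), mul_comm ((d : ℝ) / 2), Real.rpow_mul (by positivity),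
    ← Real.mul_rpow (by positivity) (by positivity), ← Real.mul_rpow (by positivity) (by positivity)]
  have hpi := Real.pi_pos
  -- All prefactors are powers with exponent `d / 2`; their combined base is `1` because `M` has
  -- total mass one.
  have e : β / (2 * Real.pi) * (Real.pi / (β / 4)) ^ ((2 : ℕ) : ℝ) *
      (Real.pi / (2 * (Real.pi ^ 2 / (β / 4)))) = 1 := by
    rw [Real.rpow_natCast]; field_simp; norm_num
  rw [e, Real.one_rpow, one_mul]
  congr 2
  field_simp
  ring

/-- The Gaussian whose Fourier transform is `√M`. -/
def maxwellHat (d : ℕ) {β : ℝ} (hβ : 0 < β) : L2 d :=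
  gaussL2 (maxwellHatAmp d β) (maxwellHat_rate_pos hβ)

theorem fourier_maxwellHat {β : ℝ} (hβ : 0 < β) :
    (𝓕 (maxwellHat d hβ) : L2 d) =ᵐ[volume] fun v => ((Real.sqrt (maxwellian d β v) : ℝ) : ℂ) := by
  filter_upwards [fourier_gaussL2 (d := d) (maxwellHatAmp d β) (maxwellHat_rate_pos hβ)] with v hv
  rw [maxwellHat, hv, sqrt_maxwellian, maxwellHatAmp]
  have hpi := Real.pi_pos
  have e : maxwellAmp d β * (Real.pi / (β / 4)) ^ ((d : ℝ) / 2) *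
      (Real.pi / (Real.pi ^ 2 / (β / 4))) ^ ((d : ℝ) / 2) = maxwellAmp d β := by
    rw [mul_assoc, ← Real.mul_rpow (by positivity) (by positivity),
      show Real.pi / (β / 4) * (Real.pi / (Real.pi ^ 2 / (β / 4))) = 1 by field_simp,
      Real.one_rpow, mul_one]
  rw [e, show Real.pi ^ 2 / (Real.pi ^ 2 / (β / 4)) = β / 4 by field_simp]

/-- `√M` as an element of `L²`. -/
def sqrtMaxwellL2 (d : ℕ) {β : ℝ} (hβ : 0 < β) : L2 d :=
  gaussL2 (maxwellAmp d β) (show 0 < β / 4 by positivity)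

theorem coeFn_sqrtMaxwellL2 {β : ℝ} (hβ : 0 < β) :
    sqrtMaxwellL2 d hβ =ᵐ[volume] fun v => ((Real.sqrt (maxwellian d β v) : ℝ) : ℂ) := by
  filter_upwards [coeFn_gaussL2 (d := d) (maxwellAmp d β) (show 0 < β / 4 by positivity)] with v hv
  rw [sqrtMaxwellL2, hv, sqrt_maxwellian]

theorem integral_fourier_sqrtMaxwellL2 {β : ℝ} (hβ : 0 < β) (s t : ℝ) (k : Vel d) :
    ∫ ξ, (𝓕 (sqrtMaxwellL2 d hβ) : L2 d) ξ * transport s k (maxwellHat d hβ) t ξ =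
      (mcorr β s t k : ℂ) := by
  rw [mcorr, corr, ← integral_complex_ofReal]
  have h1 := coeFn_gaussL2 (d := d) (maxwellHatAmp d β) (maxwellHat_rate_pos hβ)
  refine integral_congr_ae ?_
  filter_upwards [fourier_gaussL2 (d := d) (maxwellAmp d β) (show 0 < β / 4 by positivity),
    (measurePreserving_sub_right volume (t • k)).quasiMeasurePreserving.ae h1] with ξ h2 h3
  rw [sqrtMaxwellL2, h2, transport, maxwellHat, h3, maxwellHatAmp]
  push_cast
  ring

/-! ### The hat operator at a fixed momentum transfer -/

theorem sum_lineDeriv (f : 𝓢(Vel d, ℂ)) (k ξ : Vel d) :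
    ∑ j : Fin d, ((k j : ℝ) : ℂ) * (∂_{(basisVec j : Vel d)} f) ξ = ∂_{k} f ξ := by
  simp only [SchwartzMap.lineDerivOp_apply_eq_fderiv]
  have hk : k = ∑ j : Fin d, k j • (basisVec j : Vel d) := by
    ext i
    simp [basisVec, Finset.sum_apply, Pi.single_apply]
  conv_rhs => rw [hk, map_sum]
  simp

theorem inner_eq_sum (k ξ : Vel d) : inner ℝ k ξ = ∑ j : Fin d, k j * ξ j := by
  rw [PiLp.inner_apply]
  simp [mul_comm]

/-- `k · ∇ u` for a weak gradient. -/
def dirGrad (k : Vel d) (G : Fin d → L2 d) : L2 d := ∑ j : Fin d, ((k j : ℝ) : ℂ) • G j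

theorem coeFn_finsetSum {X ι : Type*} [MeasurableSpace X] {μ : Measure X} (S : Finset ι)
    (f : ι → Lp ℂ 2 μ) : (∑ i ∈ S, f i : Lp ℂ 2 μ) =ᵐ[μ] fun x => ∑ i ∈ S, f i x := by
  classical
  induction S using Finset.induction_on with
  | empty =>
    simp only [Finset.sum_empty]
    exact Lp.coeFn_zero ℂ 2 μ
  | insert i S hi ih =>
    rw [Finset.sum_insert hi]
    filter_upwards [Lp.coeFn_add (f i) (∑ j ∈ S, f j), ih] with x h1 h2
    rw [h1, Pi.add_apply, h2, Finset.sum_insert hi]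

theorem coeFn_sum_smul (k : Vel d) (G : Fin d → L2 d) :
    dirGrad k G =ᵐ[volume] fun v => ∑ j : Fin d, ((k j : ℝ) : ℂ) * G j v := by
  unfold dirGrad
  have h1 := coeFn_finsetSum Finset.univ (fun j : Fin d => ((k j : ℝ) : ℂ) • G j)
  have h2 : ∀ᵐ v : Vel d, ∀ j : Fin d, (((k j : ℝ) : ℂ) • G j : L2 d) v = ((k j : ℝ) : ℂ) * G j v :=
    ae_all_iff.2 fun j => by
      filter_upwards [Lp.coeFn_smul ((k j : ℝ) : ℂ) (G j)] with v hv
      rw [hv, Pi.smul_apply, smul_eq_mul]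
  filter_upwards [h1, h2] with v h1 h2
  rw [h1]
  simp only [h2]

theorem fourier_dirGrad {u : L2 d} {G : Fin d → L2 d} (h : IsWeakGradient u G) (k : Vel d) :
    (𝓕 (dirGrad k G) : L2 d) =ᵐ[volume]
      fun ξ => 2 * Real.pi * Complex.I * (inner ℝ k ξ : ℝ) * (𝓕 u : L2 d) ξ := by
  have e : (𝓕 (dirGrad k G) : L2 d) = dirGrad k (fun j => 𝓕 (G j)) := by
    rw [dirGrad, dirGrad, FourierTransform.fourier_sum]
    simp only [FourierTransform.fourier_smul]
  rw [e]
  filter_upwards [coeFn_sum_smul k (fun j => (𝓕 (G j) : L2 d)),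
    ae_all_iff.2 fun j => fourier_weakGradient h j] with ξ h1 h2
  rw [h1, inner_eq_sum]
  simp only [h2]
  push_cast
  rw [Finset.mul_sum, Finset.sum_mul]
  exact Finset.sum_congr rfl fun j _ => by ring

/-- `-2πi (k · ξ) χ(ξ)`. -/
def innerMul (k : Vel d) (χ : 𝓢(Vel d, ℂ)) : 𝓢(Vel d, ℂ) :=
  -(2 * Real.pi * Complex.I) •
      SchwartzMap.smulLeftCLM ℂ (fun ξ : Vel d => ((inner ℝ ξ k : ℝ) : ℂ)) χ

theorem innerMul_apply (k : Vel d) (χ : 𝓢(Vel d, ℂ)) (ξ : Vel d) :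
    innerMul k χ ξ = -(2 * Real.pi * Complex.I) * ((inner ℝ k ξ : ℝ) * χ ξ) := by
  rw [innerMul, smul_apply, SchwartzMap.smulLeftCLM_apply_apply (by fun_prop), smul_eq_mul,
    smul_eq_mul, real_inner_comm]

theorem hasCompactSupport_innerMul (k : Vel d) {χ : 𝓢(Vel d, ℂ)} (h : HasCompactSupport χ) :
    HasCompactSupport (innerMul k χ) := by
  have : (innerMul k χ : Vel d → ℂ) =
      fun ξ => (-(2 * Real.pi * Complex.I) * (inner ℝ k ξ : ℝ)) * χ ξ := by
    ext ξ; rw [innerMul_apply]; ring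
  rw [this]
  exact h.mul_left

/-- Travelling back from `ξ - t k` to `ξ` runs along the same segment, so the accumulated damping is
the same. -/
theorem phase_neg_sub (t : ℝ) (k ξ : Vel d) : phase t (-k) (ξ - t • k) = phase t k ξ := by
  rw [phase_eq, phase_eq, norm_neg]
  have : ξ - t • k - t • -k = ξ := by rw [smul_neg]; abel
  rw [this]
  ring

/-- The Laplace representation of the resolvent is tested on a product, so the two particles
decouple: the `v₁` factor is the overlap `mcorr`, and the `v₀` factor is a damped translation of `𝓕
u`. The constant `8π³` is the `2π` of the time rescaling times the `4π²` of the two derivatives. -/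
theorem integral_sPlus_inner {β : ℝ} (hβ : 0 < β) (V : Vel d → ℝ) {z : ℂ} (hz : 0 < z.re) {σ : ℝ}
    (hσ : 0 ≤ σ) {u : L2 d} {G : Fin d → L2 d} (hG : IsWeakGradient u G) {k : Vel d}
    {h : L2Pair d} (hh : IsResolvent z σ k (sMinus β V G k) h) {χ : 𝓢(Vel d, ℂ)}
    (hχ : HasCompactSupport χ) (s : ℝ) (hs : s = 8 * Real.pi ^ 3 * σ) :
    ∫ p : Vel d × Vel d, -(((Real.sqrt (maxwellian d β p.2) : ℝ) : ℂ) * potHat V k *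
        (∑ j : Fin d, ((k j : ℝ) : ℂ) * (∂_{(basisVec j : Vel d)} (𝓕 χ)) p.1) * h p) =
      (8 * Real.pi ^ 3 * potHat V k ^ 2) * ∫ t in Ioi (0 : ℝ), Complex.exp (-(2 * Real.pi * z * t)) *
        mcorr β s t k * ∫ ξ, damp s t k ξ * ((inner ℝ k ξ : ℝ) * (inner ℝ k (ξ - t • k) : ℝ)) *
          (𝓕 u : L2 d) (ξ - t • k) * χ ξ := by
  have hf : ∀ᵐ p : Vel d × Vel d, sMinus β V G k p =
      -potHat V k * (dirGrad k G p.1 * sqrtMaxwellL2 d hβ p.2) := by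
    filter_upwards [ae_fst (coeFn_sum_smul k G), ae_snd (coeFn_sqrtMaxwellL2 (d := d) hβ)] with p h1 h2
    rw [h1, h2, sMinus]
    ring
  have h0 := hasCompactSupport_innerMul k hχ
  have main := hh.tensorPairing_eq_of_L2 hz hσ hf (innerMul k χ) h0 (maxwellHat d hβ) s hs
  have lhs : ∫ p : Vel d × Vel d, -(((Real.sqrt (maxwellian d β p.2) : ℝ) : ℂ) * potHat V k *
        (∑ j : Fin d, ((k j : ℝ) : ℂ) * (∂_{(basisVec j : Vel d)} (𝓕 χ)) p.1) * h p) =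
      -potHat V k * tensorPairing h (𝓕 ((innerMul k χ).toLp 2 volume) : L2 d)
        (𝓕 (maxwellHat d hβ) : L2 d) := by
    rw [tensorPairing_apply, ← integral_const_mul, SchwartzMap.toLp_fourier_eq]
    refine integral_congr_ae ?_
    filter_upwards [ae_fst ((𝓕 (innerMul k χ)).coeFn_toLp 2 (volume : Measure (Vel d))),
      ae_snd (fourier_maxwellHat (d := d) hβ)] with p h1 h2
    rw [h1, h2, sum_lineDeriv, lineDeriv_fourier_apply, innerMul]
    ring
  rw [lhs, main, ← integral_const_mul, ← integral_const_mul]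
  congr 1
  ext t
  rw [integral_fourier_sqrtMaxwellL2, pairing_transportL2]
  -- The substitution `ξ ↦ ξ - t k` moves the translation from the test function onto `𝓕 u`; the
  -- symbols `2πi` and `-2πi` of the two derivatives multiply to `4π²`.
  have e : ∫ ξ, (𝓕 (dirGrad k G) : L2 d) ξ * transport s (-k) (innerMul k χ) t ξ =
      4 * Real.pi ^ 2 * ∫ ξ, damp s t k ξ * ((inner ℝ k ξ : ℝ) * (inner ℝ k (ξ - t • k) : ℝ)) *
          (𝓕 u : L2 d) (ξ - t • k) * χ ξ := by
    rw [← integral_sub_right_eq_self _ (t • k), ← integral_const_mul]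
    refine integral_congr_ae ?_
    filter_upwards [(measurePreserving_sub_right volume (t • k)).quasiMeasurePreserving.ae
      (fourier_dirGrad hG k)] with ξ h1
    rw [h1, transport, innerMul_apply, phase_neg_sub, damp,
      show ξ - t • k - t • -k = ξ by rw [smul_neg]; abel]
    have hI := Complex.I_sq
    linear_combination (-4 * Real.pi ^ 2 * (inner ℝ k ξ : ℝ) * (inner ℝ k (ξ - t • k) : ℝ) *
      (𝓕 u : L2 d) (ξ - t • k) * (Real.exp (-(s * phase t k ξ)) : ℂ) * χ ξ) * hI
  rw [e]
  ring

/-! ### The potential and the collision measure -/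

theorem potHat_eq_fourier {V : Vel d → ℝ} (hV : ContDiff ℝ ∞ V) (hc : HasCompactSupport V) :
    ∃ ψ : 𝓢(Vel d, ℂ), ∀ k, potHat V k = ψ ((2 * Real.pi)⁻¹ • k) := by
  have h1 : ContDiff ℝ ∞ (fun x => ((V x : ℝ) : ℂ)) := Complex.ofRealCLM.contDiff.comp hV
  have h2 : HasCompactSupport (fun x => ((V x : ℝ) : ℂ)) := hc.comp_left (g := Complex.ofReal) rfl
  refine ⟨𝓕 (h2.toSchwartzMap h1), fun k => ?_⟩
  rw [SchwartzMap.fourier_coe, Real.fourier_eq', potHat]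
  congr 1
  ext x
  rw [smul_eq_mul]
  congr 2
  rw [inner_smul_right, real_inner_comm]
  have := Real.pi_pos
  push_cast
  field_simp

theorem potHat_eq_of_norm_eq {V : Vel d → ℝ} (hrad : ∀ x y : Vel d, ‖x‖ = ‖y‖ → V x = V y)
    {k l : Vel d} (h : ‖k‖ = ‖l‖) : potHat V k = potHat V l := by
  -- Reflection in the hyperplane orthogonal to `k - l` exchanges the two vectors and leaves the
  -- radial `V` invariant.
  set R : Vel d ≃ₗᵢ[ℝ] Vel d := (ℝ ∙ (k - l))ᗮ.reflection with hR
  have hkl : R k = l := Submodule.reflection_sub h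
  symm
  rw [potHat, potHat, ← R.measurePreserving.integral_comp R.toHomeomorph.measurableEmbedding]
  congr 1
  ext x
  rw [show V (R x) = V x from hrad _ _ (R.norm_map x), ← hkl, R.inner_map_map]

theorem conj_potHat {V : Vel d → ℝ} (hrad : ∀ x y : Vel d, ‖x‖ = ‖y‖ → V x = V y) (k : Vel d) :
    (starRingEnd ℂ) (potHat V k) = potHat V k := by
  conv_rhs => rw [potHat_eq_of_norm_eq hrad (norm_neg k).symm]
  rw [potHat, potHat, ← integral_conj]
  congr 1
  ext x
  rw [map_mul, ← Complex.exp_conj, inner_neg_left]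
  simp

theorem potHat_sq {V : Vel d → ℝ} (hrad : ∀ x y : Vel d, ‖x‖ = ‖y‖ → V x = V y) (k : Vel d) :
    potHat V k ^ 2 = ((‖potHat V k‖ ^ 2 : ℝ) : ℂ) := by
  have h := Complex.normSq_eq_conj_mul_self (z := potHat V k)
  rw [conj_potHat hrad] at h
  rw [sq, ← h, Complex.normSq_eq_norm_sq]

/-- The density `8 π³ (2π)^{-d} |V̂(k)|²`. -/
def potWeight (V : Vel d → ℝ) (k : Vel d) : ℝ :=
  8 * Real.pi ^ 3 * ((2 * Real.pi) ^ d)⁻¹ * ‖potHat V k‖ ^ 2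

theorem potWeight_nonneg (V : Vel d → ℝ) (k : Vel d) : 0 ≤ potWeight V k := by
  have := Real.pi_pos
  unfold potWeight; positivity

theorem continuous_potHat {V : Vel d → ℝ} (hV : ContDiff ℝ ∞ V) (hc : HasCompactSupport V) :
    Continuous (potHat V) := by
  obtain ⟨ψ, hψ⟩ := potHat_eq_fourier hV hc
  rw [show potHat V = fun k => ψ ((2 * Real.pi)⁻¹ • k) from funext hψ]
  exact ψ.continuous.comp (continuous_const_smul _)

theorem continuous_potWeight {V : Vel d → ℝ} (hV : ContDiff ℝ ∞ V) (hc : HasCompactSupport V) :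
    Continuous (potWeight V) := by
  have := continuous_potHat hV hc
  unfold potWeight; fun_prop

/-- Of the two factors in `‖potHat V k‖ ^ 2` one is bounded and the other, a Schwartz function,
absorbs the power of `‖k‖`. -/
theorem integrable_potWeight_mul_pow {V : Vel d → ℝ} (hV : ContDiff ℝ ∞ V)
    (hc : HasCompactSupport V) (m : ℕ) : Integrable fun k => potWeight V k * ‖k‖ ^ m := by
  obtain ⟨ψ, hψ⟩ := potHat_eq_fourier hV hc
  have hpi := Real.pi_pos
  obtain ⟨C, hC⟩ : ∃ C : ℝ, ∀ x, ‖ψ x‖ ≤ C := by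
    obtain ⟨C, hC⟩ := ψ.decay 0 0
    exact ⟨C, fun x => by simpa using hC.2 x⟩
  have h1 := (ψ.integrable_pow_mul volume m).comp_smul
    (show (2 * Real.pi)⁻¹ ≠ 0 by positivity)
  refine (h1.const_mul (8 * Real.pi ^ 3 * ((2 * Real.pi) ^ d)⁻¹ * C * (2 * Real.pi) ^ m)).mono'
    ((continuous_potWeight hV hc).mul (by fun_prop)).aestronglyMeasurable (ae_of_all _ fun k => ?_)
  have h0 := norm_nonneg (ψ ((2 * Real.pi)⁻¹ • k))
  have e : 8 * Real.pi ^ 3 * ((2 * Real.pi) ^ d)⁻¹ * C * (2 * Real.pi) ^ m *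
      (‖(2 * Real.pi)⁻¹ • k‖ ^ m * ‖ψ ((2 * Real.pi)⁻¹ • k)‖) =
      8 * Real.pi ^ 3 * ((2 * Real.pi) ^ d)⁻¹ * (C * ‖ψ ((2 * Real.pi)⁻¹ • k)‖) * ‖k‖ ^ m := by
    rw [norm_smul, mul_pow _ ‖k‖, Real.norm_eq_abs, abs_of_pos (by positivity), inv_pow]
    field_simp
  rw [e, Real.norm_eq_abs, abs_of_nonneg (mul_nonneg (potWeight_nonneg V k) (by positivity)),
    potWeight, hψ]
  gcongr
  rw [sq]
  gcongr
  exact hC _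

/-- Momentum transfer and (rescaled) positive time. -/
def collisionMeasure (d : ℕ) : Measure (Vel d × ℝ) :=
  (volume : Measure (Vel d)).prod (volume.restrict (Ioi (0 : ℝ)))

instance : SFinite (collisionMeasure d) := by unfold collisionMeasure; infer_instance

theorem ae_collisionMeasure_pos : ∀ᵐ y ∂collisionMeasure d, 0 < y.2 := by
  rw [collisionMeasure]
  exact Measure.quasiMeasurePreserving_snd.ae (ae_restrict_mem measurableSet_Ioi)

/-- The dominating weight `(1 + t) q(k) |k|² exp (-a t² |k|²)`. -/
def collisionBound (V : Vel d → ℝ) (a : ℝ) (y : Vel d × ℝ) : ℝ :=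
  (1 + y.2) * (potWeight V y.1 * ‖y.1‖ ^ 2) * Real.exp (-a * (y.2 ^ 2 * ‖y.1‖ ^ 2))

theorem integral_one_add_mul_exp {b : ℝ} (hb : 0 < b) :
    IntegrableOn (fun t : ℝ => (1 + t) * Real.exp (-b * t ^ 2)) (Ioi 0) ∧
    ∫ t in Ioi (0 : ℝ), (1 + t) * Real.exp (-b * t ^ 2) = √(Real.pi / b) / 2 + (2 * b)⁻¹ := by
  have h1 : IntegrableOn (fun t : ℝ => Real.exp (-b * t ^ 2)) (Ioi 0) :=
    (integrable_exp_neg_mul_sq hb).integrableOn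
  have h2 : IntegrableOn (fun t : ℝ => t * Real.exp (-b * t ^ 2)) (Ioi 0) :=
    (integrable_mul_exp_neg_mul_sq hb).integrableOn
  have e : (fun t : ℝ => (1 + t) * Real.exp (-b * t ^ 2)) =
      fun t => Real.exp (-b * t ^ 2) + t * Real.exp (-b * t ^ 2) := by ext t; ring
  rw [e]
  refine ⟨h1.add h2, ?_⟩
  rw [integral_add h1 h2, integral_gaussian_Ioi]
  congr 1
  have h3 := integral_mul_cexp_neg_mul_sq (b := (b : ℂ)) (by simpa using hb)
  have h4 : ∫ t in Ioi (0 : ℝ), ((t * Real.exp (-b * t ^ 2) : ℝ) : ℂ) = (2 * (b : ℂ))⁻¹ := by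
    rw [← h3]; congr 1; ext t; push_cast; rfl
  rw [integral_complex_ofReal] at h4
  exact_mod_cast h4

/-- For fixed `k ≠ 0` the integral of `(1 + t) exp (-a t² ‖k‖²)` over `t` is a combination of
`‖k‖⁻¹` and `‖k‖⁻²`. After multiplication by `‖k‖²` exactly the first and zeroth moments of `w` are
left. -/
theorem integrable_gaussian_weight (hd : 0 < d) {w : Vel d → ℝ} (hw : Continuous w)
    (hw0 : ∀ k, 0 ≤ w k) (h1 : Integrable fun k => w k * ‖k‖ ^ 1)
    (h2 : Integrable fun k => w k * ‖k‖ ^ 0) {a : ℝ} (ha : 0 < a) :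
    Integrable (fun y : Vel d × ℝ => (1 + y.2) * (w y.1 * ‖y.1‖ ^ 2) *
      Real.exp (-a * (y.2 ^ 2 * ‖y.1‖ ^ 2))) (collisionMeasure d) := by
  have : Nonempty (Fin d) := ⟨⟨0, hd⟩⟩
  have hcont : Continuous (fun y : Vel d × ℝ => (1 + y.2) * (w y.1 * ‖y.1‖ ^ 2) *
      Real.exp (-a * (y.2 ^ 2 * ‖y.1‖ ^ 2))) := by fun_prop
  -- At `k = 0` the Gaussian in `t` degenerates; this single point is negligible.
  have hne : ∀ᵐ k : Vel d, k ≠ 0 := Measure.ae_ne volume 0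
  have hrw : ∀ (k : Vel d) (t : ℝ), (1 + t) * (w k * ‖k‖ ^ 2) * Real.exp (-a * (t ^ 2 * ‖k‖ ^ 2)) =
      (w k * ‖k‖ ^ 2) * ((1 + t) * Real.exp (-(a * ‖k‖ ^ 2) * t ^ 2)) := by
    intro k t
    rw [show -a * (t ^ 2 * ‖k‖ ^ 2) = -(a * ‖k‖ ^ 2) * t ^ 2 by ring]
    ring
  rw [collisionMeasure, integrable_prod_iff hcont.aestronglyMeasurable]
  simp only [hrw]
  refine ⟨?_, ?_⟩
  · filter_upwards [hne] with k hk
    exact (integral_one_add_mul_exp (by positivity)).1.const_mul _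
  · refine ((h1.const_mul (√(Real.pi / a) / 2)).add (h2.const_mul ((2 * a)⁻¹))).congr ?_
    filter_upwards [hne] with k hk
    have hk' : 0 < ‖k‖ := norm_pos_iff.2 hk
    have e : ∫ t in Ioi (0 : ℝ), ‖(w k * ‖k‖ ^ 2) * ((1 + t) * Real.exp (-(a * ‖k‖ ^ 2) * t ^ 2))‖ =
        ∫ t in Ioi (0 : ℝ), (w k * ‖k‖ ^ 2) * ((1 + t) * Real.exp (-(a * ‖k‖ ^ 2) * t ^ 2)) := by
      refine setIntegral_congr_fun measurableSet_Ioi fun t ht => ?_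
      have ht' : (0 : ℝ) < t := ht
      have hq0 := hw0 k
      rw [Real.norm_eq_abs, abs_of_nonneg (by positivity)]
    rw [e, integral_const_mul, (integral_one_add_mul_exp (by positivity)).2, Pi.add_apply,
      show Real.pi / (a * ‖k‖ ^ 2) = Real.pi / a / ‖k‖ ^ 2 by field_simp,
      Real.sqrt_div (show 0 ≤ Real.pi / a by have := Real.pi_pos; positivity), Real.sqrt_sq hk'.le]
    field_simp

theorem integrable_collisionBound {V : Vel d → ℝ} (hd : 2 ≤ d) (hV : ContDiff ℝ ∞ V)
    (hc : HasCompactSupport V) {a : ℝ} (ha : 0 < a) :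
    Integrable (collisionBound V a) (collisionMeasure d) :=
  integrable_gaussian_weight (by omega) (continuous_potWeight hV hc) (potWeight_nonneg V)
    (integrable_potWeight_mul_pow hV hc 1) (integrable_potWeight_mul_pow hV hc 0) ha

/-! ### `L²` norms and Schur's test -/

/-- The `L²` norm of a real function. -/
def l2n (f : Vel d → ℝ) : ℝ := √(∫ ξ, f ξ ^ 2)

theorem l2n_nonneg (f : Vel d → ℝ) : 0 ≤ l2n f := Real.sqrt_nonneg _

theorem l2n_sq (f : Vel d → ℝ) : l2n f ^ 2 = ∫ ξ, f ξ ^ 2 :=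
  Real.sq_sqrt (integral_nonneg fun _ => sq_nonneg _)

theorem l2n_le {f g : Vel d → ℝ} (hg : MemLp g 2 volume) (h : ∀ ξ, |f ξ| ≤ g ξ) :
    l2n f ≤ l2n g :=
  Real.sqrt_le_sqrt (integral_mono_of_nonneg (ae_of_all _ fun _ => sq_nonneg _) hg.integrable_sq
    (ae_of_all _ fun ξ => sq_le_sq.2 ((h ξ).trans (le_abs_self _))))

theorem l2n_const_mul {c : ℝ} (hc : 0 ≤ c) (f : Vel d → ℝ) :
    l2n (fun ξ => c * f ξ) = c * l2n f := by
  simp only [l2n, mul_pow]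
  rw [integral_const_mul, Real.sqrt_mul (sq_nonneg c), Real.sqrt_sq hc]

theorem integral_mul_le_l2n {f g : Vel d → ℝ} (hf : MemLp f 2 volume) (hg : MemLp g 2 volume) :
    ∫ ξ, ‖f ξ * g ξ‖ ≤ l2n f * l2n g := by
  have h := integral_mul_norm_le_Lp_mul_Lq (μ := (volume : Measure (Vel d)))
    Real.HolderConjugate.two_two (f := f) (g := g) (by simpa using hf) (by simpa using hg)
  simp only [norm_mul]
  refine h.trans (le_of_eq ?_)
  simp only [l2n, Real.sqrt_eq_rpow, Real.rpow_two, Real.norm_eq_abs, sq_abs]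

theorem l2n_comp_sub (f : Vel d → ℝ) (η : Vel d) : l2n (fun ξ => f (ξ - η)) = l2n f := by
  rw [l2n, l2n, integral_sub_right_eq_self (fun ξ => f ξ ^ 2)]

variable {Y : Type*} [MeasurableSpace Y] {ν : Measure Y} [SFinite ν]

/-- On each slice Cauchy–Schwarz and translation invariance give the bound `‖b y‖ * (l2n f * l2n
φ)`, which is integrable in `y`. -/
theorem schur_test_aux {η : Y → Vel d} (hη : Measurable η) {b : Y → ℝ} (hb : Integrable b ν)
    {f φ : Vel d → ℝ} (hf : MemLp f 2 volume) (hφ : MemLp φ 2 volume) :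
    Integrable (fun p : Y × Vel d => b p.1 * (f (p.2 - η p.1) * φ p.2)) (ν.prod volume) ∧
      ∫ p : Y × Vel d, ‖b p.1 * (f (p.2 - η p.1) * φ p.2)‖ ∂(ν.prod volume) ≤
        (∫ y, ‖b y‖ ∂ν) * (l2n f * l2n φ) := by
  have hmeas : Measurable (fun p : Y × Vel d => p.2 - η p.1) :=
    measurable_snd.sub (hη.comp measurable_fst)
  -- Every slice of this map is a translation, so null sets pull back to null sets; thus the
  -- composition with `f` is measurable although `f` is only almost everywhere measurable.
  have hshift : Measure.QuasiMeasurePreserving (fun p : Y × Vel d => p.2 - η p.1)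
      (ν.prod volume) volume := by
    refine ⟨hmeas, ?_⟩
    refine Measure.AbsolutelyContinuous.mk fun S hS h0 => ?_
    rw [Measure.map_apply hmeas hS,
      Measure.measure_prod_null (hmeas hS)]
    refine ae_of_all _ fun y => ?_
    have := (measurePreserving_sub_right (volume : Measure (Vel d)) (η y)).measure_preimage
      hS.nullMeasurableSet
    rw [h0] at this
    exact this
  have hm : AEStronglyMeasurable (fun p : Y × Vel d => b p.1 * (f (p.2 - η p.1) * φ p.2))
      (ν.prod volume) :=
    hb.aestronglyMeasurable.comp_fst.mul
      ((hf.aestronglyMeasurable.comp_quasiMeasurePreserving hshift).mul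
        hφ.aestronglyMeasurable.comp_snd)
  have hfs : ∀ y, MemLp (fun ξ => f (ξ - η y)) 2 volume := fun y =>
    hf.comp_measurePreserving (measurePreserving_sub_right volume (η y))
  have hle : ∀ y, ∫ ξ, ‖b y * (f (ξ - η y) * φ ξ)‖ ≤ ‖b y‖ * (l2n f * l2n φ) := fun y => by
    simp only [norm_mul (b y)]
    rw [integral_const_mul, ← l2n_comp_sub f (η y)]
    exact mul_le_mul_of_nonneg_left (integral_mul_le_l2n (hfs y) hφ) (norm_nonneg _)
  have hint : Integrable (fun p : Y × Vel d => b p.1 * (f (p.2 - η p.1) * φ p.2))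
      (ν.prod volume) := by
    rw [integrable_prod_iff hm]
    have hsl : ∀ y, Integrable (fun ξ => b y * (f (ξ - η y) * φ ξ)) := fun y =>
      Integrable.const_mul (f := fun ξ => f (ξ - η y) * φ ξ) ((hfs y).integrable_mul hφ) (b y)
    refine ⟨ae_of_all _ hsl, ?_⟩
    refine (hb.norm.mul_const (l2n f * l2n φ)).mono' hm.norm.integral_prod_right' (ae_of_all _ fun y => ?_)
    rw [Real.norm_eq_abs, abs_of_nonneg (integral_nonneg fun _ => norm_nonneg _)]
    exact hle y
  refine ⟨hint, ?_⟩
  rw [integral_prod _ hint.norm, ← integral_mul_const]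
  exact integral_mono hint.norm.integral_prod_left (hb.norm.mul_const _) hle

/-- Schur's test for superpositions of translations. -/
theorem schur_test {η : Y → Vel d} (hη : Measurable η) {b : Y → ℝ} (hb : Integrable b ν)
    (hb0 : ∀ᵐ y ∂ν, 0 ≤ b y)
    {f φ : Vel d → ℝ} (hf : MemLp f 2 volume) (hφ : MemLp φ 2 volume) {H : Y × Vel d → ℂ}
    (hH : AEStronglyMeasurable H (ν.prod volume))
    (hle : ∀ᵐ y ∂ν, ∀ ξ, ‖H (y, ξ)‖ ≤ b y * (f (ξ - η y) * φ ξ)) :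
    Integrable H (ν.prod volume) ∧
      ‖∫ p, H p ∂(ν.prod volume)‖ ≤ (∫ y, b y ∂ν) * (l2n f * l2n φ) := by
  obtain ⟨h1, h2⟩ := schur_test_aux hη hb hf hφ
  have hle' : ∀ᵐ p ∂(ν.prod (volume : Measure (Vel d))),
      ‖H p‖ ≤ ‖b p.1 * (f (p.2 - η p.1) * φ p.2)‖ := by
    filter_upwards [Measure.quasiMeasurePreserving_fst.ae hle] with p hp
    exact (hp p.2).trans (le_abs_self _)
  have e : ∫ y, ‖b y‖ ∂ν = ∫ y, b y ∂ν := integral_congr_ae (by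
    filter_upwards [hb0] with y hy
    rw [Real.norm_eq_abs, abs_of_nonneg hy])
  rw [e] at h2
  refine ⟨h1.mono hH hle', ?_⟩
  exact (norm_integral_le_of_norm_le h1.norm hle').trans h2

/-- A crude triangle inequality from `(a + b)² ≤ 2a² + 2b²`; the factor `2` goes into the constants.
-/
theorem l2n_add_le {f g : Vel d → ℝ} (hf : MemLp f 2 volume) (hg : MemLp g 2 volume) :
    l2n (fun ξ => f ξ + g ξ) ≤ 2 * (l2n f + l2n g) := by
  refine Real.sqrt_le_iff.2 ⟨by have := l2n_nonneg f; have := l2n_nonneg g; positivity, ?_⟩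
  have h : ∫ ξ, (f ξ + g ξ) ^ 2 ≤ ∫ ξ, (2 * f ξ ^ 2 + 2 * g ξ ^ 2) :=
    integral_mono (hf.add hg).integrable_sq
      ((hf.integrable_sq.const_mul 2).add (hg.integrable_sq.const_mul 2))
      fun ξ => by nlinarith [sq_nonneg (f ξ - g ξ)]
  rw [integral_add (hf.integrable_sq.const_mul 2) (hg.integrable_sq.const_mul 2),
    integral_const_mul, integral_const_mul, ← l2n_sq f, ← l2n_sq g] at h
  beta_reduce
  nlinarith [l2n_nonneg f, l2n_nonneg g, mul_nonneg (l2n_nonneg f) (l2n_nonneg g)]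

/-! ### Pointwise bounds on the collision kernel -/

theorem mcorr_nonneg {β : ℝ} (hβ : 0 < β) (s t : ℝ) (k : Vel d) : 0 ≤ mcorr β s t k :=
  corr_nonneg (maxwellHatAmp_nonneg hβ) _ _ _ _

theorem mcorr_le {β : ℝ} (hβ : 0 < β) {s : ℝ} (hs : 0 ≤ s) {t : ℝ} (ht : 0 ≤ t) (k : Vel d) :
    mcorr β s t k ≤ Real.exp (-(2 * Real.pi ^ 2 / β) * (t ^ 2 * ‖k‖ ^ 2)) :=
  (corr_le (maxwellHatAmp_nonneg hβ) (maxwellHat_rate_pos hβ) hs ht k).trans_eq (mcorr_zero hβ t k)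

theorem exists_mcorr_sub_le {β : ℝ} (hβ : 0 < β) : ∃ A : ℝ, 0 ≤ A ∧ ∀ s t : ℝ, 0 ≤ s → 0 ≤ t →
    ∀ k : Vel d, |mcorr β s t k - mcorr β 0 t k| ≤
      A * (s * t * Real.exp (-(Real.pi ^ 2 / β) * (t ^ 2 * ‖k‖ ^ 2))) := by
  have hpi := Real.pi_pos
  refine ⟨2 / (Real.pi ^ 2 / (β / 4)) * ((maxwellHatAmp d β) ^ 2 *
    (Real.pi / (Real.pi ^ 2 / (β / 4))) ^ ((d : ℝ) / 2)), by positivity, fun s t hs ht k => ?_⟩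
  have h1 := corr_sub_le (maxwellHatAmp_nonneg (d := d) hβ) (maxwellHat_rate_pos hβ) hs ht k
  have h2 := corr_le (maxwellHatAmp_nonneg (d := d) hβ) (maxwellHat_rate_pos hβ) hs ht k
  rw [abs_sub_comm, mcorr, mcorr, abs_of_nonneg (sub_nonneg.2 h2)]
  refine h1.trans (le_of_eq ?_)
  rw [show Real.pi ^ 2 / (β / 4) / 4 = Real.pi ^ 2 / β by field_simp]
  ring

theorem measurable_mcorr (β s : ℝ) :
    Measurable fun y : Vel d × ℝ => mcorr β s y.2 y.1 := by
  have h : Continuous fun p : (Vel d × ℝ) × Vel d =>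
      gauss (maxwellHatAmp d β) (Real.pi ^ 2 / (β / 4)) p.2 *
        (Real.exp (-(s * phase p.1.2 p.1.1 p.2)) *
          gauss (maxwellHatAmp d β) (Real.pi ^ 2 / (β / 4)) (p.2 - p.1.2 • p.1.1)) := by
    fun_prop
  exact (h.stronglyMeasurable.integral_prod_right' (ν := (volume : Measure (Vel d)))).measurable

/-- The integral kernel of the collision operators on the Fourier side. -/
def kernel (V : Vel d → ℝ) (β : ℝ) (z : ℂ) (s : ℝ) (p : (Vel d × ℝ) × Vel d) : ℂ :=
  (potWeight V p.1.1 : ℂ) * (Complex.exp (-(2 * Real.pi * z * p.1.2)) *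
    mcorr β s p.1.2 p.1.1 * damp s p.1.2 p.1.1 p.2) *
    ((inner ℝ p.1.1 p.2 : ℝ) * (inner ℝ p.1.1 (p.2 - p.1.2 • p.1.1) : ℝ))

theorem measurable_kernel {V : Vel d → ℝ} (hV : ContDiff ℝ ∞ V) (hc : HasCompactSupport V) (β : ℝ)
    (z : ℂ) (s : ℝ) : Measurable (kernel V β z s) := by
  have h1 := (continuous_potWeight hV hc).measurable
  have h2 := measurable_mcorr (d := d) β s
  have h3 : Measurable fun p : (Vel d × ℝ) × Vel d => damp s p.1.2 p.1.1 p.2 := by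
    unfold damp
    have : Continuous fun p : (Vel d × ℝ) × Vel d =>
      ((Real.exp (-(s * phase p.1.2 p.1.1 p.2)) : ℝ) : ℂ) := by fun_prop
    exact this.measurable
  have h4 : Measurable fun p : (Vel d × ℝ) × Vel d => (potWeight V p.1.1 : ℂ) :=
    Complex.measurable_ofReal.comp (h1.comp (measurable_fst.comp measurable_fst))
  have h5 : Measurable fun p : (Vel d × ℝ) × Vel d => ((mcorr β s p.1.2 p.1.1 : ℝ) : ℂ) :=
    Complex.measurable_ofReal.comp (h2.comp measurable_fst)
  have h6 : Measurable fun p : (Vel d × ℝ) × Vel d => Complex.exp (-(2 * Real.pi * z * p.1.2)) := by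
    have : Continuous fun p : (Vel d × ℝ) × Vel d => Complex.exp (-(2 * Real.pi * z * p.1.2)) := by
      fun_prop
    exact this.measurable
  have h7 : Measurable fun p : (Vel d × ℝ) × Vel d =>
      (((inner ℝ p.1.1 p.2 : ℝ) : ℂ) * ((inner ℝ p.1.1 (p.2 - p.1.2 • p.1.1) : ℝ) : ℂ)) := by
    have : Continuous fun p : (Vel d × ℝ) × Vel d =>
      (((inner ℝ p.1.1 p.2 : ℝ) : ℂ) * ((inner ℝ p.1.1 (p.2 - p.1.2 • p.1.1) : ℝ) : ℂ)) := by
      fun_prop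
    exact this.measurable
  exact (h4.mul ((h6.mul h5).mul h3)).mul h7

theorem norm_exp_le_one {z : ℂ} (hz : 0 ≤ z.re) {t : ℝ} (ht : 0 ≤ t) :
    ‖Complex.exp (-(2 * Real.pi * z * t))‖ ≤ 1 := by
  have hpi := Real.pi_pos
  rw [Complex.norm_exp, Real.exp_le_one_iff]
  have : (-(2 * (Real.pi : ℂ) * z * (t : ℂ))).re = -(2 * Real.pi * z.re * t) := by simp
  rw [this]
  have : 0 ≤ 2 * Real.pi * z.re * t := by positivity
  linarith

/-- On the half-plane of nonpositive real part the exponential has derivative of modulus at most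
one, so the mean value inequality applies between `0` and `-2πzt`. -/
theorem norm_exp_sub_one_le {z : ℂ} (hz : 0 ≤ z.re) {t : ℝ} (ht : 0 ≤ t) :
    ‖Complex.exp (-(2 * Real.pi * z * t)) - 1‖ ≤ 2 * Real.pi * ‖z‖ * t := by
  have hpi := Real.pi_pos
  have hd : ∀ w ∈ {w : ℂ | w.re ≤ 0}, HasDerivWithinAt Complex.exp (Complex.exp w) {w : ℂ | w.re ≤ 0} w :=
    fun w _ => (Complex.hasDerivAt_exp w).hasDerivWithinAt
  have h := (convex_halfSpace_re_le 0).norm_image_sub_le_of_norm_hasDerivWithin_le (C := 1) hd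
    (fun w hw => by rw [Complex.norm_exp]; exact Real.exp_le_one_iff.2 hw)
    (x := 0) (y := -(2 * Real.pi * z * t)) (by simp) (by
      have : (-(2 * (Real.pi : ℂ) * z * (t : ℂ))).re = -(2 * Real.pi * z.re * t) := by simp
      simp only [Set.mem_ofPred_eq]
      rw [this]
      have : 0 ≤ 2 * Real.pi * z.re * t := by positivity
      linarith)
  rw [Complex.exp_zero, sub_zero, norm_neg, one_mul] at h
  refine h.trans (le_of_eq ?_)
  simp [abs_of_pos hpi, abs_of_nonneg ht]

/-- Half of the rate pays for the polynomial: it is at most `6 + 6x⁴`, and `x⁴ exp (-r x²) ≤ 2 /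
r²`. -/
theorem one_add_sq_mul_exp_le {r : ℝ} (hr : 0 < r) (x : ℝ) :
    (1 + x + x ^ 2) ^ 2 * Real.exp (-(2 * r) * x ^ 2) ≤ (6 + 12 / r ^ 2) * Real.exp (-r * x ^ 2) := by
  have h1 : Real.exp (-(2 * r) * x ^ 2) = Real.exp (-r * x ^ 2) * Real.exp (-r * x ^ 2) := by
    rw [← Real.exp_add]; ring_nf
  have h2 : (r * x ^ 2) ^ 2 / 2 * Real.exp (-r * x ^ 2) ≤ 1 := by
    have h3 := Real.quadratic_le_exp_of_nonneg (show 0 ≤ r * x ^ 2 by positivity)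
    have h4 : (r * x ^ 2) ^ 2 / 2 ≤ Real.exp (r * x ^ 2) := by
      nlinarith [show 0 ≤ r * x ^ 2 by positivity]
    rw [show -r * x ^ 2 = -(r * x ^ 2) by ring, Real.exp_neg]
    rw [← div_eq_mul_inv]
    exact (div_le_one (Real.exp_pos _)).2 h4
  have h5 : Real.exp (-r * x ^ 2) ≤ 1 := Real.exp_le_one_iff.2 (by nlinarith [sq_nonneg x])
  have h6 : (1 + x + x ^ 2) ^ 2 ≤ 6 + 6 * x ^ 4 := by
    nlinarith [sq_nonneg (x - 1), sq_nonneg (x ^ 2 - 1), sq_nonneg (x ^ 2 - x), sq_nonneg x]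
  rw [h1, ← mul_assoc]
  refine mul_le_mul_of_nonneg_right ?_ (Real.exp_nonneg _)
  have h7 : x ^ 4 * Real.exp (-r * x ^ 2) ≤ 2 / r ^ 2 := by
    rw [le_div_iff₀ (by positivity)]
    nlinarith
  have h8 := Real.exp_pos (-r * x ^ 2)
  calc (1 + x + x ^ 2) ^ 2 * Real.exp (-r * x ^ 2) ≤ (6 + 6 * x ^ 4) * Real.exp (-r * x ^ 2) := by gcongr
    _ = 6 * Real.exp (-r * x ^ 2) + 6 * (x ^ 4 * Real.exp (-r * x ^ 2)) := by ring
    _ ≤ 6 * 1 + 6 * (2 / r ^ 2) := by gcongr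
    _ = _ := by ring

/-- The Gaussian rate of the dominating weight. -/
def rate (β : ℝ) : ℝ := Real.pi ^ 2 / (2 * β)

theorem rate_pos {β : ℝ} (hβ : 0 < β) : 0 < rate β := by unfold rate; positivity

/-- The constant absorbing polynomial factors into the Gaussian. -/
def absorb (β : ℝ) : ℝ := 6 + 12 / rate β ^ 2

theorem absorb_pos {β : ℝ} (hβ : 0 < β) : 0 < absorb β := by
  have := rate_pos hβ
  unfold absorb; positivity

theorem absorb_le {β : ℝ} (hβ : 0 < β) (t : ℝ) (k : Vel d) :
    (1 + t * ‖k‖ + (t * ‖k‖) ^ 2) ^ 2 * Real.exp (-(Real.pi ^ 2 / β) * (t ^ 2 * ‖k‖ ^ 2)) ≤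
      absorb β * Real.exp (-rate β * (t ^ 2 * ‖k‖ ^ 2)) := by
  have h := one_add_sq_mul_exp_le (rate_pos hβ) (t * ‖k‖)
  rw [mul_pow] at h ⊢
  rw [show Real.pi ^ 2 / β = 2 * rate β by unfold rate; field_simp]
  exact h

/-- The rate is halved to agree with that of `exists_mcorr_sub_le`, so that all terms share one
Gaussian. -/
theorem mcorr_le' {β : ℝ} (hβ : 0 < β) {s : ℝ} (hs : 0 ≤ s) {t : ℝ} (ht : 0 ≤ t) (k : Vel d) :
    mcorr β s t k ≤ Real.exp (-(Real.pi ^ 2 / β) * (t ^ 2 * ‖k‖ ^ 2)) := by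
  refine (mcorr_le hβ hs ht k).trans (Real.exp_le_exp.2 ?_)
  refine mul_le_mul_of_nonneg_right (neg_le_neg ?_) (by positivity)
  gcongr
  nlinarith [sq_nonneg Real.pi]

/-- The Gaussian overlap beats any power of `t ‖k‖`. The spare polynomial on the left pays later for
carrying a weight across the translation by `t k`. -/
theorem norm_kernel_le {β : ℝ} (hβ : 0 < β) (V : Vel d → ℝ) {z : ℂ} (hz : 0 ≤ z.re) {s : ℝ}
    (hs : 0 ≤ s) {y : Vel d × ℝ} (hy : 0 < y.2) (ξ : Vel d) :
    ‖kernel V β z s (y, ξ)‖ * (1 + y.2 * ‖y.1‖ + (y.2 * ‖y.1‖) ^ 2) ^ 2 ≤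
      absorb β * collisionBound V (rate β) y * (‖ξ - y.2 • y.1‖ * ‖ξ‖) := by
  obtain ⟨k, t⟩ := y
  simp only at hy ⊢
  have h1 := norm_exp_le_one hz hy.le
  have h2 := mcorr_le' hβ hs hy.le k
  have h3 := norm_damp_le_one hs hy.le k ξ
  have h4 := absorb_le hβ t k
  have h5 := potWeight_nonneg V k
  have h6 := mcorr_nonneg hβ s t k
  set P := (1 + t * ‖k‖ + (t * ‖k‖) ^ 2) ^ 2 with hP
  have hP0 : 0 ≤ P := sq_nonneg _
  have i1 : |(inner ℝ k ξ : ℝ)| ≤ ‖k‖ * ‖ξ‖ := abs_real_inner_le_norm k ξ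
  have i2 : |(inner ℝ k (ξ - t • k) : ℝ)| ≤ ‖k‖ * ‖ξ - t • k‖ := abs_real_inner_le_norm _ _
  rw [kernel, collisionBound]
  simp only [norm_mul, Complex.norm_real, Real.norm_eq_abs]
  rw [abs_of_nonneg h5, abs_of_nonneg h6]
  calc potWeight V k * (‖Complex.exp (-(2 * Real.pi * z * t))‖ * mcorr β s t k * ‖damp s t k ξ‖) *
        (|(inner ℝ k ξ : ℝ)| * |(inner ℝ k (ξ - t • k) : ℝ)|) * P
      ≤ potWeight V k * (1 * Real.exp (-(Real.pi ^ 2 / β) * (t ^ 2 * ‖k‖ ^ 2)) * 1) *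
        ((‖k‖ * ‖ξ‖) * (‖k‖ * ‖ξ - t • k‖)) * P := by gcongr
    _ = potWeight V k * ‖k‖ ^ 2 * (P * Real.exp (-(Real.pi ^ 2 / β) * (t ^ 2 * ‖k‖ ^ 2))) *
        (‖ξ - t • k‖ * ‖ξ‖) := by ring
    _ ≤ (1 + t) * (potWeight V k * ‖k‖ ^ 2) * (absorb β * Real.exp (-rate β * (t ^ 2 * ‖k‖ ^ 2))) *
        (‖ξ - t • k‖ * ‖ξ‖) := by
        have : potWeight V k * ‖k‖ ^ 2 ≤ (1 + t) * (potWeight V k * ‖k‖ ^ 2) :=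
          le_mul_of_one_le_left (by positivity) (by linarith)
        gcongr
    _ = _ := by ring

/-- Here `n`, `r`, `x` stand for `‖ξ‖`, `‖ξ - t k‖`, `t ‖k‖`. By `n ≤ (1 + x) (1 + r)`, powers of
`n` are traded for powers of `r` and of `1 + x`; only one `n` is kept, and only next to `s`. -/
theorem kernel_sub_poly {x r n P A Z s c : ℝ} (hx : 0 ≤ x) (hr : 0 ≤ r) (hn : 0 ≤ n)
    (hnr : n ≤ r + x) (hP : (1 + x) ^ 2 ≤ P) (hA : 0 ≤ A) (hZ : 0 ≤ Z) (hs : 0 ≤ s) (hc : 0 ≤ c) :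
    n * (2 * c * Z + A * s + s * (n ^ 2 + r ^ 2)) ≤
      (4 * c + A + 8) * (P * ((1 + r ^ 2) * (Z + s * n))) := by
  have hT : (1 + x) ^ 2 * (1 + r ^ 2) ≤ P * (1 + r ^ 2) := by gcongr
  have h1 : 1 ≤ (1 + x) ^ 2 := one_le_pow₀ (by linarith)
  have h2 : 1 + x ≤ (1 + x) ^ 2 := by nlinarith
  have h3 : n ≤ (1 + x) * (1 + r) := by nlinarith [mul_nonneg hx hr]
  have a2 : 1 ≤ P * (1 + r ^ 2) :=
    (one_le_mul_of_one_le_of_one_le h1 (by nlinarith [sq_nonneg r])).trans hT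
  have a1 : n ≤ 2 * (P * (1 + r ^ 2)) := by
    have : (1 + x) * (1 + r) ≤ (1 + x) ^ 2 * (2 * (1 + r ^ 2)) := by
      gcongr
      nlinarith [sq_nonneg (r - 1)]
    linarith
  have a3 : n ^ 2 + r ^ 2 ≤ 8 * (P * (1 + r ^ 2)) := by
    have e1 : n ^ 2 ≤ ((1 + x) * (1 + r)) ^ 2 := by gcongr
    have e2 : ((1 + x) * (1 + r)) ^ 2 ≤ (1 + x) ^ 2 * (2 * (1 + r ^ 2)) := by
      rw [mul_pow]
      gcongr
      nlinarith [sq_nonneg (r - 1)]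
    have e3 : 1 * (1 + r ^ 2) ≤ (1 + x) ^ 2 * (1 + r ^ 2) := by gcongr
    linarith
  set Q := P * (1 + r ^ 2) with hQ
  calc n * (2 * c * Z + A * s + s * (n ^ 2 + r ^ 2))
      = 2 * c * Z * n + A * (s * n) * 1 + s * n * (n ^ 2 + r ^ 2) := by ring
    _ ≤ 2 * c * Z * (2 * Q) + A * (s * n) * Q + s * n * (8 * Q) := by gcongr
    _ ≤ (4 * c + A + 8) * (Q * (Z + s * n)) := by
      have hQ0 : 0 ≤ Q := by linarith
      have b1 : 0 ≤ Q * Z := by positivity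
      have b2 : 0 ≤ Q * (s * n) := by positivity
      nlinarith [mul_nonneg hA b1, mul_nonneg hc b2]
    _ = _ := by rw [hQ]; ring

/-- The kernel is a product of `exp (-2πzt)`, `mcorr` and `damp`; they are changed one at a time,
each at a cost proportional to `t`, which is why `collisionBound` contains `1 + t`. All surplus
derivatives are placed on the translated variable `ξ - t k`, because only the limit solution is
known to be regular; the test variable keeps at most the weight `‖z‖ + s ‖ξ‖`. -/
theorem exists_norm_kernel_sub_le {β : ℝ} (hβ : 0 < β) (V : Vel d → ℝ) : ∃ A : ℝ, 0 < A ∧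
    ∀ (z : ℂ) (s : ℝ), 0 ≤ z.re → 0 ≤ s → ∀ y : Vel d × ℝ, 0 < y.2 → ∀ ξ : Vel d,
      ‖kernel V β z s (y, ξ) - kernel V β 0 0 (y, ξ)‖ ≤ A * collisionBound V (rate β) y *
        (((1 + ‖ξ - y.2 • y.1‖ ^ 2) * ‖ξ - y.2 • y.1‖) * (‖z‖ + s * ‖ξ‖)) := by
  obtain ⟨A, hA, hm⟩ := exists_mcorr_sub_le (d := d) hβ
  have hpi := Real.pi_pos
  refine ⟨(4 * Real.pi + A + 8) * absorb β, by have := absorb_pos hβ; positivity,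
    fun z s hz hs y hy ξ => ?_⟩
  obtain ⟨k, t⟩ := y
  simp only at hy ⊢
  have h1 := norm_exp_sub_one_le hz hy.le
  have h2 := hm s t hs hy.le k
  have h3 := norm_damp_le_one hs hy.le k ξ
  have h4 := absorb_le hβ t k
  have h5 := potWeight_nonneg V k
  have h6 := mcorr_nonneg hβ s t k
  have h7 := mcorr_le' hβ hs hy.le k
  have h8 := mcorr_le' hβ le_rfl hy.le k
  have h9 := mcorr_nonneg hβ 0 t k
  have h10 : ‖damp s t k ξ - 1‖ ≤ s * (t * (‖ξ‖ ^ 2 + ‖ξ - t • k‖ ^ 2)) := by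
    have e1 := phase_le hy.le k ξ
    have e2 := mul_nonneg hs (phase_nonneg hy.le k ξ)
    have e3 := Real.one_sub_le_exp_neg (s * phase t k ξ)
    have e4 := Real.exp_le_one_iff.2 (neg_nonpos.2 e2)
    rw [damp, ← Complex.ofReal_one, ← Complex.ofReal_sub, Complex.norm_real, Real.norm_eq_abs,
      abs_sub_comm, abs_of_nonneg (by linarith)]
    have := mul_le_mul_of_nonneg_left e1 hs
    linarith
  set x := t * ‖k‖ with hx
  have hx0 : 0 ≤ x := by positivity
  set E := Real.exp (-(Real.pi ^ 2 / β) * (t ^ 2 * ‖k‖ ^ 2)) with hE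
  have hE0 : 0 < E := Real.exp_pos _
  set r := ‖ξ - t • k‖ with hr
  have hr0 : 0 ≤ r := norm_nonneg _
  have hn0 : 0 ≤ ‖ξ‖ := norm_nonneg _
  have htri : ‖ξ‖ ≤ r + x := by
    have := norm_add_le (ξ - t • k) (t • k)
    rw [sub_add_cancel, norm_smul, Real.norm_eq_abs, abs_of_pos hy] at this
    exact this
  set P := (1 + x + x ^ 2) ^ 2 with hP
  have hP1 : (1 + x) ^ 2 ≤ P := pow_le_pow_left₀ (by positivity) (by nlinarith [sq_nonneg x]) 2
  have i1 : |(inner ℝ k ξ : ℝ)| ≤ ‖k‖ * ‖ξ‖ := abs_real_inner_le_norm k ξ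
  have i2 : |(inner ℝ k (ξ - t • k) : ℝ)| ≤ ‖k‖ * r := abs_real_inner_le_norm _ _
  have decomp : kernel V β z s ((k, t), ξ) - kernel V β 0 0 ((k, t), ξ) =
      (potWeight V k : ℂ) * ((inner ℝ k ξ : ℝ) * (inner ℝ k (ξ - t • k) : ℝ)) *
        ((Complex.exp (-(2 * Real.pi * z * t)) - 1) * mcorr β s t k * damp s t k ξ +
          (((mcorr β s t k - mcorr β 0 t k : ℝ) : ℂ)) * damp s t k ξ +
          mcorr β 0 t k * (damp s t k ξ - 1)) := by
    simp only [kernel, damp]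
    push_cast
    simp
    ring
  have hbr : ‖(Complex.exp (-(2 * Real.pi * z * t)) - 1) * mcorr β s t k * damp s t k ξ +
          (((mcorr β s t k - mcorr β 0 t k : ℝ) : ℂ)) * damp s t k ξ +
          mcorr β 0 t k * (damp s t k ξ - 1)‖ ≤
      t * E * (2 * Real.pi * ‖z‖ + A * s + s * (‖ξ‖ ^ 2 + r ^ 2)) := by
    refine (norm_add₃_le).trans ?_
    simp only [norm_mul, Complex.norm_real, Real.norm_eq_abs]
    rw [abs_of_nonneg h6, abs_of_nonneg h9]
    calc _ ≤ (2 * Real.pi * ‖z‖ * t) * E * 1 + (A * (s * t * E)) * 1 +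
          E * (s * (t * (‖ξ‖ ^ 2 + r ^ 2))) := by gcongr
      _ = _ := by ring
  have hpoly : ‖ξ‖ * (2 * Real.pi * ‖z‖ + A * s + s * (‖ξ‖ ^ 2 + r ^ 2)) ≤
      (4 * Real.pi + A + 8) * (P * ((1 + r ^ 2) * (‖z‖ + s * ‖ξ‖))) := by
    exact kernel_sub_poly hx0 hr0 hn0 htri hP1 hA (norm_nonneg z) hs hpi.le
  rw [decomp, norm_mul]
  have hpre : ‖(potWeight V k : ℂ) * ((inner ℝ k ξ : ℝ) * (inner ℝ k (ξ - t • k) : ℝ))‖ ≤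
      potWeight V k * ((‖k‖ * ‖ξ‖) * (‖k‖ * r)) := by
    simp only [norm_mul, Complex.norm_real, Real.norm_eq_abs]
    rw [abs_of_nonneg h5]
    gcongr
  rw [collisionBound]
  simp only
  have hq : 0 ≤ potWeight V k * ‖k‖ ^ 2 := by positivity
  have hz0 := norm_nonneg z
  calc _ ≤ (potWeight V k * ((‖k‖ * ‖ξ‖) * (‖k‖ * r))) *
        (t * E * (2 * Real.pi * ‖z‖ + A * s + s * (‖ξ‖ ^ 2 + r ^ 2))) := by gcongr
    _ = (potWeight V k * ‖k‖ ^ 2) * t * E * r *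
        (‖ξ‖ * (2 * Real.pi * ‖z‖ + A * s + s * (‖ξ‖ ^ 2 + r ^ 2))) := by ring
    _ ≤ (potWeight V k * ‖k‖ ^ 2) * t * E * r *
        ((4 * Real.pi + A + 8) * (P * ((1 + r ^ 2) * (‖z‖ + s * ‖ξ‖)))) := by gcongr
    _ = (4 * Real.pi + A + 8) * (potWeight V k * ‖k‖ ^ 2) * t * (P * E) *
        (((1 + r ^ 2) * r) * (‖z‖ + s * ‖ξ‖)) := by ring
    _ ≤ (4 * Real.pi + A + 8) * (potWeight V k * ‖k‖ ^ 2) * (1 + t) *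
        (absorb β * Real.exp (-rate β * (t ^ 2 * ‖k‖ ^ 2))) *
        (((1 + r ^ 2) * r) * (‖z‖ + s * ‖ξ‖)) := by
        gcongr
        linarith
    _ = _ := by ring

/-! ### The collision forms and their continuity -/

/-- Functions on the Fourier side in the domain of the collision forms: the Fourier transforms
of `H¹` functions. -/
structure FormDomain (U : Vel d → ℂ) : Prop where
  meas : Measurable U
  memLp : MemLp U 2 volume
  memLp_norm : MemLp (fun ξ => ‖ξ‖ * ‖U ξ‖) 2 volume

/-- The norm of the gradient, on the Fourier side and without the factor `2π`. -/
def dirichlet (U : Vel d → ℂ) : ℝ := l2n fun ξ => ‖ξ‖ * ‖U ξ‖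

/-- Translation by `t k` with `y = (k, t)`. -/
def shift (y : Vel d × ℝ) : Vel d := y.2 • y.1

theorem measurable_shift : Measurable (shift : Vel d × ℝ → Vel d) := by
  have : Continuous (shift : Vel d × ℝ → Vel d) := by unfold shift; fun_prop
  exact this.measurable

theorem norm_shift {y : Vel d × ℝ} (hy : 0 < y.2) : ‖shift y‖ = y.2 * ‖y.1‖ := by
  rw [shift, norm_smul, Real.norm_eq_abs, abs_of_pos hy]

/-- The integrand of the collision form. -/
def formIntegrand (V : Vel d → ℝ) (β : ℝ) (z : ℂ) (s : ℝ) (U Φ : Vel d → ℂ)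
    (p : (Vel d × ℝ) × Vel d) : ℂ :=
  kernel V β z s p * U (p.2 - shift p.1) * Φ p.2

/-- The bilinear form of the collision operator. -/
def form (V : Vel d → ℝ) (β : ℝ) (z : ℂ) (s : ℝ) (U Φ : Vel d → ℂ) : ℂ :=
  ∫ p, formIntegrand V β z s U Φ p ∂((collisionMeasure d).prod volume)

theorem measurable_formIntegrand {V : Vel d → ℝ} (hV : ContDiff ℝ ∞ V) (hc : HasCompactSupport V)
    (β : ℝ) (z : ℂ) (s : ℝ) {U Φ : Vel d → ℂ} (hU : Measurable U) (hΦ : Measurable Φ) :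
    Measurable (formIntegrand V β z s U Φ) :=
  ((measurable_kernel hV hc β z s).mul
    (hU.comp (measurable_snd.sub (measurable_shift.comp measurable_fst)))).mul (hΦ.comp measurable_snd)

theorem collisionBound_nonneg (V : Vel d → ℝ) (a : ℝ) {y : Vel d × ℝ} (hy : 0 < y.2) :
    0 ≤ collisionBound V a y := by
  have := potWeight_nonneg V y.1
  unfold collisionBound; positivity

/-- The norm of the collision forms. -/
def formBound (V : Vel d → ℝ) (β : ℝ) : ℝ :=
  absorb β * ∫ y, collisionBound V (rate β) y ∂collisionMeasure d

theorem integral_collisionBound_nonneg (V : Vel d → ℝ) (a : ℝ) :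
    0 ≤ ∫ y, collisionBound V a y ∂collisionMeasure d :=
  integral_nonneg_of_ae (by
    filter_upwards [ae_collisionMeasure_pos] with y hy using collisionBound_nonneg V a hy)

theorem formBound_nonneg (V : Vel d → ℝ) {β : ℝ} (hβ : 0 < β) : 0 ≤ formBound V β :=
  mul_nonneg (absorb_pos hβ).le (integral_collisionBound_nonneg V _)

section Bounds

variable {V : Vel d → ℝ} {β : ℝ}

/-- A pointwise bound by the dominating kernel gives integrability and a norm bound. -/
theorem integrable_and_norm_integral_le (hd : 2 ≤ d) (hV : ContDiff ℝ ∞ V)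
    (hc : HasCompactSupport V) (hβ : 0 < β) {C : ℝ} (hC : 0 ≤ C) {f φ : Vel d → ℝ}
    (hf : MemLp f 2 volume) (hφ : MemLp φ 2 volume) {H : (Vel d × ℝ) × Vel d → ℂ}
    (hH : Measurable H) (hle : ∀ y : Vel d × ℝ, 0 < y.2 → ∀ ξ, ‖H (y, ξ)‖ ≤
      C * collisionBound V (rate β) y * (f (ξ - shift y) * φ ξ)) :
    Integrable H ((collisionMeasure d).prod volume) ∧
      ‖∫ p, H p ∂((collisionMeasure d).prod volume)‖ ≤
        C * (∫ y, collisionBound V (rate β) y ∂collisionMeasure d) * (l2n f * l2n φ) := by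
  have h := schur_test (ν := collisionMeasure d) measurable_shift
    ((integrable_collisionBound hd hV hc (rate_pos hβ)).const_mul C)
    (by filter_upwards [ae_collisionMeasure_pos] with y hy
        exact mul_nonneg hC (collisionBound_nonneg V _ hy)) hf hφ hH.aestronglyMeasurable
    (by filter_upwards [ae_collisionMeasure_pos] with y hy using hle y hy)
  rwa [integral_const_mul] at h

theorem one_le_poly {y : Vel d × ℝ} (hy : 0 < y.2) : 1 ≤ 1 + y.2 * ‖y.1‖ + (y.2 * ‖y.1‖) ^ 2 := by
  have : 0 ≤ y.2 * ‖y.1‖ := by positivity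
  nlinarith [sq_nonneg (y.2 * ‖y.1‖)]

theorem norm_kernel_le' (hβ : 0 < β) (V : Vel d → ℝ) {z : ℂ} (hz : 0 ≤ z.re) {s : ℝ}
    (hs : 0 ≤ s) {y : Vel d × ℝ} (hy : 0 < y.2) (ξ : Vel d) :
    ‖kernel V β z s (y, ξ)‖ * (1 + y.2 * ‖y.1‖ + (y.2 * ‖y.1‖) ^ 2) ≤
      absorb β * collisionBound V (rate β) y * (‖ξ - shift y‖ * ‖ξ‖) := by
  refine le_trans ?_ (norm_kernel_le hβ V hz hs hy ξ)
  have := one_le_poly hy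
  exact mul_le_mul_of_nonneg_left (le_self_pow₀ this two_ne_zero) (norm_nonneg _)

/-- The kernel contains `k · ξ` and `k · (ξ - t k)`, hence one derivative for each argument; Schur's
test does the rest. -/
theorem form_bound (hd : 2 ≤ d) (hV : ContDiff ℝ ∞ V)
    (hc : HasCompactSupport V) (hβ : 0 < β) {z : ℂ} (hz : 0 ≤ z.re) {s : ℝ} (hs : 0 ≤ s)
    {U Φ : Vel d → ℂ} (hU : Measurable U) (hU1 : MemLp (fun ξ => ‖ξ‖ * ‖U ξ‖) 2 volume)
    (hΦ : Measurable Φ) (hΦ1 : MemLp (fun ξ => ‖ξ‖ * ‖Φ ξ‖) 2 volume) :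
    Integrable (formIntegrand V β z s U Φ) ((collisionMeasure d).prod volume) ∧
      ‖form V β z s U Φ‖ ≤ formBound V β * (dirichlet U * dirichlet Φ) := by
  refine integrable_and_norm_integral_le hd hV hc hβ (absorb_pos hβ).le hU1 hΦ1
    (measurable_formIntegrand hV hc β z s hU hΦ) fun y hy ξ => ?_
  have h1 := norm_kernel_le' hβ V hz hs hy ξ
  have h2 := one_le_poly hy
  have h3 : ‖kernel V β z s (y, ξ)‖ ≤ absorb β * collisionBound V (rate β) y * (‖ξ - shift y‖ * ‖ξ‖) :=
    (le_mul_of_one_le_right (norm_nonneg _) h2).trans h1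
  rw [formIntegrand, norm_mul, norm_mul]
  calc _ ≤ absorb β * collisionBound V (rate β) y * (‖ξ - shift y‖ * ‖ξ‖) *
        ‖U (ξ - shift y)‖ * ‖Φ ξ‖ := by gcongr
    _ = _ := by ring

/-- The consistency estimate behind the rate `1 / N`: in the application `‖z‖ ≤ (1 + |α|) / N` and
`s = 8π³κ / N`. The price is three derivatives on `U`. -/
theorem exists_form_sub_bound (hd : 2 ≤ d) (hV : ContDiff ℝ ∞ V)
    (hc : HasCompactSupport V) (hβ : 0 < β) : ∃ A : ℝ, 0 ≤ A ∧ ∀ (z : ℂ) (s : ℝ), 0 ≤ z.re → 0 ≤ s →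
    ∀ U Φ : Vel d → ℂ, FormDomain U →
      MemLp (fun ξ => (1 + ‖ξ‖ ^ 2) * ‖ξ‖ * ‖U ξ‖) 2 volume → FormDomain Φ →
      ‖form V β z s U Φ - form V β 0 0 U Φ‖ ≤ A * (l2n (fun ξ => (1 + ‖ξ‖ ^ 2) * ‖ξ‖ * ‖U ξ‖) *
        (‖z‖ * l2n (fun ξ => ‖Φ ξ‖) + s * dirichlet Φ)) := by
  obtain ⟨A, hA, hk⟩ := exists_norm_kernel_sub_le hβ V
  refine ⟨A * (∫ y, collisionBound V (rate β) y ∂collisionMeasure d) * 2,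
    mul_nonneg (mul_nonneg hA.le (integral_collisionBound_nonneg V _)) zero_le_two, ?_⟩
  intro z s hz hs U Φ hU hU3 hΦ
  have i1 := (form_bound hd hV hc hβ hz hs hU.meas hU.memLp_norm hΦ.meas hΦ.memLp_norm).1
  have i2 := (form_bound (z := 0) (s := 0) hd hV hc hβ le_rfl le_rfl hU.meas hU.memLp_norm
    hΦ.meas hΦ.memLp_norm).1
  have hφ : MemLp (fun ξ => ‖z‖ * ‖Φ ξ‖ + s * (‖ξ‖ * ‖Φ ξ‖)) 2 volume :=
    (hΦ.memLp.norm.const_mul ‖z‖).add (hΦ.memLp_norm.const_mul s)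
  have h := (integrable_and_norm_integral_le hd hV hc hβ hA.le hU3 hφ
    (H := fun p => formIntegrand V β z s U Φ p - formIntegrand V β 0 0 U Φ p)
    ((measurable_formIntegrand hV hc β z s hU.meas hΦ.meas).sub
      (measurable_formIntegrand hV hc β 0 0 hU.meas hΦ.meas)) fun y hy ξ => ?_).2
  · rw [integral_sub i1 i2] at h
    have h2 := l2n_add_le (hΦ.memLp.norm.const_mul ‖z‖) (hΦ.memLp_norm.const_mul s)
    rw [l2n_const_mul (norm_nonneg z), l2n_const_mul hs] at h2
    refine h.trans ?_
    rw [mul_assoc _ (2 : ℝ), mul_left_comm (2 : ℝ)]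
    refine mul_le_mul_of_nonneg_left (mul_le_mul_of_nonneg_left h2 (l2n_nonneg _)) ?_
    exact mul_nonneg hA.le (integral_collisionBound_nonneg V _)
  · rw [formIntegrand, formIntegrand, ← sub_mul, ← sub_mul, norm_mul, norm_mul]
    calc _ ≤ A * collisionBound V (rate β) y *
        (((1 + ‖ξ - shift y‖ ^ 2) * ‖ξ - shift y‖) * (‖z‖ + s * ‖ξ‖)) *
        ‖U (ξ - shift y)‖ * ‖Φ ξ‖ := by gcongr; exact hk z s hz hs y hy ξ
      _ = _ := by ring

/-! ### Weights and commutators -/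

/-- The weight `(μ² + |ξ|²) / (1 + ε (μ² + |ξ|²))`. -/
def weight (μ ε : ℝ) (ξ : Vel d) : ℝ := (μ ^ 2 + ‖ξ‖ ^ 2) / (1 + ε * (μ ^ 2 + ‖ξ‖ ^ 2))

theorem weight_nonneg (μ : ℝ) {ε : ℝ} (hε : 0 ≤ ε) (ξ : Vel d) : 0 ≤ weight μ ε ξ := by
  unfold weight; positivity

theorem measurable_weight (μ ε : ℝ) : Measurable (weight μ ε : Vel d → ℝ) := by
  unfold weight; fun_prop

theorem weight_le (μ : ℝ) {ε : ℝ} (hε : 0 < ε) (ξ : Vel d) : weight μ ε ξ ≤ ε⁻¹ := by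
  unfold weight
  rw [div_le_iff₀ (by positivity)]
  field_simp
  nlinarith [sq_nonneg μ, sq_nonneg ‖ξ‖]

theorem weight_le' {μ : ℝ} (hμ : 1 ≤ μ) {ε : ℝ} (hε : 0 ≤ ε) (ξ : Vel d) :
    weight μ ε ξ ≤ μ ^ 2 * (1 + ‖ξ‖ ^ 2) := by
  have h1 : weight μ ε ξ ≤ μ ^ 2 + ‖ξ‖ ^ 2 := by
    unfold weight
    exact div_le_self (by positivity) (le_add_of_nonneg_right (by positivity))
  nlinarith [one_le_pow₀ (n := 2) hμ, sq_nonneg ‖ξ‖]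

/-- The weight varies slowly at scale `μ`, uniformly in `ε`. The difference of the two quotients has
numerator at most `‖η‖ (2 ‖ξ - η‖ + ‖η‖)`, and `2 μ r ≤ μ² + r²` extracts the factor `1 / μ`; the
denominator at `ξ` is at least one and is discarded. -/
theorem abs_weight_sub_le {μ : ℝ} (hμ : 1 ≤ μ) {ε : ℝ} (hε : 0 ≤ ε) (ξ η : Vel d) :
    |weight μ ε ξ - weight μ ε (ξ - η)| ≤ (‖η‖ + ‖η‖ ^ 2) / μ * weight μ ε (ξ - η) := by
  have h1 : ‖ξ‖ ≤ ‖ξ - η‖ + ‖η‖ := by simpa using norm_add_le (ξ - η) η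
  have h2 : ‖ξ - η‖ ≤ ‖ξ‖ + ‖η‖ := norm_sub_le ξ η
  unfold weight
  set r := ‖ξ - η‖
  set n := ‖ξ‖
  set x := ‖η‖
  have hr : 0 ≤ r := norm_nonneg _
  have hn : 0 ≤ n := norm_nonneg _
  have hx : 0 ≤ x := norm_nonneg _
  have hμ0 : 0 < μ := by linarith
  have hA : 0 < 1 + ε * (μ ^ 2 + n ^ 2) := by positivity
  have hB : 0 < 1 + ε * (μ ^ 2 + r ^ 2) := by positivity
  have e : (μ ^ 2 + n ^ 2) / (1 + ε * (μ ^ 2 + n ^ 2)) - (μ ^ 2 + r ^ 2) / (1 + ε * (μ ^ 2 + r ^ 2)) =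
      (n ^ 2 - r ^ 2) / ((1 + ε * (μ ^ 2 + n ^ 2)) * (1 + ε * (μ ^ 2 + r ^ 2))) := by
    field_simp
    ring
  have h3 : |n ^ 2 - r ^ 2| ≤ x * (2 * r + x) := by
    rw [abs_le]
    constructor <;> nlinarith
  have h4 : x * (2 * r + x) ≤ (x + x ^ 2) / μ * (μ ^ 2 + r ^ 2) := by
    rw [div_mul_eq_mul_div, le_div_iff₀ hμ0]
    nlinarith [mul_nonneg hx (sq_nonneg (μ - r)), mul_nonneg (sq_nonneg x) (sq_nonneg r),
      mul_nonneg (sq_nonneg x) (show 0 ≤ μ * (μ - 1) by nlinarith)]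
  rw [e, abs_div, abs_of_pos (mul_pos hA hB), ← mul_div_assoc, div_le_div_iff₀ (mul_pos hA hB) hB]
  calc |n ^ 2 - r ^ 2| * (1 + ε * (μ ^ 2 + r ^ 2)) ≤
        (x + x ^ 2) / μ * (μ ^ 2 + r ^ 2) * (1 + ε * (μ ^ 2 + r ^ 2)) := by
        gcongr; exact h3.trans h4
    _ = 1 * ((x + x ^ 2) / μ * (μ ^ 2 + r ^ 2) * (1 + ε * (μ ^ 2 + r ^ 2))) := by ring
    _ ≤ (1 + ε * (μ ^ 2 + n ^ 2)) *
        ((x + x ^ 2) / μ * (μ ^ 2 + r ^ 2) * (1 + ε * (μ ^ 2 + r ^ 2))) := by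
        gcongr
        exact le_add_of_nonneg_right (by positivity)
    _ = _ := by ring

/-- Purpose of the regularisation: for `ε > 0` the weight is bounded, so weighted solutions are
admissible test functions. -/
theorem FormDomain.weight_mul {U : Vel d → ℂ} (hU : FormDomain U) (μ : ℝ) {ε : ℝ} (hε : 0 < ε) :
    FormDomain fun ξ => (weight μ ε ξ : ℂ) * U ξ := by
  have hm : Measurable fun ξ : Vel d => ((weight μ ε ξ : ℝ) : ℂ) :=
    Complex.measurable_ofReal.comp (measurable_weight μ ε)
  have hb : ∀ ξ : Vel d, ‖((weight μ ε ξ : ℝ) : ℂ)‖ ≤ ε⁻¹ := fun ξ => by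
    rw [Complex.norm_real, Real.norm_eq_abs, abs_of_nonneg (weight_nonneg μ hε.le ξ)]
    exact weight_le μ hε ξ
  refine ⟨hm.mul hU.meas, ?_, ?_⟩
  · refine (hU.memLp.const_mul ((ε⁻¹ : ℝ) : ℂ)).mono (hm.mul hU.meas).aestronglyMeasurable
      (ae_of_all _ fun ξ => ?_)
    rw [norm_mul, norm_mul, Complex.norm_real ε⁻¹, Real.norm_eq_abs, abs_of_pos (inv_pos.2 hε)]
    gcongr
    exact hb ξ
  · refine (hU.memLp_norm.const_mul ε⁻¹).mono
      (measurable_norm.mul (hm.mul hU.meas).norm).aestronglyMeasurable (ae_of_all _ fun ξ => ?_)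
    simp only [norm_mul, norm_norm]
    rw [Real.norm_eq_abs, abs_of_pos (inv_pos.2 hε)]
    calc _ ≤ ‖ξ‖ * (ε⁻¹ * ‖U ξ‖) := by gcongr; exact hb ξ
      _ = _ := by ring

theorem norm_weight_mul (μ : ℝ) {ε : ℝ} (hε : 0 ≤ ε) (ξ : Vel d) (c : ℂ) :
    ‖(weight μ ε ξ : ℂ) * c‖ = weight μ ε ξ * ‖c‖ := by
  rw [norm_mul, Complex.norm_real, Real.norm_eq_abs, abs_of_nonneg (weight_nonneg μ hε ξ)]

/-- The form against a doubly weighted function. -/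
theorem form_weight_bound (hd : 2 ≤ d) (hV : ContDiff ℝ ∞ V)
    (hc : HasCompactSupport V) (hβ : 0 < β) {z : ℂ} (hz : 0 ≤ z.re) {s : ℝ} (hs : 0 ≤ s)
    {U Φ : Vel d → ℂ} (hU : FormDomain U) (hΦ : FormDomain Φ) {μ : ℝ} (hμ : 1 ≤ μ) {ε : ℝ}
    (hε : 0 < ε) :
    ‖form V β z s U (fun ξ => (weight μ ε ξ : ℂ) * ((weight μ ε ξ : ℂ) * Φ ξ))‖ ≤
      formBound V β * (dirichlet (fun ξ => (weight μ ε ξ : ℂ) * U ξ) *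
        dirichlet (fun ξ => (weight μ ε ξ : ℂ) * Φ ξ)) := by
  have h1 := hU.weight_mul μ hε
  have h2 := hΦ.weight_mul μ hε
  refine (integrable_and_norm_integral_le hd hV hc hβ (absorb_pos hβ).le h1.memLp_norm h2.memLp_norm
    (measurable_formIntegrand hV hc β z s hU.meas (h2.weight_mul μ hε).meas) fun y hy ξ => ?_).2
  have h3 := norm_kernel_le' hβ V hz hs hy ξ
  have h4 := abs_weight_sub_le hμ hε.le ξ (shift y)
  rw [norm_shift hy] at h4
  have h5 := weight_nonneg μ hε.le (ξ - shift y)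
  have h6 := weight_nonneg μ hε.le ξ
  set x := y.2 * ‖y.1‖ with hx
  have hx0 : 0 ≤ x := by positivity
  -- One copy of the weight passes from `ξ` to the translated point, at a polynomial cost covered by
  -- the spare factor in `norm_kernel_le'`.
  have h7 : weight μ ε ξ ≤ (1 + x + x ^ 2) * weight μ ε (ξ - shift y) := by
    have : (x + x ^ 2) / μ ≤ x + x ^ 2 := div_le_self (by positivity) hμ
    have := mul_le_mul_of_nonneg_right this h5
    linarith [le_abs_self (weight μ ε ξ - weight μ ε (ξ - shift y))]
  rw [formIntegrand, norm_mul, norm_mul]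
  simp only [norm_weight_mul μ hε.le]
  calc ‖kernel V β z s (y, ξ)‖ * ‖U (ξ - shift y)‖ * (weight μ ε ξ * (weight μ ε ξ * ‖Φ ξ‖))
      ≤ ‖kernel V β z s (y, ξ)‖ * ‖U (ξ - shift y)‖ *
        (((1 + x + x ^ 2) * weight μ ε (ξ - shift y)) * (weight μ ε ξ * ‖Φ ξ‖)) := by gcongr
    _ = (‖kernel V β z s (y, ξ)‖ * (1 + x + x ^ 2)) * (‖U (ξ - shift y)‖ *
        (weight μ ε (ξ - shift y) * (weight μ ε ξ * ‖Φ ξ‖))) := by ring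
    _ ≤ (absorb β * collisionBound V (rate β) y * (‖ξ - shift y‖ * ‖ξ‖)) * (‖U (ξ - shift y)‖ *
        (weight μ ε (ξ - shift y) * (weight μ ε ξ * ‖Φ ξ‖))) := by gcongr
    _ = _ := by ring

/-- The commutator of the form with the weight. -/
theorem form_weight_commutator_bound (hd : 2 ≤ d) (hV : ContDiff ℝ ∞ V)
    (hc : HasCompactSupport V) (hβ : 0 < β) {z : ℂ} (hz : 0 ≤ z.re) {s : ℝ} (hs : 0 ≤ s)
    {U Φ : Vel d → ℂ} (hU : FormDomain U) (hΦ : FormDomain Φ) {μ : ℝ} (hμ : 1 ≤ μ) {ε : ℝ}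
    (hε : 0 < ε) :
    ‖form V β z s U (fun ξ => (weight μ ε ξ : ℂ) * ((weight μ ε ξ : ℂ) * Φ ξ)) -
      form V β z s (fun ξ => (weight μ ε ξ : ℂ) * U ξ) (fun ξ => (weight μ ε ξ : ℂ) * Φ ξ)‖ ≤
      formBound V β / μ * (dirichlet (fun ξ => (weight μ ε ξ : ℂ) * U ξ) *
        dirichlet (fun ξ => (weight μ ε ξ : ℂ) * Φ ξ)) := by
  have h1 := hU.weight_mul μ hε
  have h2 := hΦ.weight_mul μ hε
  have h3 := h2.weight_mul μ hε
  have i1 := (form_bound hd hV hc hβ hz hs hU.meas hU.memLp_norm h3.meas h3.memLp_norm).1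
  have i2 := (form_bound hd hV hc hβ hz hs h1.meas h1.memLp_norm h2.meas h2.memLp_norm).1
  rw [form, form, ← integral_sub i1 i2]
  have hμ0 : 0 < μ := by linarith
  refine ((integrable_and_norm_integral_le hd hV hc hβ (C := absorb β / μ)
    (div_nonneg (absorb_pos hβ).le hμ0.le) h1.memLp_norm h2.memLp_norm
    ((measurable_formIntegrand hV hc β z s hU.meas h3.meas).sub
      (measurable_formIntegrand hV hc β z s h1.meas h2.meas)) fun y hy ξ => ?_).2).trans_eq ?_
  · have h3 := norm_kernel_le' hβ V hz hs hy ξ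
    have h4 := abs_weight_sub_le hμ hε.le ξ (shift y)
    rw [norm_shift hy] at h4
    have h5 := weight_nonneg μ hε.le (ξ - shift y)
    have h6 := weight_nonneg μ hε.le ξ
    set x := y.2 * ‖y.1‖ with hx
    have hx0 : 0 ≤ x := by positivity
    have h7 : |weight μ ε ξ - weight μ ε (ξ - shift y)| ≤
        (1 + x + x ^ 2) / μ * weight μ ε (ξ - shift y) := by
      refine h4.trans (mul_le_mul_of_nonneg_right ?_ h5)
      gcongr
      linarith
    -- Only the difference of the weights at `ξ` and at the translated point survives; it carries
    -- the gain `1 / μ`.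
    have e : formIntegrand V β z s U (fun ξ => (weight μ ε ξ : ℂ) * ((weight μ ε ξ : ℂ) * Φ ξ)) (y, ξ) -
        formIntegrand V β z s (fun ξ => (weight μ ε ξ : ℂ) * U ξ)
          (fun ξ => (weight μ ε ξ : ℂ) * Φ ξ) (y, ξ) =
        kernel V β z s (y, ξ) * U (ξ - shift y) *
          (((weight μ ε ξ - weight μ ε (ξ - shift y) : ℝ) : ℂ) * ((weight μ ε ξ : ℂ) * Φ ξ)) := by
      simp only [formIntegrand]
      push_cast
      ring
    rw [Pi.sub_apply, e, norm_mul, norm_mul, norm_mul, Complex.norm_real, Real.norm_eq_abs]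
    simp only [norm_weight_mul μ hε.le]
    calc _ ≤ ‖kernel V β z s (y, ξ)‖ * ‖U (ξ - shift y)‖ *
          (((1 + x + x ^ 2) / μ * weight μ ε (ξ - shift y)) * (weight μ ε ξ * ‖Φ ξ‖)) := by gcongr
      _ = (‖kernel V β z s (y, ξ)‖ * (1 + x + x ^ 2)) / μ * (‖U (ξ - shift y)‖ *
          (weight μ ε (ξ - shift y) * (weight μ ε ξ * ‖Φ ξ‖))) := by ring
      _ ≤ (absorb β * collisionBound V (rate β) y * (‖ξ - shift y‖ * ‖ξ‖)) / μ * (‖U (ξ - shift y)‖ *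
          (weight μ ε (ξ - shift y) * (weight μ ε ξ * ‖Φ ξ‖))) := by gcongr
      _ = _ := by ring
  · rw [formBound, dirichlet, dirichlet]
    ring

/-- The collision operator, as a function. -/
def collisionOp (V : Vel d → ℝ) (β : ℝ) (z : ℂ) (s : ℝ) (U : Vel d → ℂ) (ξ : Vel d) : ℂ :=
  ∫ y, kernel V β z s (y, ξ) * U (ξ - shift y) ∂collisionMeasure d

theorem form_eq_integral_collisionOp (hd : 2 ≤ d) (hV : ContDiff ℝ ∞ V)
    (hc : HasCompactSupport V) (hβ : 0 < β) {z : ℂ} (hz : 0 ≤ z.re) {s : ℝ} (hs : 0 ≤ s)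
    {U Φ : Vel d → ℂ} (hU : Measurable U) (hU1 : MemLp (fun ξ => ‖ξ‖ * ‖U ξ‖) 2 volume)
    (hΦ : Measurable Φ) (hΦ1 : MemLp (fun ξ => ‖ξ‖ * ‖Φ ξ‖) 2 volume) :
    Integrable (fun ξ => collisionOp V β z s U ξ * Φ ξ) ∧
      form V β z s U Φ = ∫ ξ, collisionOp V β z s U ξ * Φ ξ := by
  have h := (form_bound hd hV hc hβ hz hs hU hU1 hΦ hΦ1).1
  have e : ∀ ξ, ∫ y, formIntegrand V β z s U Φ (y, ξ) ∂collisionMeasure d =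
      collisionOp V β z s U ξ * Φ ξ := fun ξ => by
    simp only [formIntegrand]
    rw [integral_mul_const, collisionOp]
  have h1 := h.integral_prod_right
  simp only [e] at h1
  refine ⟨h1, ?_⟩
  rw [form, integral_prod_symm _ h]
  simp only [e]

end Bounds

/-! ### Positivity of the collision form -/

/-- Resolvents of contraction semigroups have nonnegative real part. -/
theorem re_integral_exp_inner_nonneg {E : Type*} [NormedAddCommGroup E] [InnerProductSpace ℂ E]
    [CompleteSpace E] {x : ℝ → E} (hx : Continuous x) (hb : ∀ t, ‖x t‖ ≤ ‖x 0‖)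
    (T : ℝ → E →L[ℂ] E) (hT : ∀ r, 0 ≤ r → ∀ v, ‖T r v‖ ≤ ‖v‖)
    (hTx : ∀ r t, 0 ≤ r → 0 ≤ t → T r (x t) = x (r + t)) {c : ℂ} (hc : 0 < c.re) :
    0 ≤ (∫ t in Ioi (0 : ℝ), Complex.exp (-(c * t)) * inner ℂ (x 0) (x t)).re := by
  set y : ℝ → E := fun t => Complex.exp (-(c * t)) • x t with hy
  have hyc : Continuous y := by fun_prop
  have hyi : IntegrableOn y (Ioi 0) := by
    refine ((exp_neg_integrableOn_Ioi 0 hc).mul_const ‖x 0‖).mono' hyc.aestronglyMeasurable.restrict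
      (ae_of_all _ fun t => ?_)
    rw [hy, norm_smul, Complex.norm_exp]
    have : (-(c * (t : ℂ))).re = -c.re * t := by simp
    rw [this]
    exact mul_le_mul_of_nonneg_left (hb t) (Real.exp_nonneg _)
  set h : E := ∫ t in Ioi (0 : ℝ), y t with hh
  set J : ℝ → E := fun r => ∫ t in (0 : ℝ)..r, y t with hJ
  -- With `h = ∫₀^∞ y` and `J r = ∫₀ʳ y`, the semigroup law gives `T r h = exp (c r) (h - J r)`.
  -- Contractivity and `0 < c.re` then yield `‖h - J r‖ ≤ ‖h‖`, and expanding the square gives the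
  -- sign.
  have key : ∀ r, 0 < r → 0 ≤ (inner ℂ (J r) h).re := by
    intro r hr
    have e1 : T r h = Complex.exp (c * r) • (h - J r) := by
      have s1 : h - J r = ∫ t in Ioi r, y t := by
        rw [hh, hJ, sub_eq_iff_eq_add']
        exact (intervalIntegral.integral_interval_add_Ioi hyi
          (hyi.mono_set (Ioi_subset_Ioi hr.le))).symm
      have s2 : ∫ t in Ioi r, y t = ∫ t in Ioi (0 : ℝ), y (t + r) := by
        rw [← (measurePreserving_add_right volume r).setIntegral_preimage_emb
          (measurableEmbedding_addRight r) y (Ioi r)]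
        simp
      rw [s1, s2, ← integral_smul, hh, ← ContinuousLinearMap.integral_comp_comm _ hyi]
      refine setIntegral_congr_fun measurableSet_Ioi fun t ht => ?_
      have ht' : (0 : ℝ) < t := ht
      simp only [hy]
      rw [map_smul, hTx r t hr.le ht'.le, smul_smul, ← Complex.exp_add, add_comm r t]
      congr 2
      push_cast
      ring
    have e2 : ‖h - J r‖ ≤ ‖h‖ := by
      have e3 : ‖T r h‖ = Real.exp (c.re * r) * ‖h - J r‖ := by
        rw [e1, norm_smul, Complex.norm_exp]
        simp
      have e4 := hT r hr.le h
      have e5 : 1 ≤ Real.exp (c.re * r) := Real.one_le_exp (by positivity)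
      rw [e3] at e4
      exact (le_mul_of_one_le_left (norm_nonneg _) e5).trans e4
    have e6 := norm_sub_sq (𝕜 := ℂ) h (J r)
    have e7 : ‖h - J r‖ ^ 2 ≤ ‖h‖ ^ 2 := by gcongr
    rw [inner_re_symm] at e6
    have e8 := sq_nonneg ‖J r‖
    simp only [RCLike.re_to_complex] at e6
    linarith
  -- Dividing by `r` and letting `r → 0` replaces `J r` by its initial velocity `x 0`.
  have hder : HasDerivAt J (y 0) 0 :=
    intervalIntegral.integral_hasDerivAt_right (hyc.intervalIntegrable 0 0)
      (hyc.stronglyMeasurableAtFilter _ _) hyc.continuousAt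
  have hlim := (hasDerivAt_iff_tendsto_slope_zero.1 hder).mono_left
    (nhdsWithin_mono 0 (show Ioi (0 : ℝ) ⊆ {0}ᶜ from fun r hr => (ne_of_gt hr)))
  have hJ0 : J 0 = 0 := by simp [hJ]
  have hy0 : y 0 = x 0 := by simp [hy]
  simp only [zero_add, hJ0, sub_zero, hy0] at hlim
  have hlim2 : Filter.Tendsto (fun r : ℝ => (inner ℂ (r⁻¹ • J r) h).re) (nhdsWithin 0 (Ioi 0))
      (nhds (inner ℂ (x 0) h).re) :=
    (Complex.continuous_re.comp (continuous_id.inner continuous_const)).continuousAt.tendsto.comp hlim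
  have h0 : 0 ≤ (inner ℂ (x 0) h).re := by
    refine ge_of_tendsto hlim2 ?_
    filter_upwards [self_mem_nhdsWithin] with r hr
    have hr' : (0 : ℝ) < r := hr
    rw [inner_smul_left_eq_smul, Complex.smul_re, smul_eq_mul]
    exact mul_nonneg (inv_nonneg.2 hr'.le) (key r hr')
  have e : inner ℂ (x 0) h = ∫ t in Ioi (0 : ℝ), Complex.exp (-(c * t)) * inner ℂ (x 0) (x t) := by
    rw [hh, ← integral_inner hyi]
    simp only [hy, inner_smul_right]
  rwa [← e]

/-- The tensor product as a bounded bilinear map. -/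
def tensorL2 : L2 d →L[ℂ] L2 d →L[ℂ] L2Pair d :=
  LinearMap.mkContinuous₂
    (LinearMap.mk₂ ℂ (fun a b => (memLp_tensor a b).toLp)
      (fun a a' b => by
        apply Lp.ext
        filter_upwards [(memLp_tensor (a + a') b).coeFn_toLp, (memLp_tensor a b).coeFn_toLp,
          (memLp_tensor a' b).coeFn_toLp, Lp.coeFn_add (memLp_tensor a b).toLp
          (memLp_tensor a' b).toLp, ae_fst (Lp.coeFn_add a a')] with p h1 h2 h3 h4 h5
        rw [h1, h4, Pi.add_apply, h2, h3, h5, Pi.add_apply, add_mul])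
      (fun c a b => by
        apply Lp.ext
        filter_upwards [(memLp_tensor (c • a) b).coeFn_toLp, (memLp_tensor a b).coeFn_toLp,
          Lp.coeFn_smul c (memLp_tensor a b).toLp, ae_fst (Lp.coeFn_smul c a)] with p h1 h2 h3 h4
        rw [h1, h3, Pi.smul_apply, h2, h4, Pi.smul_apply, smul_mul_assoc])
      (fun a b b' => by
        apply Lp.ext
        filter_upwards [(memLp_tensor a (b + b')).coeFn_toLp, (memLp_tensor a b).coeFn_toLp,
          (memLp_tensor a b').coeFn_toLp, Lp.coeFn_add (memLp_tensor a b).toLp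
          (memLp_tensor a b').toLp, ae_snd (Lp.coeFn_add b b')] with p h1 h2 h3 h4 h5
        rw [h1, h4, Pi.add_apply, h2, h3, h5, Pi.add_apply, mul_add])
      (fun c a b => by
        apply Lp.ext
        filter_upwards [(memLp_tensor a (c • b)).coeFn_toLp, (memLp_tensor a b).coeFn_toLp,
          Lp.coeFn_smul c (memLp_tensor a b).toLp, ae_snd (Lp.coeFn_smul c b)] with p h1 h2 h3 h4
        rw [h1, h3, Pi.smul_apply, h2, h4, Pi.smul_apply, mul_smul_comm])) 1
    (fun a b => by rw [one_mul]; exact (norm_tensor a b).le)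

theorem coeFn_tensorL2 (a b : L2 d) :
    tensorL2 a b =ᵐ[volume] fun p => a p.1 * b p.2 := (memLp_tensor a b).coeFn_toLp

theorem norm_tensorL2 (a b : L2 d) : ‖tensorL2 a b‖ = ‖a‖ * ‖b‖ := norm_tensor a b

theorem inner_tensorL2 (a b a' b' : L2 d) :
    inner ℂ (tensorL2 a b) (tensorL2 a' b') = inner ℂ a a' * inner ℂ b b' := by
  rw [L2.inner_def, L2.inner_def, L2.inner_def, ← integral_prod_mul]
  refine integral_congr_ae ?_
  filter_upwards [coeFn_tensorL2 a b, coeFn_tensorL2 a' b'] with p h1 h2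
  rw [h1, h2]
  simp only [RCLike.inner_apply, map_mul]
  ring

/-- The two-particle evolution. -/
def pairOp {s : ℝ} (hs : 0 ≤ s) {t : ℝ} (ht : 0 ≤ t) (k : Vel d) : L2Pair d →L[ℂ] L2Pair d :=
  weightedComp (e := fun p : Vel d × Vel d => damp s t k p.1 * damp s t k p.2)
    (measurePreserving_sub_right (volume : Measure (Vel d × Vel d)) (t • k, t • k))
    (by fun_prop : Continuous fun p : Vel d × Vel d =>
      damp s t k p.1 * damp s t k p.2).aestronglyMeasurable
    (fun p => by
      rw [norm_mul]
      exact mul_le_one₀ (norm_damp_le_one hs ht k _) (norm_nonneg _) (norm_damp_le_one hs ht k _))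

theorem pairOp_tensorL2 {s : ℝ} (hs : 0 ≤ s) {t : ℝ} (ht : 0 ≤ t) (k : Vel d) (a b : L2 d) :
    pairOp hs ht k (tensorL2 a b) = tensorL2 (transportOp hs ht k a) (transportOp hs ht k b) := by
  apply Lp.ext
  filter_upwards [coeFn_weightedComp (e := fun p : Vel d × Vel d => damp s t k p.1 * damp s t k p.2)
      (measurePreserving_sub_right (volume : Measure (Vel d × Vel d)) (t • k, t • k))
      (by fun_prop : Continuous fun p : Vel d × Vel d =>
        damp s t k p.1 * damp s t k p.2).aestronglyMeasurable
      (fun p => by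
        rw [norm_mul]
        exact mul_le_one₀ (norm_damp_le_one hs ht k _) (norm_nonneg _) (norm_damp_le_one hs ht k _))
      (tensorL2 a b),
    coeFn_tensorL2 (transportOp hs ht k a) (transportOp hs ht k b),
    ae_fst (coeFn_transportOp hs ht k a), ae_snd (coeFn_transportOp hs ht k b),
    (measurePreserving_sub_right (volume : Measure (Vel d × Vel d))
      (t • k, t • k)).quasiMeasurePreserving.ae (coeFn_tensorL2 a b)] with p h1 h2 h3 h4 h5
  rw [pairOp, h1, h2, h3, h4, h5, transport, transport, damp, damp]
  simp only [Prod.fst_sub, Prod.snd_sub]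
  ring

theorem transportOp_transportOp {s : ℝ} (hs : 0 ≤ s) {r t : ℝ} (hr : 0 ≤ r) (ht : 0 ≤ t) (k : Vel d)
    (f : L2 d) : transportOp hs hr k (transportOp hs ht k f) =
      transportOp hs (add_nonneg hr ht) k f := by
  apply Lp.ext
  filter_upwards [coeFn_transportOp hs hr k (transportOp hs ht k f),
    coeFn_transportOp hs (add_nonneg hr ht) k f,
    (measurePreserving_sub_right volume (r • k)).quasiMeasurePreserving.ae
      (coeFn_transportOp hs ht k f)] with ξ h1 h2 h3
  rw [h1, h2, transport, h3, transport, transport, add_comm r t, phase_add, mul_add, neg_add,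
    Real.exp_add, add_smul, sub_sub, add_comm (t • k)]
  push_cast
  ring

theorem norm_transportOp_le {s : ℝ} (hs : 0 ≤ s) {t : ℝ} (ht : 0 ≤ t) (k : Vel d) (f : L2 d) :
    ‖transportOp hs ht k f‖ ≤ ‖f‖ := norm_weightedComp_le _ _ _ f

theorem transportOp_zero {s : ℝ} (hs : 0 ≤ s) (k : Vel d) (f : L2 d) :
    transportOp hs le_rfl k f = f := by
  apply Lp.ext
  filter_upwards [coeFn_transportOp hs le_rfl k f] with ξ h
  rw [h, transport, phase_zero]
  simp

/-- Strong continuity: contractivity makes every orbit a uniform limit of the differentiable orbits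
of compactly supported smooth functions. The time `max t 0` extends the orbit constantly to negative
times. -/
theorem continuous_transportOp {s : ℝ} (hs : 0 ≤ s) (k : Vel d) (f : L2 d) :
    Continuous fun t : ℝ => transportOp hs (le_max_right t 0) k f := by
  obtain ⟨χ, hχ, hlim⟩ := exists_seq_schwartz_tendsto f
  have hu : TendstoUniformly
      (fun n (t : ℝ) => transportOp hs (le_max_right t 0) k ((χ n).toLp 2 volume : L2 d))
      (fun t => transportOp hs (le_max_right t 0) k f) Filter.atTop := by
    rw [Metric.tendstoUniformly_iff]
    intro ε hε
    filter_upwards [Metric.tendsto_nhds.1 hlim ε hε] with n hn t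
    rw [dist_eq_norm, ← map_sub]
    refine (norm_transportOp_le _ _ _ _).trans_lt ?_
    rwa [← dist_eq_norm, dist_comm]
  refine hu.continuous (Filter.Eventually.frequently (Filter.Eventually.of_forall fun n => ?_))
  simp only [← transportL2_eq hs _ k (χ n) (hχ n)]
  exact (continuous_transportL2 s k (χ n) (hχ n)).comp (by fun_prop)

/-- The product of the two autocorrelations is the autocorrelation of `a ⊗ b` under the two-particle
contraction semigroup, to which the abstract positivity applies. -/
theorem re_integral_exp_inner_transportOp_nonneg {s : ℝ} (hs : 0 ≤ s) (k : Vel d) (a b : L2 d) {c : ℂ}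
    (hc : 0 < c.re) :
    0 ≤ (∫ t in Ioi (0 : ℝ), Complex.exp (-(c * t)) *
      (inner ℂ a (transportOp hs (le_max_right t 0) k a) *
        inner ℂ b (transportOp hs (le_max_right t 0) k b))).re := by
  have h0 : ∀ f : L2 d, transportOp hs (le_max_right (0 : ℝ) 0) k f = f := fun f => by
    have := transportOp_zero hs k f
    simpa only [max_self] using this
  set x : ℝ → L2Pair d := fun t => tensorL2 (transportOp hs (le_max_right t 0) k a)
    (transportOp hs (le_max_right t 0) k b) with hx
  have hx0 : x 0 = tensorL2 a b := by simp only [hx, h0]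
  have hcont : Continuous x :=
    (tensorL2.continuous.comp (continuous_transportOp hs k a)).clm_apply (continuous_transportOp hs k b)
  have main := re_integral_exp_inner_nonneg hcont
    (fun t => by
      rw [hx0, hx, norm_tensorL2, norm_tensorL2]
      have := norm_transportOp_le hs (le_max_right t 0) k a
      have := norm_transportOp_le hs (le_max_right t 0) k b
      gcongr)
    (fun r => pairOp hs (le_max_right r 0) k) (fun r _ v => norm_weightedComp_le _ _ _ v)
    (fun r t hr ht => by
      simp only [hx, pairOp_tensorL2, transportOp_transportOp]
      simp only [max_eq_left hr, max_eq_left ht, max_eq_left (add_nonneg hr ht)]) hc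
  rw [hx0] at main
  simpa only [hx, inner_tensorL2] using main

theorem FormDomain.conj {U : Vel d → ℂ} (hU : FormDomain U) :
    FormDomain fun ξ => starRingEnd ℂ (U ξ) := by
  have hm : Measurable fun ξ => starRingEnd ℂ (U ξ) :=
    (Complex.continuous_conj.measurable).comp hU.meas
  refine ⟨hm, hU.memLp.congr_norm hm.aestronglyMeasurable (ae_of_all _ fun ξ => ?_), ?_⟩
  · simp
  · simpa using hU.memLp_norm

theorem dirichlet_conj (U : Vel d → ℂ) : dirichlet (fun ξ => starRingEnd ℂ (U ξ)) = dirichlet U := by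
  simp [dirichlet]

theorem inner_maxwellHat_transportOp {β : ℝ} (hβ : 0 < β) {s : ℝ} (hs : 0 ≤ s) {t : ℝ} (ht : 0 ≤ t)
    (k : Vel d) : inner ℂ (maxwellHat d hβ) (transportOp hs ht k (maxwellHat d hβ)) =
      (mcorr β s t k : ℂ) := by
  rw [L2.inner_def, mcorr, corr, ← integral_complex_ofReal]
  have h1 := coeFn_gaussL2 (d := d) (maxwellHatAmp d β) (maxwellHat_rate_pos hβ)
  refine integral_congr_ae ?_
  filter_upwards [coeFn_transportOp hs ht k (maxwellHat d hβ), h1,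
    (measurePreserving_sub_right volume (t • k)).quasiMeasurePreserving.ae h1] with ξ h2 h3 h4
  rw [h2, transport, maxwellHat, h3, h4]
  simp only [RCLike.inner_apply, Complex.conj_ofReal]
  push_cast
  ring

theorem memLp_inner_mul {U : Vel d → ℂ} (hU : FormDomain U) (k : Vel d) :
    MemLp (fun ξ => ((inner ℝ k ξ : ℝ) : ℂ) * U ξ) 2 volume := by
  have hm : Measurable fun ξ => ((inner ℝ k ξ : ℝ) : ℂ) * U ξ :=
    (by fun_prop : Continuous fun ξ : Vel d => ((inner ℝ k ξ : ℝ) : ℂ)).measurable.mul hU.meas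
  refine (hU.memLp_norm.const_mul ‖k‖).mono hm.aestronglyMeasurable (ae_of_all _ fun ξ => ?_)
  simp only [norm_mul, norm_norm, Complex.norm_real]
  calc _ ≤ (‖k‖ * ‖ξ‖) * ‖U ξ‖ := by gcongr; exact norm_inner_le_norm k ξ
    _ = _ := by ring

/-- Tested against its own conjugate, the slice at fixed `(k, t)` is the autocorrelation of `(k · ξ)
U` times that of the transform of `√M`. This is the structure responsible for positivity. -/
theorem integral_formIntegrand_conj (V : Vel d → ℝ) {β : ℝ} (hβ : 0 < β) (z : ℂ) {s : ℝ} (hs : 0 ≤ s)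
    {U : Vel d → ℂ} (hU : FormDomain U) (k : Vel d) {t : ℝ} (ht : 0 ≤ t) :
    ∫ ξ, formIntegrand V β z s U (fun ξ => starRingEnd ℂ (U ξ)) ((k, t), ξ) =
      (potWeight V k : ℂ) * (Complex.exp (-(2 * Real.pi * z * t)) *
        (inner ℂ (memLp_inner_mul hU k).toLp (transportOp hs ht k (memLp_inner_mul hU k).toLp) *
          inner ℂ (maxwellHat d hβ) (transportOp hs ht k (maxwellHat d hβ)))) := by
  rw [inner_maxwellHat_transportOp, L2.inner_def, ← integral_mul_const, ← integral_const_mul,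
    ← integral_const_mul]
  have h1 := (memLp_inner_mul hU k).coeFn_toLp
  refine integral_congr_ae ?_
  filter_upwards [coeFn_transportOp hs ht k (memLp_inner_mul hU k).toLp, h1,
    (measurePreserving_sub_right volume (t • k)).quasiMeasurePreserving.ae h1] with ξ h2 h3 h4
  rw [h2, transport, h3, h4, formIntegrand, kernel, damp, shift]
  simp only [RCLike.inner_apply, map_mul, Complex.conj_ofReal]
  ring

/-- Positivity of the dissipative collision form. -/
theorem re_form_nonneg_of_pos (hd : 2 ≤ d) {V : Vel d → ℝ} (hV : ContDiff ℝ ∞ V)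
    (hc : HasCompactSupport V) {β : ℝ} (hβ : 0 < β) {z : ℂ} (hz : 0 < z.re) {s : ℝ} (hs : 0 ≤ s)
    {U : Vel d → ℂ} (hU : FormDomain U) :
    0 ≤ (form V β z s U fun ξ => starRingEnd ℂ (U ξ)).re := by
  have hi := (form_bound hd hV hc hβ hz.le hs hU.meas hU.memLp_norm hU.conj.meas
    hU.conj.memLp_norm).1
  have h2 := hi.integral_prod_left
  rw [form, integral_prod _ hi]
  simp only [collisionMeasure] at h2 ⊢
  have h3 := h2.integral_prod_left
  rw [integral_prod _ h2]
  have e := integral_re h3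
  simp only [RCLike.re_to_complex] at e
  rw [← e]
  refine integral_nonneg fun k => ?_
  have e2 : ∫ t in Ioi (0 : ℝ), ∫ ξ, formIntegrand V β z s U (fun ξ => starRingEnd ℂ (U ξ)) ((k, t), ξ) =
      (potWeight V k : ℂ) * ∫ t in Ioi (0 : ℝ), Complex.exp (-(2 * Real.pi * z * t)) *
        (inner ℂ (memLp_inner_mul hU k).toLp
            (transportOp hs (le_max_right t 0) k (memLp_inner_mul hU k).toLp) *
          inner ℂ (maxwellHat d hβ) (transportOp hs (le_max_right t 0) k (maxwellHat d hβ))) := by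
    rw [← integral_const_mul]
    refine setIntegral_congr_fun measurableSet_Ioi fun t ht => ?_
    have ht' : (0 : ℝ) ≤ t := le_of_lt ht
    rw [integral_formIntegrand_conj V hβ z hs hU k ht']
    simp only [max_eq_left ht']
  rw [Pi.zero_apply, e2, Complex.re_ofReal_mul]
  refine mul_nonneg (potWeight_nonneg V k) ?_
  exact re_integral_exp_inner_transportOp_nonneg hs k _ _ (c := 2 * Real.pi * z)
    (by have := Real.pi_pos; simp; positivity)

theorem continuous_kernel_param (V : Vel d → ℝ) (β s : ℝ) (p : (Vel d × ℝ) × Vel d) :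
    Continuous fun z : ℂ => kernel V β z s p := by
  unfold kernel; fun_prop

/-- Positivity of the collision form. -/
theorem re_form_nonneg (hd : 2 ≤ d) {V : Vel d → ℝ} (hV : ContDiff ℝ ∞ V)
    (hc : HasCompactSupport V) {β : ℝ} (hβ : 0 < β) {z : ℂ} (hz : 0 ≤ z.re) {s : ℝ} (hs : 0 ≤ s)
    {U : Vel d → ℂ} (hU : FormDomain U) :
    0 ≤ (form V β z s U fun ξ => starRingEnd ℂ (U ξ)).re := by
  -- The boundary case `z.re = 0`, which includes the Landau form at `z = 0`, is the limit of
  -- strictly dissipative ones; the kernel bound is uniform in `z`.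
  have hz' : ∀ n : ℕ, 0 < (z + ((1 / ((n : ℝ) + 1) : ℝ) : ℂ)).re := fun n => by
    rw [Complex.add_re, Complex.ofReal_re]; positivity
  have hlimz : Filter.Tendsto (fun n : ℕ => z + ((1 / ((n : ℝ) + 1) : ℝ) : ℂ)) Filter.atTop (nhds z) := by
    have h := (Complex.continuous_ofReal.tendsto 0).comp
      (tendsto_one_div_add_atTop_nhds_zero_nat (𝕜 := ℝ))
    simpa using h.const_add z
  have hb := (schur_test_aux (ν := collisionMeasure d) measurable_shift
    ((integrable_collisionBound hd hV hc (rate_pos hβ)).const_mul (absorb β)) hU.memLp_norm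
    hU.conj.memLp_norm).1
  have hpos : ∀ᵐ p ∂((collisionMeasure d).prod (volume : Measure (Vel d))), 0 < p.1.2 :=
    Measure.quasiMeasurePreserving_fst.ae ae_collisionMeasure_pos
  have hlim : Filter.Tendsto (fun n : ℕ => form V β (z + ((1 / ((n : ℝ) + 1) : ℝ) : ℂ)) s U
      fun ξ => starRingEnd ℂ (U ξ)) Filter.atTop
      (nhds (form V β z s U fun ξ => starRingEnd ℂ (U ξ))) := by
    refine tendsto_integral_of_dominated_convergence _
      (fun n => (measurable_formIntegrand hV hc β _ s hU.meas hU.conj.meas).aestronglyMeasurable) hb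
      (fun n => ?_) (ae_of_all _ fun p => ?_)
    · filter_upwards [hpos] with p hp
      have h1 := norm_kernel_le' hβ V (hz' n).le hs hp p.2
      have h3 := (le_mul_of_one_le_right (norm_nonneg _) (one_le_poly hp)).trans h1
      rw [formIntegrand, norm_mul, norm_mul]
      calc _ ≤ absorb β * collisionBound V (rate β) p.1 * (‖p.2 - shift p.1‖ * ‖p.2‖) *
            ‖U (p.2 - shift p.1)‖ * ‖starRingEnd ℂ (U p.2)‖ := by gcongr
        _ = _ := by ring
    · exact (((continuous_kernel_param V β s p).tendsto z).comp hlimz).mul_const _ |>.mul_const _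
  refine ge_of_tendsto ((Complex.continuous_re.tendsto _).comp hlim) (Filter.Eventually.of_forall fun n => ?_)
  exact re_form_nonneg_of_pos hd hV hc hβ (hz' n) hs hU

/-! ### The symbol and the energy identity -/

/-- The symbol of `1 + iα - κ Δ`. -/
def symbol (κ α : ℝ) (ξ : Vel d) : ℂ :=
  1 + Complex.I * (α : ℂ) + ((4 * Real.pi ^ 2 * κ * ‖ξ‖ ^ 2 : ℝ) : ℂ)

theorem symbol_re (κ α : ℝ) (ξ : Vel d) : (symbol κ α ξ).re = 1 + 4 * Real.pi ^ 2 * κ * ‖ξ‖ ^ 2 := by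
  rw [symbol, Complex.add_re, Complex.ofReal_re]
  simp

theorem symbol_im (κ α : ℝ) (ξ : Vel d) : (symbol κ α ξ).im = α := by
  rw [symbol, Complex.add_im, Complex.ofReal_im]
  simp

theorem measurable_symbol (κ α : ℝ) : Measurable (symbol κ α : Vel d → ℂ) := by
  have : Continuous (symbol κ α : Vel d → ℂ) := by unfold symbol; fun_prop
  exact this.measurable

theorem le_norm_symbol (κ α : ℝ) (ξ : Vel d) : 1 + 4 * Real.pi ^ 2 * κ * ‖ξ‖ ^ 2 ≤ ‖symbol κ α ξ‖ := by
  rw [← symbol_re κ α ξ]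
  exact Complex.re_le_norm _

theorem one_le_norm_symbol {κ : ℝ} (hκ : 0 < κ) (α : ℝ) (ξ : Vel d) : 1 ≤ ‖symbol κ α ξ‖ :=
  le_trans (le_add_of_nonneg_right (by positivity)) (le_norm_symbol κ α ξ)

theorem norm_mul_le_norm_symbol {κ : ℝ} (hκ : 0 < κ) (α : ℝ) (ξ : Vel d) :
    ‖ξ‖ ≤ (1 + (4 * Real.pi ^ 2 * κ)⁻¹) * ‖symbol κ α ξ‖ := by
  have hpi := Real.pi_pos
  have h := le_norm_symbol κ α ξ
  have hc : 0 < 4 * Real.pi ^ 2 * κ := by positivity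
  set c := 4 * Real.pi ^ 2 * κ
  have h1 : ‖ξ‖ ≤ (1 + c⁻¹) * (1 + c * ‖ξ‖ ^ 2) := by
    have e : (1 + c⁻¹) * (1 + c * ‖ξ‖ ^ 2) = 1 + c⁻¹ + c * ‖ξ‖ ^ 2 + ‖ξ‖ ^ 2 := by
      field_simp
      ring
    rw [e]
    have : 0 < c⁻¹ := by positivity
    have : 0 ≤ c * ‖ξ‖ ^ 2 := by positivity
    nlinarith [sq_nonneg (‖ξ‖ - 1)]
  exact h1.trans (mul_le_mul_of_nonneg_left h (by positivity))

theorem FormDomain.sub {U Φ : Vel d → ℂ} (hU : FormDomain U) (hΦ : FormDomain Φ) :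
    FormDomain fun ξ => U ξ - Φ ξ := by
  have hm := hU.meas.sub hΦ.meas
  refine ⟨hm, hU.memLp.sub hΦ.memLp, ?_⟩
  refine (hU.memLp_norm.add hΦ.memLp_norm).mono (measurable_norm.mul hm.norm).aestronglyMeasurable
    (ae_of_all _ fun ξ => ?_)
  rw [Real.norm_eq_abs, Real.norm_eq_abs, abs_of_nonneg (by positivity), Pi.add_apply,
    abs_of_nonneg (by positivity), ← mul_add]
  exact mul_le_mul_of_nonneg_left (norm_sub_le _ _) (norm_nonneg _)

theorem dirichlet_nonneg (U : Vel d → ℂ) : 0 ≤ dirichlet U := l2n_nonneg _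

theorem formDomain_div_symbol {g : Vel d → ℂ} (hg : Measurable g) (hg2 : MemLp g 2 volume) {κ : ℝ}
    (hκ : 0 < κ) (α : ℝ) : FormDomain fun ξ => g ξ / symbol κ α ξ := by
  have hm := hg.div (measurable_symbol (d := d) κ α)
  refine ⟨hm, hg2.mono hm.aestronglyMeasurable (ae_of_all _ fun ξ => ?_), ?_⟩
  · rw [norm_div]
    exact div_le_self (norm_nonneg _) (one_le_norm_symbol hκ α ξ)
  · refine (hg2.norm.const_mul (1 + (4 * Real.pi ^ 2 * κ)⁻¹)).mono
      (measurable_norm.mul hm.norm).aestronglyMeasurable (ae_of_all _ fun ξ => ?_)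
    have h1 := one_le_norm_symbol hκ α ξ
    rw [Real.norm_eq_abs, Real.norm_eq_abs, abs_of_nonneg (by positivity),
      abs_of_nonneg (by positivity), norm_div, ← mul_div_assoc, div_le_iff₀ (by linarith)]
    calc ‖ξ‖ * ‖g ξ‖ ≤ ((1 + (4 * Real.pi ^ 2 * κ)⁻¹) * ‖symbol κ α ξ‖) * ‖g ξ‖ := by
          gcongr; exact norm_mul_le_norm_symbol hκ α ξ
      _ = _ := by ring

/-- The energy identity terms. -/
theorem integrable_symbol_mul {U Φ : Vel d → ℂ} (hU : FormDomain U) (hΦ : FormDomain Φ) (κ α : ℝ) :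
    Integrable fun ξ => symbol κ α ξ * (U ξ * Φ ξ) := by
  have h1 : Integrable fun ξ => U ξ * Φ ξ := hU.memLp.integrable_mul hΦ.memLp
  have h2 : Integrable fun ξ => (‖ξ‖ * ‖U ξ‖) * (‖ξ‖ * ‖Φ ξ‖) :=
    hU.memLp_norm.integrable_mul hΦ.memLp_norm
  have h3 : Integrable fun ξ : Vel d => ((4 * Real.pi ^ 2 * κ * ‖ξ‖ ^ 2 : ℝ) : ℂ) * (U ξ * Φ ξ) := by
    refine (h2.const_mul (4 * Real.pi ^ 2 * κ)).mono ?_ (ae_of_all _ fun ξ => le_of_eq ?_)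
    · exact ((by fun_prop : Continuous fun ξ : Vel d =>
        ((4 * Real.pi ^ 2 * κ * ‖ξ‖ ^ 2 : ℝ) : ℂ)).measurable.mul
          (hU.meas.mul hΦ.meas)).aestronglyMeasurable
    · simp only [norm_mul, norm_norm, Complex.norm_real, norm_pow]
      ring
  refine ((h1.const_mul (1 + Complex.I * α)).add h3).congr (ae_of_all _ fun ξ => ?_)
  simp only [Pi.add_apply, symbol]
  ring

/-- The real part carries the mass and the diffusion; the imaginary part provides the factor `α`
that later offsets the growth of `z`. -/
theorem integral_symbol_mul_conj {U : Vel d → ℂ} (hU : FormDomain U) (κ α : ℝ) :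
    (∫ ξ, symbol κ α ξ * (U ξ * starRingEnd ℂ (U ξ))).re =
        l2n (fun ξ => ‖U ξ‖) ^ 2 + 4 * Real.pi ^ 2 * κ * dirichlet U ^ 2 ∧
      (∫ ξ, symbol κ α ξ * (U ξ * starRingEnd ℂ (U ξ))).im = α * l2n (fun ξ => ‖U ξ‖) ^ 2 := by
  have hi := integrable_symbol_mul hU hU.conj κ α
  have e1 := integral_re hi
  have e2 := integral_im hi
  simp only [RCLike.re_to_complex, RCLike.im_to_complex] at e1 e2
  rw [← e1, ← e2]
  have hs : ∀ ξ, symbol κ α ξ * (U ξ * starRingEnd ℂ (U ξ)) = symbol κ α ξ * ((‖U ξ‖ ^ 2 : ℝ) : ℂ) :=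
    fun ξ => by rw [Complex.mul_conj, Complex.normSq_eq_norm_sq]
  have i1 : Integrable fun ξ => ‖U ξ‖ ^ 2 := hU.memLp.norm.integrable_sq
  have i2 : Integrable fun ξ => (‖ξ‖ * ‖U ξ‖) ^ 2 := hU.memLp_norm.integrable_sq
  rw [l2n_sq, dirichlet, l2n_sq]
  constructor
  · rw [← integral_const_mul, ← integral_add i1 (i2.const_mul _)]
    congr 1; ext ξ
    rw [hs, Complex.re_mul_ofReal, symbol_re]
    ring
  · rw [← integral_const_mul]
    congr 1; ext ξ
    rw [hs, Complex.im_mul_ofReal, symbol_im]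

/-! ### Regularity of the limit and the energy estimate -/

section Solutions

variable {V : Vel d → ℝ} {β : ℝ}

/-- The Fourier transform of the resolvent equations. -/
structure FourierSolution (V : Vel d → ℝ) (β κ α : ℝ) (z : ℂ) (s : ℝ) (g U : Vel d → ℂ) : Prop where
  dom : FormDomain U
  eq : ∀ᵐ ξ, symbol κ α ξ * U ξ + collisionOp V β z s U ξ = g ξ

theorem form_sub_left (hd : 2 ≤ d) (hV : ContDiff ℝ ∞ V)
    (hc : HasCompactSupport V) (hβ : 0 < β) {z : ℂ} (hz : 0 ≤ z.re) {s : ℝ} (hs : 0 ≤ s)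
    {U U' Φ : Vel d → ℂ} (hU : FormDomain U) (hU' : FormDomain U') (hΦ : FormDomain Φ) :
    form V β z s (fun ξ => U ξ - U' ξ) Φ = form V β z s U Φ - form V β z s U' Φ := by
  rw [form, form, form, ← integral_sub
    (form_bound hd hV hc hβ hz hs hU.meas hU.memLp_norm hΦ.meas hΦ.memLp_norm).1
    (form_bound hd hV hc hβ hz hs hU'.meas hU'.memLp_norm hΦ.meas hΦ.memLp_norm).1]
  congr 1; ext p
  simp only [formIntegrand]
  ring

/-- Write `U = U₁ + R` with `U₁ = g / symbol` explicit in `α`, and test the equation for `R` with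
the doubly weighted conjugate of `R`. The diagonal part of the form is nonnegative, its commutator
with the weight is at most `F / μ` times the weighted Dirichlet norm squared of `R` and is absorbed
by the diffusion, and the source coming from `U₁` is bounded by `form_weight_bound`. No bound
depends on `ε`. -/
theorem exists_weighted_bound (hd : 2 ≤ d) (hV : ContDiff ℝ ∞ V) (hc : HasCompactSupport V)
    (hβ : 0 < β) {κ₀ : ℝ} (hκ₀ : 0 < κ₀) : ∃ C μ : ℝ, 0 ≤ C ∧ 1 ≤ μ ∧ ∀ κ α : ℝ, κ₀ ≤ κ →
      ∀ g U : Vel d → ℂ, Measurable g → MemLp g 2 volume → FourierSolution V β κ α 0 0 g U →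
      ∀ ε : ℝ, 0 < ε → dirichlet (fun ξ => (weight μ ε ξ : ℂ) * U ξ) ≤
        C * dirichlet (fun ξ => (weight μ ε ξ : ℂ) * (g ξ / symbol κ α ξ)) := by
  have hpi := Real.pi_pos
  set F := formBound V β with hF
  have hF0 : 0 ≤ F := formBound_nonneg V hβ
  -- Half of the smallest diffusion constant `4π²κ₀`: the other half is left for the commutator.
  set c₀ := 2 * Real.pi ^ 2 * κ₀ with hc₀
  have hc₀0 : 0 < c₀ := by positivity
  -- Chosen so that `F / μ ≤ c₀`, with `1 ≤ μ`.
  set μ := 1 + F / c₀ with hμ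
  have hμ1 : 1 ≤ μ := le_add_of_nonneg_right (by positivity)
  refine ⟨2 * (F / c₀ + 1), μ, by positivity, hμ1, fun κ α hκ g U hg hg2 hU ε hε => ?_⟩
  have hκ0 : 0 < κ := hκ₀.trans_le hκ
  have h1 := formDomain_div_symbol hg hg2 hκ0 α
  set U₁ : Vel d → ℂ := fun ξ => g ξ / symbol κ α ξ with hU₁
  set R : Vel d → ℂ := fun ξ => U ξ - U₁ ξ with hR
  have hRd : FormDomain R := hU.dom.sub h1
  set Φ : Vel d → ℂ := fun ξ => (weight μ ε ξ : ℂ) * ((weight μ ε ξ : ℂ) * starRingEnd ℂ (R ξ)) with hΦ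
  have hΦd : FormDomain Φ := (hRd.conj.weight_mul μ hε).weight_mul μ hε
  have hWR := hRd.weight_mul μ hε
  set WR : Vel d → ℂ := fun ξ => (weight μ ε ξ : ℂ) * R ξ with hWRdef
  have hconj : (fun ξ => (weight μ ε ξ : ℂ) * starRingEnd ℂ (R ξ)) = fun ξ => starRingEnd ℂ (WR ξ) := by
    ext ξ; rw [hWRdef]; simp
  set Y := dirichlet WR with hY
  set X := dirichlet (fun ξ => (weight μ ε ξ : ℂ) * U₁ ξ) with hX
  have hY0 : 0 ≤ Y := dirichlet_nonneg _
  have hX0 : 0 ≤ X := dirichlet_nonneg _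
  have hYc : dirichlet (fun ξ => (weight μ ε ξ : ℂ) * starRingEnd ℂ (R ξ)) = Y := by
    rw [hconj, dirichlet_conj]
  -- The equation for `R` is `symbol · R + collisionOp U = 0`, with the full `U` inside the
  -- collision term.
  have t1 : (∫ ξ, symbol κ α ξ * (WR ξ * starRingEnd ℂ (WR ξ))) + form V β 0 0 U Φ = 0 := by
    obtain ⟨i1, e1⟩ := form_eq_integral_collisionOp (z := 0) (s := 0) hd hV hc hβ le_rfl le_rfl
      hU.dom.meas hU.dom.memLp_norm hΦd.meas hΦd.memLp_norm
    rw [e1, ← integral_add (integrable_symbol_mul hWR hWR.conj κ α) i1]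
    refine integral_eq_zero_of_ae ?_
    filter_upwards [hU.eq] with ξ hξ
    have hsy : symbol κ α ξ ≠ 0 := norm_pos_iff.1 (lt_of_lt_of_le one_pos (one_le_norm_symbol hκ0 α ξ))
    have e2 : symbol κ α ξ * R ξ + collisionOp V β 0 0 U ξ = 0 := by
      rw [hR, hU₁]
      simp only
      rw [mul_sub, mul_div_cancel₀ _ hsy, ← hξ]
      ring
    simp only [hWRdef, hΦ, map_mul, Complex.conj_ofReal, Pi.zero_apply]
    linear_combination ((weight μ ε ξ : ℂ) * ((weight μ ε ξ : ℂ) * starRingEnd ℂ (R ξ))) * e2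
  have t2 := form_sub_left (z := 0) (s := 0) hd hV hc hβ le_rfl le_rfl hU.dom h1 hΦd
  have t3 := form_weight_commutator_bound (z := 0) (s := 0) hd hV hc hβ le_rfl le_rfl hRd hRd.conj hμ1 hε
  have t4 := form_weight_bound (z := 0) (s := 0) hd hV hc hβ le_rfl le_rfl h1 hRd.conj hμ1 hε
  have t5 := re_form_nonneg (z := 0) (s := 0) hd hV hc hβ le_rfl le_rfl hWR
  have t6 := (integral_symbol_mul_conj hWR κ α).1
  rw [hYc] at t3 t4
  rw [hconj] at t3
  have t7 := (abs_le.1 ((Complex.abs_re_le_norm _).trans t3)).1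
  have t8 := (abs_le.1 ((Complex.abs_re_le_norm _).trans t4)).1
  have t9 := congrArg Complex.re t1
  have t10 := congrArg Complex.re t2
  rw [Complex.add_re, t6, Complex.zero_re] at t9
  rw [Complex.sub_re] at t7 t10
  have hFμ : F / μ ≤ c₀ := by
    rw [div_le_iff₀ (by linarith), hμ, mul_add, mul_div_cancel₀ _ hc₀0.ne']
    linarith
  have hcκ : 2 * c₀ ≤ 4 * Real.pi ^ 2 * κ := by
    rw [hc₀]; nlinarith [sq_nonneg Real.pi]
  have hl0 := sq_nonneg (l2n fun ξ => ‖WR ξ‖)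
  have m1 : F / μ * (Y * Y) ≤ c₀ * (Y * Y) := mul_le_mul_of_nonneg_right hFμ (mul_nonneg hY0 hY0)
  have m2 : 2 * c₀ * (Y * Y) ≤ 4 * Real.pi ^ 2 * κ * (Y * Y) :=
    mul_le_mul_of_nonneg_right hcκ (mul_nonneg hY0 hY0)
  have hmain : c₀ * (Y * Y) ≤ F * (X * Y) := by
    have e1 : dirichlet WR ^ 2 = Y * Y := by rw [← hY]; ring
    rw [e1] at t9
    linarith
  have hYX : Y ≤ F / c₀ * X := by
    rw [div_mul_eq_mul_div, le_div_iff₀ hc₀0]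
    rcases hY0.eq_or_lt with h | h
    · rw [← h, zero_mul]; positivity
    · nlinarith
  have hsum : dirichlet (fun ξ => (weight μ ε ξ : ℂ) * U ξ) ≤ 2 * (Y + X) := by
    refine le_trans ?_ (l2n_add_le hWR.memLp_norm (h1.weight_mul μ hε).memLp_norm)
    refine l2n_le (hWR.memLp_norm.add (h1.weight_mul μ hε).memLp_norm) fun ξ => ?_
    change |‖ξ‖ * ‖(weight μ ε ξ : ℂ) * U ξ‖| ≤
      ‖ξ‖ * ‖WR ξ‖ + ‖ξ‖ * ‖(weight μ ε ξ : ℂ) * U₁ ξ‖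
    rw [abs_of_nonneg (by positivity), ← mul_add]
    refine mul_le_mul_of_nonneg_left ?_ (norm_nonneg _)
    refine le_trans (le_of_eq ?_) (norm_add_le _ _)
    congr 1
    simp only [hWRdef, hR]
    ring
  calc _ ≤ 2 * (Y + X) := hsum
    _ ≤ 2 * (F / c₀ * X + X) := by gcongr
    _ = _ := by ring

/-- Fatou's lemma along `ε = 1 / (n + 1)`: the weights converge to `μ² + ‖ξ‖²`, which dominates `1 +
‖ξ‖²`. -/
theorem memLp_of_weight_bound {U : Vel d → ℂ} (hU : FormDomain U) {μ B : ℝ} (hμ : 1 ≤ μ) (hB : 0 ≤ B)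
    (h : ∀ ε : ℝ, 0 < ε → dirichlet (fun ξ => (weight μ ε ξ : ℂ) * U ξ) ≤ B) :
    MemLp (fun ξ => (1 + ‖ξ‖ ^ 2) * ‖ξ‖ * ‖U ξ‖) 2 volume ∧
      l2n (fun ξ => (1 + ‖ξ‖ ^ 2) * ‖ξ‖ * ‖U ξ‖) ≤ B := by
  have hm : Measurable fun ξ => (1 + ‖ξ‖ ^ 2) * ‖ξ‖ * ‖U ξ‖ := by
    have := hU.meas.norm
    fun_prop
  set f : ℕ → Vel d → ℝ≥0∞ := fun n ξ =>
    ENNReal.ofReal ((‖ξ‖ * ‖(weight μ (1 / ((n : ℝ) + 1)) ξ : ℂ) * U ξ‖) ^ 2) with hf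
  have hε : ∀ n : ℕ, (0 : ℝ) < 1 / ((n : ℝ) + 1) := fun n => by positivity
  have hfm : ∀ n, Measurable (f n) := fun n =>
    ((measurable_norm.mul (hU.weight_mul μ (hε n)).meas.norm).pow_const 2).ennreal_ofReal
  have hfi : ∀ n, ∫⁻ ξ, f n ξ ≤ ENNReal.ofReal (B ^ 2) := fun n => by
    have hi := (hU.weight_mul μ (hε n)).memLp_norm.integrable_sq
    rw [hf, ← ofReal_integral_eq_lintegral_ofReal hi (ae_of_all _ fun _ => sq_nonneg _)]
    refine ENNReal.ofReal_le_ofReal ?_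
    have h1 := h _ (hε n)
    rw [dirichlet] at h1
    rw [← l2n_sq]
    have := l2n_nonneg fun ξ => ‖ξ‖ * ‖(weight μ (1 / ((n : ℝ) + 1)) ξ : ℂ) * U ξ‖
    gcongr
  have hlim : ∀ ξ, Filter.Tendsto (fun n => f n ξ) Filter.atTop
      (nhds (ENNReal.ofReal ((‖ξ‖ * ((μ ^ 2 + ‖ξ‖ ^ 2) * ‖U ξ‖)) ^ 2))) := fun ξ => by
    refine ENNReal.tendsto_ofReal ?_
    have e : ∀ n : ℕ, ‖(weight μ (1 / ((n : ℝ) + 1)) ξ : ℂ) * U ξ‖ =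
        weight μ (1 / ((n : ℝ) + 1)) ξ * ‖U ξ‖ := fun n => norm_weight_mul μ (hε n).le ξ _
    simp only [e]
    refine ((Filter.Tendsto.mul_const _ ?_).const_mul _).pow 2
    have h2 : Filter.Tendsto (fun ε : ℝ => weight μ ε ξ) (nhds 0) (nhds (μ ^ 2 + ‖ξ‖ ^ 2)) := by
      have : ContinuousAt (fun ε : ℝ => weight μ ε ξ) 0 := by
        unfold weight
        refine ContinuousAt.div (by fun_prop) (by fun_prop) (by simp)
      simpa [ContinuousAt, weight] using this
    exact h2.comp (tendsto_one_div_add_atTop_nhds_zero_nat (𝕜 := ℝ))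
  have hfatou : ∫⁻ ξ, ENNReal.ofReal ((‖ξ‖ * ((μ ^ 2 + ‖ξ‖ ^ 2) * ‖U ξ‖)) ^ 2) ≤ ENNReal.ofReal (B ^ 2) := by
    calc _ = ∫⁻ ξ, Filter.liminf (fun n => f n ξ) Filter.atTop := by
          simp only [(hlim _).liminf_eq]
      _ ≤ Filter.liminf (fun n => ∫⁻ ξ, f n ξ) Filter.atTop := lintegral_liminf_le hfm
      _ ≤ Filter.liminf (fun _ : ℕ => ENNReal.ofReal (B ^ 2)) Filter.atTop :=
          Filter.liminf_le_liminf (Filter.Eventually.of_forall hfi)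
      _ = _ := Filter.liminf_const _
  have hle : ∫⁻ ξ, ENNReal.ofReal (((1 + ‖ξ‖ ^ 2) * ‖ξ‖ * ‖U ξ‖) ^ 2) ≤ ENNReal.ofReal (B ^ 2) := by
    refine (lintegral_mono fun ξ => ENNReal.ofReal_le_ofReal ?_).trans hfatou
    rw [mul_comm (1 + ‖ξ‖ ^ 2), mul_assoc]
    have : 1 ≤ μ ^ 2 := one_le_pow₀ hμ
    gcongr
  have hint : Integrable fun ξ => ((1 + ‖ξ‖ ^ 2) * ‖ξ‖ * ‖U ξ‖) ^ 2 :=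
    (lintegral_ofReal_ne_top_iff_integrable (hm.pow_const 2).aestronglyMeasurable
      (ae_of_all _ fun _ => sq_nonneg _)).1 (hle.trans_lt ENNReal.ofReal_lt_top).ne
  refine ⟨(memLp_two_iff_integrable_sq hm.aestronglyMeasurable).2 hint, ?_⟩
  rw [← ofReal_integral_eq_lintegral_ofReal hint (ae_of_all _ fun _ => sq_nonneg _),
    ENNReal.ofReal_le_ofReal_iff (sq_nonneg B), ← l2n_sq] at hle
  exact (sq_le_sq₀ (l2n_nonneg _) hB).1 hle

/-- Here `L` is `1 + |α|` and `p`, `q` are the `L²` and Dirichlet norms of the difference.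
Completing the square in `q` leaves `L (p² - G p) ≤ 4 c⁴ κ G²`; since `1 ≤ L`, the factor `L` can be
dropped and the bound on `p` is uniform in `α`. -/
theorem quadratic_absorb {p q G L κ κ₀ c : ℝ} (hκ₀ : 0 < κ₀) (hκ : κ₀ ≤ κ) (hL : 1 ≤ L) (hc : 0 < c)
    (h : L * p ^ 2 + 4 * c ^ 2 * κ * q ^ 2 ≤ G * (L * p + 8 * c ^ 3 * κ * q)) :
    p ^ 2 ≤ (8 * c ^ 4 + κ₀⁻¹) * κ * G ^ 2 := by
  have hκ0 : 0 < κ := hκ₀.trans_le hκ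
  have h1 : L * (p ^ 2 - G * p) ≤ 4 * c ^ 4 * κ * G ^ 2 := by
    nlinarith [mul_nonneg hκ0.le (sq_nonneg (2 * c * q - 2 * c ^ 2 * G))]
  have hM : 0 ≤ 4 * c ^ 4 * κ * G ^ 2 := by positivity
  have h2 : p ^ 2 - G * p ≤ 4 * c ^ 4 * κ * G ^ 2 := by
    by_contra hlt
    push Not at hlt
    nlinarith
  have h3 : 1 ≤ κ₀⁻¹ * κ := by
    rw [inv_mul_eq_div, le_div_iff₀ hκ₀]; linarith
  nlinarith [sq_nonneg (p - G), mul_le_mul_of_nonneg_right h3 (sq_nonneg G)]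

/-- The difference of the equations is tested with the conjugate of `w = U - U₀`. The form with
parameters `(z, s)` at `w` has nonnegative real part, and the mismatch of the two forms at `U₀` is
at most `E`. The real part bounds `p² + 4π²κ q²` and the imaginary part bounds `|α| p²`, both by
multiples of `E`. Together they match the factor `1 + |α|` in the bound for `z`. -/
theorem exists_energy_bound (hd : 2 ≤ d) (hV : ContDiff ℝ ∞ V) (hc : HasCompactSupport V)
    (hβ : 0 < β) {κ₀ : ℝ} (hκ₀ : 0 < κ₀) : ∃ C : ℝ, 0 ≤ C ∧ ∀ κ α N : ℝ, κ₀ ≤ κ → 1 ≤ N →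
      ∀ g U U₀ : Vel d → ℂ,
      FourierSolution V β κ α ((1 + Complex.I * (α : ℂ)) / (N : ℂ)) (8 * Real.pi ^ 3 * (κ / N)) g U →
      FourierSolution V β κ α 0 0 g U₀ →
      MemLp (fun ξ => (1 + ‖ξ‖ ^ 2) * ‖ξ‖ * ‖U₀ ξ‖) 2 volume →
      l2n (fun ξ => ‖U ξ - U₀ ξ‖) ^ 2 ≤
        C * κ / N ^ 2 * l2n (fun ξ => (1 + ‖ξ‖ ^ 2) * ‖ξ‖ * ‖U₀ ξ‖) ^ 2 := by
  obtain ⟨A, hA, hdiff⟩ := exists_form_sub_bound hd hV hc hβ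
  have hpi := Real.pi_pos
  set F := formBound V β with hF
  have hF0 : 0 ≤ F := formBound_nonneg V hβ
  set c₀ := 4 * Real.pi ^ 2 * κ₀ with hc₀
  have hc₀0 : 0 < c₀ := by positivity
  -- One unit of `E` from the real part, and `1 + F / c₀` units from the imaginary part.
  set C₁ := 2 + F / c₀ with hC₁
  refine ⟨(8 * Real.pi ^ 4 + κ₀⁻¹) * (C₁ * A) ^ 2, by positivity, fun κ α N hκ hN g U U₀ hU hU₀ hX => ?_⟩
  have hκ0 : 0 < κ := hκ₀.trans_le hκ
  have hN0 : 0 < N := by linarith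
  set z : ℂ := (1 + Complex.I * (α : ℂ)) / (N : ℂ) with hz
  set s : ℝ := 8 * Real.pi ^ 3 * (κ / N) with hs
  have hzre : 0 ≤ z.re := by
    rw [hz, Complex.div_ofReal_re]
    simp
    positivity
  have hznorm : ‖z‖ ≤ (1 + |α|) / N := by
    rw [hz, norm_div, Complex.norm_real, Real.norm_eq_abs, abs_of_pos hN0]
    gcongr
    refine (norm_add_le _ _).trans ?_
    simp
  have hs0 : 0 ≤ s := by positivity
  set w : Vel d → ℂ := fun ξ => U ξ - U₀ ξ with hw
  have hwd : FormDomain w := hU.dom.sub hU₀.dom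
  have hwc := hwd.conj
  set X := l2n (fun ξ => (1 + ‖ξ‖ ^ 2) * ‖ξ‖ * ‖U₀ ξ‖) with hXdef
  have hX0 : 0 ≤ X := l2n_nonneg _
  set p := l2n (fun ξ => ‖w ξ‖) with hp
  set q := dirichlet w with hq
  have hp0 : 0 ≤ p := l2n_nonneg _
  have hq0 : 0 ≤ q := dirichlet_nonneg _
  have t1 : (∫ ξ, symbol κ α ξ * (w ξ * starRingEnd ℂ (w ξ))) +
      (form V β z s U (fun ξ => starRingEnd ℂ (w ξ)) -
        form V β 0 0 U₀ fun ξ => starRingEnd ℂ (w ξ)) = 0 := by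
    obtain ⟨i1, e1⟩ := form_eq_integral_collisionOp hd hV hc hβ hzre hs0
      hU.dom.meas hU.dom.memLp_norm hwc.meas hwc.memLp_norm
    obtain ⟨i2, e2⟩ := form_eq_integral_collisionOp (z := 0) (s := 0) hd hV hc hβ le_rfl le_rfl
      hU₀.dom.meas hU₀.dom.memLp_norm hwc.meas hwc.memLp_norm
    have i3 : Integrable fun ξ => collisionOp V β z s U ξ * starRingEnd ℂ (w ξ) -
      collisionOp V β 0 0 U₀ ξ * starRingEnd ℂ (w ξ) := i1.sub i2
    rw [e1, e2, ← integral_sub i1 i2, ← integral_add (integrable_symbol_mul hwd hwc κ α) i3]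
    refine integral_eq_zero_of_ae ?_
    filter_upwards [hU.eq, hU₀.eq] with ξ h1 h2
    simp only [hw, Pi.zero_apply]
    linear_combination (starRingEnd ℂ (U ξ - U₀ ξ)) * (h1 - h2)
  have t2 := form_sub_left hd hV hc hβ hzre hs0 hU.dom hU₀.dom hwc
  have t3 := hdiff z s hzre hs0 U₀ _ hU₀.dom hX hwc
  rw [dirichlet_conj] at t3
  simp only [RCLike.norm_conj] at t3
  have t4 := re_form_nonneg hd hV hc hβ hzre hs0 hwd
  have t5 := (form_bound hd hV hc hβ hzre hs0 hwd.meas hwd.memLp_norm hwc.meas hwc.memLp_norm).2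
  rw [dirichlet_conj] at t5
  obtain ⟨t6, t7⟩ := integral_symbol_mul_conj hwd κ α
  set E := A * (X * (‖z‖ * p + s * q)) with hE
  set D := form V β z s U₀ (fun ξ => starRingEnd ℂ (w ξ)) -
    form V β 0 0 U₀ (fun ξ => starRingEnd ℂ (w ξ)) with hD
  have t8 : (∫ ξ, symbol κ α ξ * (w ξ * starRingEnd ℂ (w ξ))) +
      form V β z s w (fun ξ => starRingEnd ℂ (w ξ)) + D = 0 := by
    rw [hD]
    linear_combination t1 + t2
  have r1 := congrArg Complex.re t8
  have r2 := congrArg Complex.im t8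
  simp only [Complex.add_re, Complex.add_im, Complex.zero_re, Complex.zero_im] at r1 r2
  rw [t6] at r1
  rw [t7] at r2
  have d1 := (abs_le.1 ((Complex.abs_re_le_norm D).trans t3)).1
  have d2 := abs_le.1 ((Complex.abs_im_le_norm D).trans t3)
  have d3 := abs_le.1 ((Complex.abs_im_le_norm _).trans t5)
  have hre : p ^ 2 + 4 * Real.pi ^ 2 * κ * q ^ 2 ≤ E := by linarith
  have hE0 : 0 ≤ E := by positivity
  have hFq : F * (q * q) ≤ F / c₀ * E := by
    rw [div_mul_eq_mul_div, le_div_iff₀ hc₀0]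
    have : c₀ * (q * q) ≤ E := by
      have : c₀ ≤ 4 * Real.pi ^ 2 * κ := by rw [hc₀]; gcongr
      nlinarith [mul_le_mul_of_nonneg_right this (mul_nonneg hq0 hq0), sq_nonneg p]
    nlinarith [mul_le_mul_of_nonneg_left this hF0]
  -- The imaginary part of the form has no sign; it is bounded by `F q²`, which the real part
  -- already controls.
  have him : |α| * p ^ 2 ≤ F / c₀ * E + E := by
    have : |α * p ^ 2| ≤ F * (q * q) + E := by rw [abs_le]; constructor <;> linarith
    rw [abs_mul, abs_of_nonneg (sq_nonneg p)] at this
    linarith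
  have hEN : E ≤ A * X / N * ((1 + |α|) * p + 8 * Real.pi ^ 3 * κ * q) := by
    calc E ≤ A * (X * ((1 + |α|) / N * p + s * q)) := by rw [hE]; gcongr
      _ = _ := by rw [hs]; field_simp
  have hfin : (1 + |α|) * p ^ 2 + 4 * Real.pi ^ 2 * κ * q ^ 2 ≤
      (C₁ * A * X / N) * ((1 + |α|) * p + 8 * Real.pi ^ 3 * κ * q) := by
    calc (1 + |α|) * p ^ 2 + 4 * Real.pi ^ 2 * κ * q ^ 2 ≤ C₁ * E := by rw [hC₁]; linarith
      _ ≤ C₁ * (A * X / N * ((1 + |α|) * p + 8 * Real.pi ^ 3 * κ * q)) := by gcongr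
      _ = _ := by ring
  have := quadratic_absorb hκ₀ hκ (le_add_of_nonneg_right (abs_nonneg α)) hpi hfin
  refine this.trans (le_of_eq ?_)
  field_simp

end Solutions

/-! ### From the weak hat equation to the Fourier side -/

theorem L2.measurable (u : L2 d) : Measurable u := (Lp.stronglyMeasurable u).measurable

theorem formDomain_of_compact {Φ : Vel d → ℂ} (hΦ : Continuous Φ) (hc : HasCompactSupport Φ) :
    FormDomain Φ := by
  refine ⟨hΦ.measurable, hΦ.memLp_of_hasCompactSupport hc, ?_⟩
  exact (continuous_norm.mul hΦ.norm).memLp_of_hasCompactSupport hc.norm.mul_left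

theorem formDomain_indicator {K : Set (Vel d)} (hK : IsCompact K) :
    FormDomain (K.indicator fun _ => (1 : ℂ)) := by
  have hm : Measurable (K.indicator fun _ : Vel d => (1 : ℂ)) :=
    measurable_const.indicator hK.measurableSet
  have h1 : MemLp (K.indicator fun _ : Vel d => (1 : ℂ)) 2 volume :=
    memLp_indicator_const 2 hK.measurableSet 1 (Or.inr hK.measure_lt_top.ne)
  refine ⟨hm, h1, ?_⟩
  obtain ⟨R, hR⟩ := hK.isBounded.exists_norm_le
  refine (h1.norm.const_mul R).mono (measurable_norm.mul hm.norm).aestronglyMeasurable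
    (ae_of_all _ fun ξ => ?_)
  by_cases h : ξ ∈ K
  · simpa [h] using (hR ξ h).trans (le_abs_self R)
  · simp [h]

/-- The form is represented by the function `collisionOp`, so the weak identity is one between
locally integrable functions and holds almost everywhere. -/
theorem fourierSolution_of_test (hd : 2 ≤ d) {V : Vel d → ℝ} (hV : ContDiff ℝ ∞ V)
    (hc : HasCompactSupport V) {β : ℝ} (hβ : 0 < β) {z : ℂ} (hz : 0 ≤ z.re) {s : ℝ} (hs : 0 ≤ s)
    {κ α : ℝ} {g U : Vel d → ℂ} (hg : MemLp g 2 volume) (hU : FormDomain U)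
    (h : ∀ χ : 𝓢(Vel d, ℂ), HasCompactSupport χ →
      (∫ ξ, symbol κ α ξ * (U ξ * χ ξ)) + form V β z s U χ = ∫ ξ, g ξ * χ ξ) :
    FourierSolution V β κ α z s g U := by
  refine ⟨hU, ?_⟩
  have hint : ∀ Φ : Vel d → ℂ, FormDomain Φ →
      Integrable fun ξ => (symbol κ α ξ * U ξ + collisionOp V β z s U ξ - g ξ) * Φ ξ := by
    intro Φ hΦ
    have i1 := integrable_symbol_mul hU hΦ κ α
    have i2 := (form_eq_integral_collisionOp hd hV hc hβ hz hs hU.meas hU.memLp_norm hΦ.meas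
      hΦ.memLp_norm).1
    have i3 : Integrable fun ξ => g ξ * Φ ξ := hg.integrable_mul hΦ.memLp
    refine ((i1.add i2).sub i3).congr (ae_of_all _ fun ξ => ?_)
    simp only [Pi.add_apply, Pi.sub_apply]
    ring
  -- Indicators of compact sets belong to the form domain; pairing with them gives local
  -- integrability.
  have hloc : LocallyIntegrable
      (fun ξ => symbol κ α ξ * U ξ + collisionOp V β z s U ξ - g ξ) volume := by
    rw [locallyIntegrable_iff]
    intro K hK
    rw [← integrable_indicator_iff hK.measurableSet]
    refine (hint _ (formDomain_indicator hK)).congr (ae_of_all _ fun ξ => ?_)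
    by_cases hξ : ξ ∈ K <;> simp [hξ]
  have h0 := ae_eq_zero_of_integral_contDiff_smul_eq_zero hloc fun f hf hfc => ?_
  · filter_upwards [h0] with ξ hξ using sub_eq_zero.1 hξ
  · have hf' : ContDiff ℝ ∞ (fun x => (f x : ℂ)) := Complex.ofRealCLM.contDiff.comp hf
    have hfc' : HasCompactSupport (fun x => (f x : ℂ)) := hfc.comp_left (g := Complex.ofReal) rfl
    set χ : 𝓢(Vel d, ℂ) := hfc'.toSchwartzMap hf' with hχ
    have hχc : HasCompactSupport χ := hfc'
    have hΦ := formDomain_of_compact χ.continuous hχc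
    have i1 := integrable_symbol_mul hU hΦ κ α
    obtain ⟨i2, e2⟩ := form_eq_integral_collisionOp hd hV hc hβ hz hs hU.meas hU.memLp_norm hΦ.meas
      hΦ.memLp_norm
    have i3 : Integrable fun ξ => g ξ * χ ξ := hg.integrable_mul hΦ.memLp
    have i4 : Integrable fun ξ => symbol κ α ξ * (U ξ * χ ξ) + collisionOp V β z s U ξ * χ ξ :=
      i1.add i2
    have h1 := h χ hχc
    rw [e2, ← integral_add i1 i2, ← sub_eq_zero, ← integral_sub i4 i3] at h1
    rw [← h1]
    congr 1; ext ξ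
    have : χ ξ = (f ξ : ℂ) := rfl
    rw [this, Complex.real_smul]
    ring

theorem norm_le_sum_abs (ξ : Vel d) : ‖ξ‖ ≤ ∑ j : Fin d, |ξ j| := by
  have h : ξ = ∑ j : Fin d, ξ j • (basisVec j : Vel d) := by
    ext i
    simp [basisVec, Finset.sum_apply, Pi.single_apply]
  conv_lhs => rw [h]
  refine (norm_sum_le _ _).trans (Finset.sum_le_sum fun j _ => ?_)
  rw [norm_smul]
  simp [basisVec]

theorem formDomain_fourier {u : L2 d} {G : Fin d → L2 d} (h : IsWeakGradient u G) :
    FormDomain (𝓕 u : L2 d) := by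
  have hm := L2.measurable (𝓕 u : L2 d)
  refine ⟨hm, Lp.memLp _, ?_⟩
  have h1 : MemLp (fun ξ => ∑ j : Fin d, ‖(𝓕 (G j) : L2 d) ξ‖) 2 volume :=
    memLp_finsetSum _ fun j _ => (Lp.memLp (𝓕 (G j) : L2 d)).norm
  refine h1.mono (measurable_norm.mul hm.norm).aestronglyMeasurable ?_
  filter_upwards [ae_all_iff.2 fun j => fourier_weakGradient h j] with ξ hξ
  simp only [hξ]
  have hpi := Real.pi_gt_three
  rw [Real.norm_eq_abs, Real.norm_eq_abs, abs_of_nonneg (by positivity),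
    abs_of_nonneg (Finset.sum_nonneg fun _ _ => norm_nonneg _)]
  calc ‖ξ‖ * ‖(𝓕 u : L2 d) ξ‖ ≤ (∑ j : Fin d, |ξ j|) * ‖(𝓕 u : L2 d) ξ‖ := by
        gcongr; exact norm_le_sum_abs ξ
    _ = ∑ j : Fin d, |ξ j| * ‖(𝓕 u : L2 d) ξ‖ := Finset.sum_mul _ _ _
    _ ≤ _ := Finset.sum_le_sum fun j _ => by
        simp only [norm_mul, Complex.norm_real, Complex.norm_I, Complex.norm_ofNat, Real.norm_eq_abs,
          mul_one]
        rw [abs_of_pos (by linarith : (0 : ℝ) < Real.pi)]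
        have := mul_nonneg (abs_nonneg (ξ j)) (norm_nonneg ((𝓕 u : L2 d) ξ))
        nlinarith

theorem integral_symbol_mul_eq {u : L2 d} {G : Fin d → L2 d} (h : IsWeakGradient u G) (κ α : ℝ)
    {χ : 𝓢(Vel d, ℂ)} (hχ : HasCompactSupport χ) :
    ∫ ξ, symbol κ α ξ * ((𝓕 u : L2 d) ξ * χ ξ) =
      (1 + Complex.I * (α : ℂ)) * (∫ v : Vel d, u v * (𝓕 χ) v)
        + (κ : ℂ) * (∑ j : Fin d, ∫ v : Vel d, G j v * (∂_{basisVec j} (𝓕 χ)) v) := by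
  have hΦ := formDomain_of_compact χ.continuous hχ
  have hU := formDomain_fourier h
  have i1 : Integrable fun ξ => (𝓕 u : L2 d) ξ * χ ξ := hU.memLp.integrable_mul hΦ.memLp
  have e : ∀ j : Fin d, ∫ v : Vel d, G j v * (∂_{basisVec j} (𝓕 χ)) v =
      ∫ ξ, 4 * Real.pi ^ 2 * (ξ j : ℂ) ^ 2 * ((𝓕 u : L2 d) ξ * χ ξ) := fun j => by
    rw [integral_mul_lineDeriv_fourier]
    refine integral_congr_ae ?_
    filter_upwards [fourier_weakGradient h j] with ξ hξ
    rw [hξ, inner_basisVec]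
    have hI := Complex.I_sq
    linear_combination (-4 * Real.pi ^ 2 * (ξ j : ℂ) ^ 2 * (𝓕 u : L2 d) ξ * χ ξ) * hI
  have hj : ∀ j : Fin d, Integrable fun ξ : Vel d =>
      4 * Real.pi ^ 2 * (ξ j : ℂ) ^ 2 * ((𝓕 u : L2 d) ξ * χ ξ) := fun j => by
    have hc : Continuous fun ξ : Vel d => 4 * (Real.pi : ℂ) ^ 2 * (ξ j : ℂ) ^ 2 * χ ξ := by fun_prop
    have hcs : HasCompactSupport fun ξ : Vel d => 4 * (Real.pi : ℂ) ^ 2 * (ξ j : ℂ) ^ 2 * χ ξ :=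
      hχ.mul_left
    have hm : MemLp (fun ξ : Vel d => 4 * (Real.pi : ℂ) ^ 2 * (ξ j : ℂ) ^ 2 * χ ξ) 2 volume :=
      hc.memLp_of_hasCompactSupport hcs
    refine (hU.memLp.integrable_mul hm).congr (ae_of_all _ fun ξ => ?_)
    simp only [Pi.mul_apply]
    ring
  simp only [e]
  rw [integral_mul_fourier, ← integral_finsetSum _ fun j _ => hj j, ← integral_const_mul,
    ← integral_const_mul, ← integral_add (i1.const_mul _) ((integrable_finsetSum _ fun j _ => hj j).const_mul _)]
  congr 1; ext ξ
  rw [← Finset.sum_mul, ← Finset.mul_sum, symbol]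
  have hn : (∑ j : Fin d, (ξ j : ℂ) ^ 2) = ((‖ξ‖ ^ 2 : ℝ) : ℂ) := by
    rw [EuclideanSpace.norm_sq_eq]
    push_cast
    refine Finset.sum_congr rfl fun j _ => ?_
    rw [← Complex.ofReal_pow, ← Complex.ofReal_pow, Real.norm_eq_abs, sq_abs]
  rw [hn]
  push_cast
  ring

/-- Assembles the slices `integral_sPlus_inner` over `k` by Fubini. Radial symmetry enters through
`potHat V k ^ 2 = ‖potHat V k‖ ^ 2`. -/
theorem sPlus_fourier (hd : 2 ≤ d) {V : Vel d → ℝ} (hV : ContDiff ℝ ∞ V)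
    (hc : HasCompactSupport V) (hrad : ∀ x y : Vel d, ‖x‖ = ‖y‖ → V x = V y) {β : ℝ} (hβ : 0 < β)
    {z : ℂ} (hz : 0 < z.re) {σ : ℝ} (hσ : 0 ≤ σ) {u : L2 d} {G : Fin d → L2 d}
    (hG : IsWeakGradient u G) {h : Vel d → L2Pair d}
    (hh : ∀ k, IsResolvent z σ k (sMinus β V G k) (h k)) {χ : 𝓢(Vel d, ℂ)}
    (hχ : HasCompactSupport χ) :
    sPlus β V h (𝓕 χ) = form V β z (8 * Real.pi ^ 3 * σ) (𝓕 u : L2 d) χ := by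
  have hΦ := formDomain_of_compact χ.continuous hχ
  have hU := formDomain_fourier hG
  have hs : 0 ≤ 8 * Real.pi ^ 3 * σ := by positivity
  have hi := (form_bound hd hV hc hβ hz.le hs hU.meas hU.memLp_norm hΦ.meas hΦ.memLp_norm).1
  have h2 := hi.integral_prod_left
  rw [form, integral_prod _ hi]
  simp only [collisionMeasure] at h2 ⊢
  rw [integral_prod _ h2, sPlus, ← integral_const_mul]
  congr 1; ext k
  rw [integral_sPlus_inner hβ V hz hσ hG (hh k) hχ _ rfl, ← mul_assoc, ← integral_const_mul]
  congr 1; ext t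
  rw [← integral_const_mul, ← integral_const_mul]
  congr 1; ext ξ
  rw [formIntegrand, kernel, shift, potHat_sq hrad, potWeight]
  push_cast
  ring

/-- The Fourier transform of the hat equation. -/
theorem SolvesHatEquation.fourierSolution (hd : 2 ≤ d) {V : Vel d → ℝ} (hV : ContDiff ℝ ∞ V)
    (hc : HasCompactSupport V) (hrad : ∀ x y : Vel d, ‖x‖ = ‖y‖ → V x = V y) {β : ℝ} (hβ : 0 < β)
    {κ : ℝ} (hκ : 0 ≤ κ) {N : ℝ} (hN : 0 < N) {𝔤 : L2 d} {α : ℝ} {u : L2 d}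
    (h : SolvesHatEquation β κ V N N 𝔤 α u) :
    FourierSolution V β κ α ((1 + Complex.I * (α : ℂ)) / (N : ℂ)) (8 * Real.pi ^ 3 * (κ / N))
      (𝓕 𝔤 : L2 d) (𝓕 u : L2 d) := by
  obtain ⟨G, r, hG, hr, heq⟩ := h
  have hz : 0 < ((1 + Complex.I * (α : ℂ)) / (N : ℂ)).re := by
    rw [Complex.div_ofReal_re]
    simpa using hN
  have hσ : 0 ≤ κ / N := by positivity
  refine fourierSolution_of_test hd hV hc hβ hz.le (by positivity) (Lp.memLp _)
    (formDomain_fourier hG) fun χ hχ => ?_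
  have h1 := heq (𝓕 χ)
  rw [sPlus_fourier hd hV hc hrad hβ hz hσ hG hr hχ, mul_div_assoc, div_self hN.ne', mul_one,
    Complex.ofReal_one, one_mul, integral_mul_fourier 𝔤] at h1
  rw [integral_symbol_mul_eq hG κ α hχ, h1]

/-! ### Gaussian computation of the Landau tensor -/

/-- Integrals of radial functions against a function homogeneous of degree one. -/
theorem exists_integral_radial_mul_eq (hd : 0 < d) {f : Vel d → ℂ}
    (hf : ∀ r : ℝ, 0 < r → ∀ k, f (r • k) = r * f k) :
    ∃ A : ℂ, ∀ p : ℝ → ℂ, ∫ k : Vel d, p ‖k‖ * f k = A * ∫ k : Vel d, p ‖k‖ * (‖k‖ : ℂ) := by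
  have : Nonempty (Fin d) := ⟨⟨0, hd⟩⟩
  set μ : Measure (Vel d) := volume with hμ
  have key : ∀ F : Vel d → ℂ, (∀ r : ℝ, 0 < r → ∀ k, F (r • k) = r * F k) → ∀ p : ℝ → ℂ,
      ∫ k : Vel d, p ‖k‖ * F k = (∫ x : Metric.sphere (0 : Vel d) 1, F x ∂μ.toSphere) *
        ∫ r : Ioi (0 : ℝ), p r * (r : ℂ) ∂(Measure.volumeIoiPow (Module.finrank ℝ (Vel d) - 1)) := by
    intro F hF p
    calc ∫ k : Vel d, p ‖k‖ * F k ∂μ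
        = ∫ x : ({(0 : Vel d)}ᶜ : Set (Vel d)), p ‖x.1‖ * F x.1 ∂(μ.comap (↑)) := by
          rw [integral_subtype_comap (measurableSet_singleton _).compl fun x : Vel d => p ‖x‖ * F x,
            restrict_compl_singleton]
      _ = ∫ y, F y.1 * (p y.2 * (y.2 : ℂ))
            ∂μ.toSphere.prod (Measure.volumeIoiPow (Module.finrank ℝ (Vel d) - 1)) := by
          rw [← μ.measurePreserving_homeomorphUnitSphereProd.integral_comp
            (Homeomorph.measurableEmbedding _) (fun y => F y.1 * (p y.2 * (y.2 : ℂ)))]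
          congr 1; ext x
          have hx : 0 < ‖x.1‖ := norm_pos_iff.2 x.2
          have h := hF ‖x.1‖ hx (‖x.1‖⁻¹ • x.1)
          rw [smul_smul, mul_inv_cancel₀ hx.ne', one_smul] at h
          simp only [homeomorphUnitSphereProd_apply_fst_coe, homeomorphUnitSphereProd_apply_snd_coe]
          rw [h]
          ring
      _ = _ := by rw [integral_prod_mul (fun x : Metric.sphere (0 : Vel d) 1 => F x)
            (fun r : Ioi (0 : ℝ) => p r * (r : ℂ))]
  have hnorm := key (fun k => (‖k‖ : ℂ)) fun r hr k => by
    rw [norm_smul, Real.norm_eq_abs, abs_of_pos hr]; push_cast; rfl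
  have hS : (∫ x : Metric.sphere (0 : Vel d) 1, ((‖(x : Vel d)‖ : ℝ) : ℂ) ∂μ.toSphere) ≠ 0 := by
    have e : ∀ x : Metric.sphere (0 : Vel d) 1, ((‖(x : Vel d)‖ : ℝ) : ℂ) = 1 := fun x => by simp
    simp only [e, integral_const]
    have hne : μ.toSphere.real univ ≠ 0 := by
      rw [measureReal_def, ENNReal.toReal_ne_zero]
      exact ⟨Measure.measure_univ_ne_zero.2 (Measure.toSphere_ne_zero μ), measure_ne_top _ _⟩
    simpa using hne
  -- The constant is the mean of `f` over the unit sphere. The radial integral is the same for `f`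
  -- and for the norm, so no integrability of `p` is needed.
  refine ⟨(∫ x : Metric.sphere (0 : Vel d) 1, f x ∂μ.toSphere) /
    ∫ x : Metric.sphere (0 : Vel d) 1, ((‖(x : Vel d)‖ : ℝ) : ℂ) ∂μ.toSphere, fun p => ?_⟩
  rw [key f hf p, hnorm p]
  field_simp

/-- The plane wave times the standard Gaussian. -/
def gaussWave (y k : Vel d) : ℂ :=
  Complex.exp (-(1 / 2 : ℝ) * ‖k‖ ^ 2 + Complex.I * (inner ℝ y k : ℝ))

theorem norm_gaussWave (y k : Vel d) : ‖gaussWave y k‖ = Real.exp (-(1 / 2) * ‖k‖ ^ 2) := by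
  rw [gaussWave, Complex.norm_exp]
  congr 1
  have : -(((1 / 2 : ℝ)) : ℂ) * (‖k‖ : ℂ) ^ 2 = ((-(1 / 2) * ‖k‖ ^ 2 : ℝ) : ℂ) := by push_cast; ring
  rw [this, Complex.add_re, Complex.ofReal_re]
  simp

theorem integral_gaussWave (y : Vel d) :
    ∫ k, gaussWave y k = (((2 * Real.pi) ^ ((d : ℝ) / 2) * Real.exp (-(‖y‖ ^ 2 / 2)) : ℝ) : ℂ) := by
  have hpi := Real.pi_pos
  have h := GaussianFourier.integral_cexp_neg_mul_sq_norm_add (b := ((1 / 2 : ℝ) : ℂ))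
    (by simp) Complex.I y
  unfold gaussWave
  rw [h, finrank_euclideanSpace_fin, Complex.ofReal_mul, Complex.ofReal_cpow (by positivity), Complex.ofReal_exp]
  congr 1
  · push_cast
    congr 1
    field_simp
  · congr 1
    rw [Complex.I_sq]
    push_cast
    ring

theorem integrable_pow_mul_gaussian (m : ℕ) {a : ℝ} (ha : 0 < a) :
    Integrable fun k : Vel d => Real.exp (-a * ‖k‖ ^ 2) * ‖k‖ ^ m := by
  obtain ⟨C, hC⟩ : ∃ C : ℝ, ∀ x : ℝ, 0 ≤ x → Real.exp (-(a / 2) * x ^ 2) * x ^ m ≤ C := by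
    -- From `x ^ m ≤ m! exp x` and `-(a / 2) x² + x ≤ 1 / (2a)`.
    refine ⟨(m.factorial : ℝ) * Real.exp (1 / (2 * a)), fun x hx => ?_⟩
    have h1 := Real.pow_div_factorial_le_exp x hx m
    have h2 : x ^ m ≤ m.factorial * Real.exp x := by
      rw [div_le_iff₀ (by positivity)] at h1
      linarith
    calc Real.exp (-(a / 2) * x ^ 2) * x ^ m ≤
          Real.exp (-(a / 2) * x ^ 2) * (m.factorial * Real.exp x) := by gcongr
      _ = m.factorial * Real.exp (-(a / 2) * x ^ 2 + x) := by rw [Real.exp_add]; ring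
      _ ≤ _ := by
        gcongr
        have e : 1 / (2 * a) - (-(a / 2) * x ^ 2 + x) = (a * x - 1) ^ 2 / (2 * a) := by
          field_simp
          ring
        have : 0 ≤ (a * x - 1) ^ 2 / (2 * a) := by positivity
        linarith
  refine ((integrable_rexp_neg_mul_norm_sq (d := d) (a := a / 2) (by positivity)).const_mul C).mono'
    (by fun_prop : Continuous _).aestronglyMeasurable (ae_of_all _ fun k => ?_)
  rw [Real.norm_eq_abs, abs_of_nonneg (by positivity)]
  have h := hC ‖k‖ (norm_nonneg _)
  calc Real.exp (-a * ‖k‖ ^ 2) * ‖k‖ ^ m =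
        (Real.exp (-(a / 2) * ‖k‖ ^ 2) * ‖k‖ ^ m) * Real.exp (-(a / 2) * ‖k‖ ^ 2) := by
        rw [mul_right_comm, ← Real.exp_add]; ring_nf
    _ ≤ _ := by gcongr

theorem hasLineDerivAt_of_eq {f : Vel d → ℂ} {a b : ℂ} {x v : Vel d} (h : HasLineDerivAt ℝ f a x v)
    (e : a = b) : HasLineDerivAt ℝ f b x v := e ▸ h

theorem hasLineDerivAt_gaussWave (y k : Vel d) (i : Fin d) :
    HasLineDerivAt ℝ (gaussWave y) ((-(k i : ℂ) + Complex.I * (y i : ℂ)) * gaussWave y k) k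
      (basisVec i) := by
  have h1 : HasFDerivAt (fun k : Vel d => -(((1 / 2 : ℝ)) : ℂ) * (‖k‖ : ℂ) ^ 2)
      (-(((1 / 2 : ℝ)) : ℂ) • (Complex.ofRealCLM.comp ((2 : ℝ) • innerSL ℝ k))) k := by
    have h := (Complex.ofRealCLM.hasFDerivAt (x := ‖k‖ ^ 2)).comp k (hasStrictFDerivAt_norm_sq k).hasFDerivAt
    have h' := h.const_mul (-(((1 / 2 : ℝ)) : ℂ))
    refine h'.congr_of_eventuallyEq (Filter.Eventually.of_forall fun x => ?_) |>.congr_fderiv ?_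
    · simp
    · ext; simp
  have h2 : HasFDerivAt (fun k : Vel d => Complex.I * ((inner ℝ y k : ℝ) : ℂ))
      (Complex.I • (Complex.ofRealCLM.comp (innerSL ℝ y))) k :=
    (Complex.ofRealCLM.comp (innerSL ℝ y)).hasFDerivAt.const_mul Complex.I
  have h3 := (h1.add h2).cexp.hasLineDerivAt (basisVec i : Vel d)
  refine hasLineDerivAt_of_eq h3 ?_
  simp only [gaussWave, smul_apply, add_apply, ContinuousLinearMap.comp_apply, innerSL_apply_apply,
    Complex.ofRealCLM_apply, inner_basisVec, smul_eq_mul, Pi.add_apply]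
  push_cast
  ring

theorem abs_apply_le_norm (k : Vel d) (i : Fin d) : |k i| ≤ ‖k‖ := PiLp.norm_apply_le k i

theorem integrable_mul_gaussWave (y : Vel d) {P : Vel d → ℂ} (hP : Continuous P) (m : ℕ)
    (hle : ∀ k, ‖P k‖ ≤ ‖k‖ ^ m) : Integrable fun k => P k * gaussWave y k := by
  have hg : Continuous (gaussWave y) := by unfold gaussWave; fun_prop
  refine (integrable_pow_mul_gaussian m (a := 1 / 2) (by norm_num)).mono'
    (hP.mul hg).aestronglyMeasurable (ae_of_all _ fun k => ?_)
  rw [norm_mul, norm_gaussWave, mul_comm]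
  gcongr
  exact hle k

theorem continuous_coord (i : Fin d) : Continuous fun k : Vel d => (k i : ℂ) := by fun_prop

theorem norm_coord_le (k : Vel d) (i : Fin d) : ‖(k i : ℂ)‖ ≤ ‖k‖ ^ 1 := by
  rw [Complex.norm_real, pow_one]
  exact abs_apply_le_norm k i

theorem norm_coord_mul_coord_le (k : Vel d) (i j : Fin d) : ‖(k i : ℂ) * (k j : ℂ)‖ ≤ ‖k‖ ^ 2 := by
  rw [norm_mul, sq]
  have h1 := norm_coord_le k i
  have h2 := norm_coord_le k j
  rw [pow_one] at h1 h2
  gcongr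

/-- The integral of the `i`-th derivative of the Gaussian wave vanishes. -/
theorem integral_coord_mul_gaussWave (y : Vel d) (i : Fin d) :
    ∫ k : Vel d, (k i : ℂ) * gaussWave y k = Complex.I * (y i : ℂ) * ∫ k, gaussWave y k := by
  have i0 : Integrable (gaussWave y) := by
    simpa using integrable_mul_gaussWave y (P := fun _ => 1) continuous_const 0 (by simp)
  have i1 := integrable_mul_gaussWave y (continuous_coord i) 1 fun k => norm_coord_le k i
  have e : ∀ k : Vel d, (-(k i : ℂ) + Complex.I * (y i : ℂ)) * gaussWave y k =
      Complex.I * (y i : ℂ) * gaussWave y k - (k i : ℂ) * gaussWave y k := fun k => by ring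
  have h := integral_bilinear_hasLineDerivAt_right_eq_neg_left_of_integrable
    (μ := (volume : Measure (Vel d))) (f := fun _ : Vel d => (1 : ℂ)) (f' := fun _ => 0)
    (g := gaussWave y) (g' := fun k => (-(k i : ℂ) + Complex.I * (y i : ℂ)) * gaussWave y k)
    (v := basisVec i) (B := ContinuousLinearMap.mul ℝ ℂ) (by simp)
    (by simp only [e, ContinuousLinearMap.mul_apply', one_mul]; exact (i0.const_mul _).sub i1)
    (by simpa using i0) (fun x _ => by simpa using (hasFDerivAt_const (1 : ℂ) x).hasLineDerivAt (basisVec i))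
    (fun x _ => hasLineDerivAt_gaussWave y x i)
  simp only [e, ContinuousLinearMap.mul_apply', one_mul, zero_mul, integral_zero, neg_zero] at h
  rw [integral_sub (i0.const_mul _) i1, integral_const_mul, sub_eq_zero] at h
  exact h.symm

/-- Second moments of a Gaussian wave. -/
theorem integral_coord_mul_coord_mul_gaussWave (y : Vel d) (i j : Fin d) :
    ∫ k : Vel d, (k i : ℂ) * (k j : ℂ) * gaussWave y k =
      ((if i = j then 1 else 0) - (y i : ℂ) * (y j : ℂ)) * ∫ k, gaussWave y k := by
  have i0 : Integrable (gaussWave y) := by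
    simpa using integrable_mul_gaussWave y (P := fun _ => 1) continuous_const 0 (by simp)
  have i1 := integrable_mul_gaussWave y (continuous_coord j) 1 fun k => norm_coord_le k j
  have i2 : Integrable fun k : Vel d => (k i : ℂ) * (k j : ℂ) * gaussWave y k :=
    integrable_mul_gaussWave y ((continuous_coord i).mul (continuous_coord j)) 2
    fun k => norm_coord_mul_coord_le k i j
  have e : ∀ k : Vel d, (k j : ℂ) * ((-(k i : ℂ) + Complex.I * (y i : ℂ)) * gaussWave y k) =
      Complex.I * (y i : ℂ) * ((k j : ℂ) * gaussWave y k) - (k i : ℂ) * (k j : ℂ) * gaussWave y k :=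
    fun k => by ring
  have hder : ∀ k : Vel d, HasLineDerivAt ℝ (fun k : Vel d => (k j : ℂ))
      (if i = j then 1 else 0) k (basisVec i) := fun k => by
    have h := (Complex.ofRealCLM.comp (EuclideanSpace.proj j : Vel d →L[ℝ] ℝ)).hasFDerivAt
      (x := k) |>.hasLineDerivAt (basisVec i)
    refine hasLineDerivAt_of_eq h ?_
    by_cases hij : i = j
    · simp [hij, basisVec]
    · simp [hij, Ne.symm hij, basisVec]
  -- Integration by parts of `k_j` against the `i`-th derivative of the wave: the Kronecker delta is
  -- the derivative of `k_j`, and the product `y_i y_j` comes from the first moment.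
  have h := integral_bilinear_hasLineDerivAt_right_eq_neg_left_of_integrable
    (μ := (volume : Measure (Vel d))) (f := fun k : Vel d => (k j : ℂ))
    (f' := fun _ => if i = j then 1 else 0)
    (g := gaussWave y) (g' := fun k => (-(k i : ℂ) + Complex.I * (y i : ℂ)) * gaussWave y k)
    (v := basisVec i) (B := ContinuousLinearMap.mul ℝ ℂ)
    (by simp only [ContinuousLinearMap.mul_apply']; exact i0.const_mul _)
    (by simp only [e, ContinuousLinearMap.mul_apply']; exact (i1.const_mul _).sub i2)
    (by simpa using i1) (fun x _ => hder x) (fun x _ => hasLineDerivAt_gaussWave y x i)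
  simp only [e, ContinuousLinearMap.mul_apply'] at h
  rw [integral_sub (i1.const_mul _) i2, integral_const_mul, integral_const_mul,
    integral_coord_mul_gaussWave] at h
  have hI := Complex.I_sq
  linear_combination (-1 : ℂ) * h + (y i : ℂ) * (y j : ℂ) * (∫ k, gaussWave y k) * hI

/-- The second moments of the Gaussian wave of frequency `2 π t x`. -/
def waveMoment (i j : Fin d) (t : ℝ) (x : Vel d) : ℝ :=
  (2 * Real.pi) ^ ((d : ℝ) / 2) * (((if i = j then 1 else 0) - (2 * Real.pi * t) ^ 2 * (x i * x j)) *
    Real.exp (-((2 * Real.pi * t) ^ 2 * ‖x‖ ^ 2 / 2)))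

theorem integral_gaussWave_smul (i j : Fin d) (t : ℝ) (x : Vel d) :
    ∫ k : Vel d, (k i : ℂ) * (k j : ℂ) * gaussWave ((2 * Real.pi * t) • x) k =
      (waveMoment i j t x : ℂ) := by
  rw [integral_coord_mul_coord_mul_gaussWave, integral_gaussWave, waveMoment]
  simp only [PiLp.smul_apply, smul_eq_mul, norm_smul, mul_pow, Real.norm_eq_abs, sq_abs]
  split_ifs <;> push_cast <;> ring

theorem continuous_waveMoment (i j : Fin d) :
    Continuous fun p : ℝ × Vel d => waveMoment i j p.1 p.2 := by
  unfold waveMoment; fun_prop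

theorem abs_waveMoment_le (i j : Fin d) (t : ℝ) (x : Vel d) :
    |waveMoment i j t x| ≤ 4 * (2 * Real.pi) ^ ((d : ℝ) / 2) *
      Real.exp (-(Real.pi ^ 2 * t ^ 2) * ‖x‖ ^ 2) := by
  have hpi := Real.pi_pos
  set u := Real.pi ^ 2 * t ^ 2 * ‖x‖ ^ 2 with hu
  have hu0 : 0 ≤ u := by positivity
  have h1 : |(if i = j then 1 else 0) - (2 * Real.pi * t) ^ 2 * (x i * x j)| ≤ 1 + 4 * u := by
    refine (abs_sub _ _).trans ?_
    gcongr
    · split_ifs <;> simp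
    · rw [abs_mul, abs_mul, abs_of_nonneg (sq_nonneg (2 * Real.pi * t))]
      calc (2 * Real.pi * t) ^ 2 * (|x i| * |x j|) ≤ (2 * Real.pi * t) ^ 2 * (‖x‖ * ‖x‖) := by
            gcongr <;> exact abs_apply_le_norm _ _
        _ = 4 * u := by rw [hu]; ring
  have h2 : (1 + 4 * u) * Real.exp (-(2 * u)) ≤ 4 * Real.exp (-u) := by
    have e : Real.exp (-(2 * u)) = Real.exp (-u) * Real.exp (-u) := by rw [← Real.exp_add]; ring_nf
    have h3 := Real.add_one_le_exp u
    have h4 : Real.exp u * Real.exp (-u) = 1 := by rw [← Real.exp_add]; simp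
    have h5 := Real.exp_pos (-u)
    have h6 : (1 + 4 * u) * Real.exp (-u) ≤ 4 := by
      calc (1 + 4 * u) * Real.exp (-u) ≤ (4 * Real.exp u) * Real.exp (-u) := by gcongr; linarith
        _ = 4 := by rw [mul_assoc, h4, mul_one]
    rw [e, ← mul_assoc]
    gcongr
  rw [waveMoment, abs_mul, abs_mul, Real.abs_exp, abs_of_pos (by positivity),
    show -((2 * Real.pi * t) ^ 2 * ‖x‖ ^ 2 / 2) = -(2 * u) by rw [hu]; ring,
    show -(Real.pi ^ 2 * t ^ 2) * ‖x‖ ^ 2 = -u by rw [hu]; ring]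
  calc _ ≤ (2 * Real.pi) ^ ((d : ℝ) / 2) * ((1 + 4 * u) * Real.exp (-(2 * u))) := by gcongr
    _ ≤ (2 * Real.pi) ^ ((d : ℝ) / 2) * (4 * Real.exp (-u)) := by gcongr
    _ = _ := by ring

theorem integral_sq_mul_gaussian {b : ℝ} (hb : 0 < b) :
    ∫ t in Ioi (0 : ℝ), t ^ 2 * Real.exp (-b * t ^ 2) = √(Real.pi / b) / (4 * b) := by
  have h := integral_rpow_mul_exp_neg_mul_rpow (p := 2) (q := 2) (b := b) (by norm_num) (by norm_num) hb
  simp only [Real.rpow_two] at h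
  have hG : Real.Gamma ((2 + 1) / 2) = √Real.pi / 2 := by
    rw [show ((2 : ℝ) + 1) / 2 = 1 / 2 + 1 by norm_num, Real.Gamma_add_one (by norm_num),
      Real.Gamma_one_half_eq]
    ring
  rw [h, hG, show (-(2 + 1) / 2 : ℝ) = -(1 : ℝ) + -(1 / 2) by norm_num, Real.rpow_add hb,
    Real.rpow_neg hb.le, Real.rpow_neg hb.le, Real.rpow_one, ← Real.sqrt_eq_rpow,
    Real.sqrt_div Real.pi_pos.le]
  have : 0 < √b := Real.sqrt_pos.2 hb
  field_simp
  norm_num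

/-- The Landau kernel appears here. Integrated over `t`, the Gaussian gives `‖x‖⁻¹` and its second
moment gives `‖x‖⁻³`, with coefficients that combine into the projection orthogonal to `x`. -/
theorem integral_waveMoment (i j : Fin d) {x : Vel d} (hx : x ≠ 0) :
    ∫ t in Ioi (0 : ℝ), waveMoment i j t x =
      (2 * Real.pi) ^ ((d : ℝ) / 2) / (2 * √(2 * Real.pi)) *
        (1 / ‖x‖ * ((if i = j then 1 else 0) - x i * x j / ‖x‖ ^ 2)) := by
  have hpi := Real.pi_pos
  have hx0 : 0 < ‖x‖ := norm_pos_iff.2 hx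
  have hb : 0 < 2 * Real.pi ^ 2 * ‖x‖ ^ 2 := by positivity
  set b := 2 * Real.pi ^ 2 * ‖x‖ ^ 2 with hbdef
  have i1 : IntegrableOn (fun t : ℝ => Real.exp (-b * t ^ 2)) (Ioi 0) :=
    (integrable_exp_neg_mul_sq hb).integrableOn
  have i2 : IntegrableOn (fun t : ℝ => t ^ 2 * Real.exp (-b * t ^ 2)) (Ioi 0) := by
    have := integrable_rpow_mul_exp_neg_mul_sq hb (s := 2) (by norm_num)
    simp only [Real.rpow_two] at this
    exact this.integrableOn
  have e : ∀ t : ℝ, waveMoment i j t x = (2 * Real.pi) ^ ((d : ℝ) / 2) *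
      ((if i = j then 1 else 0) * Real.exp (-b * t ^ 2) -
        (4 * Real.pi ^ 2 * (x i * x j)) * (t ^ 2 * Real.exp (-b * t ^ 2))) := fun t => by
    rw [waveMoment, show -((2 * Real.pi * t) ^ 2 * ‖x‖ ^ 2 / 2) = -b * t ^ 2 by rw [hbdef]; ring]
    ring
  simp only [e]
  rw [integral_const_mul, integral_sub (i1.const_mul _) (i2.const_mul _), integral_const_mul,
    integral_const_mul, integral_gaussian_Ioi, integral_sq_mul_gaussian hb]
  have hs : √(Real.pi / b) = 1 / (√(2 * Real.pi) * ‖x‖) := by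
    rw [Real.sqrt_eq_iff_mul_self_eq (by positivity) (by positivity), div_mul_div_comm,
      mul_mul_mul_comm, Real.mul_self_sqrt (by positivity), hbdef]
    field_simp
  rw [hs, hbdef]
  have : 0 < √(2 * Real.pi) := Real.sqrt_pos.2 (by positivity)
  field_simp

theorem continuous_maxwellian (β : ℝ) : Continuous (maxwellian d β) := by
  unfold maxwellian; fun_prop

theorem maxwellian_nonneg {β : ℝ} (hβ : 0 < β) (v : Vel d) : 0 ≤ maxwellian d β v := by
  unfold maxwellian; positivity

theorem integrable_maxwellian {β : ℝ} (hβ : 0 < β) : Integrable (maxwellian d β) := by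
  unfold maxwellian
  exact (integrable_rexp_neg_mul_norm_sq (by positivity)).const_mul _

theorem maxwellian_le {β : ℝ} (hβ : 0 < β) (v : Vel d) :
    maxwellian d β v ≤ (β / (2 * Real.pi)) ^ ((d : ℝ) / 2) := by
  have : Real.exp (-(β / 2) * ‖v‖ ^ 2) ≤ 1 := Real.exp_le_one_iff.2 (by
    have : 0 ≤ β / 2 * ‖v‖ ^ 2 := by positivity
    linarith)
  unfold maxwellian
  have h0 : 0 ≤ (β / (2 * Real.pi)) ^ ((d : ℝ) / 2) := by positivity
  nlinarith

/-- The characteristic function of the Maxwellian. -/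
theorem integral_maxwellian_mul_cexp {β : ℝ} (hβ : 0 < β) (t : ℝ) (k : Vel d) :
    ∫ w : Vel d, (maxwellian d β w : ℂ) *
      Complex.exp (-(2 * Real.pi * Complex.I * ((t * inner ℝ k w : ℝ) : ℂ))) =
      (Real.exp (-(2 * Real.pi ^ 2 / β) * (t ^ 2 * ‖k‖ ^ 2)) : ℂ) := by
  have hpi := Real.pi_pos
  have h := GaussianFourier.integral_cexp_neg_mul_sq_norm_add (b := ((β / 2 : ℝ) : ℂ))
    (by simpa using hβ) (-(2 * Real.pi * Complex.I * t)) k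
  have e : ∀ w : Vel d, (maxwellian d β w : ℂ) *
      Complex.exp (-(2 * Real.pi * Complex.I * ((t * inner ℝ k w : ℝ) : ℂ))) =
      (((β / (2 * Real.pi)) ^ ((d : ℝ) / 2) : ℝ) : ℂ) * Complex.exp (-((β / 2 : ℝ) : ℂ) * (‖w‖ : ℂ) ^ 2 +
        -(2 * Real.pi * Complex.I * t) * ((inner ℝ k w : ℝ) : ℂ)) := fun w => by
    rw [maxwellian, Complex.exp_add]
    push_cast
    ring_nf
  simp only [e]
  rw [integral_const_mul, h, finrank_euclideanSpace_fin]
  have e2 : ((Real.pi : ℂ) / ((β / 2 : ℝ) : ℂ)) ^ ((d : ℂ) / 2) =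
      (((2 * Real.pi / β) ^ ((d : ℝ) / 2) : ℝ) : ℂ) := by
    rw [Complex.ofReal_cpow (by positivity)]
    push_cast
    congr 1
    have : (β : ℂ) ≠ 0 := by exact_mod_cast hβ.ne'
    field_simp
  rw [e2, ← mul_assoc, ← Complex.ofReal_mul, ← Real.mul_rpow (by positivity) (by positivity)]
  have e3 : β / (2 * Real.pi) * (2 * Real.pi / β) = 1 := by field_simp
  rw [e3, Real.one_rpow, Complex.ofReal_one, one_mul]
  push_cast
  congr 1
  have : (β : ℂ) ≠ 0 := by exact_mod_cast hβ.ne'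
  field_simp
  rw [Complex.I_sq]
  ring

/-- Identifies the geometric constant of the Landau prefactor. In polar coordinates the integral is
`d * unitBallVolume d` times a radial one, whose Gamma factor cancels that of `unitBallVolume (d -
1)`. -/
theorem integral_gaussian_mul_norm (hd : 2 ≤ d) :
    unitBallVolume (d - 1) / (d * unitBallVolume d) *
      (∫ k : Vel d, Real.exp (-(1 / 2) * ‖k‖ ^ 2) * ‖k‖) = (2 * Real.pi) ^ (((d : ℝ) - 1) / 2) := by
  have hpi := Real.pi_pos
  have : Nonempty (Fin d) := ⟨⟨0, by omega⟩⟩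
  have : Nontrivial (Vel d) := by
    have : Nontrivial (Fin d) := Fin.nontrivial_iff_two_le.2 hd
    infer_instance
  have hw : 0 < unitBallVolume d := by
    unfold unitBallVolume
    rw [measureReal_def]
    exact ENNReal.toReal_pos (Metric.measure_ball_pos _ _ one_pos).ne' measure_ball_lt_top.ne
  have h1 := integral_fun_norm_addHaar (volume : Measure (Vel d))
    (fun r : ℝ => Real.exp (-(1 / 2) * r ^ 2) * r)
  have h2 := integral_rpow_mul_exp_neg_mul_rpow (p := 2) (q := d) (b := 1 / 2) (by norm_num)
    (by have : (0 : ℝ) ≤ d := by positivity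
        linarith) (by norm_num)
  have e1 : ∫ y in Ioi (0 : ℝ), y ^ (Module.finrank ℝ (Vel d) - 1) • (Real.exp (-(1 / 2) * y ^ 2) * y) =
      ∫ x in Ioi (0 : ℝ), x ^ (d : ℝ) * Real.exp (-(1 / 2) * x ^ (2 : ℝ)) := by
    refine setIntegral_congr_fun measurableSet_Ioi fun y hy => ?_
    simp only [finrank_euclideanSpace_fin, smul_eq_mul, Real.rpow_natCast, Real.rpow_two]
    obtain ⟨m, rfl⟩ : ∃ m, d = m + 1 := ⟨d - 1, by omega⟩
    rw [Nat.add_sub_cancel, pow_succ]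
    ring
  rw [e1, h2] at h1
  rw [h1, finrank_euclideanSpace_fin]
  have h3 : unitBallVolume (d - 1) = Real.pi ^ (((d : ℝ) - 1) / 2) / Real.Gamma (((d : ℝ) + 1) / 2) := by
    have : Nonempty (Fin (d - 1)) := ⟨⟨0, by omega⟩⟩
    unfold unitBallVolume
    rw [measureReal_def, EuclideanSpace.volume_ball, ENNReal.ofReal_one, one_pow, one_mul,
      Fintype.card_fin, ENNReal.toReal_ofReal (by positivity), Nat.cast_sub (by omega), Nat.cast_one,
      Real.sqrt_eq_rpow, ← Real.rpow_natCast, ← Real.rpow_mul hpi.le, Nat.cast_sub (by omega), Nat.cast_one]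
    congr 2 <;> ring
  have hG : 0 < Real.Gamma (((d : ℝ) + 1) / 2) := Real.Gamma_pos_of_pos (by positivity)
  have hd0 : (0 : ℝ) < d := by
    have : 0 < d := by omega
    exact_mod_cast this
  have h4 : ((1 : ℝ) / 2) ^ (-((d : ℝ) + 1) / 2) = 2 ^ (((d : ℝ) - 1) / 2) * 2 := by
    rw [one_div, Real.inv_rpow (by norm_num), ← Real.rpow_neg (by norm_num),
      show -(-((d : ℝ) + 1) / 2) = ((d : ℝ) - 1) / 2 + 1 by ring, Real.rpow_add (by norm_num), Real.rpow_one]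
  rw [h3, h4, Real.mul_rpow (by norm_num) hpi.le]
  change _ * (d • unitBallVolume d • _) = _
  simp only [nsmul_eq_mul, smul_eq_mul]
  field_simp

/-- The integrand over `(k, t)` in the Fourier representation of the Landau tensor. -/
def landauPhase (β : ℝ) (v : Vel d) (i j : Fin d) (y : Vel d × ℝ) : ℂ :=
  (y.1 i : ℂ) * (y.1 j : ℂ) * (Real.exp (-(2 * Real.pi ^ 2 / β) * (y.2 ^ 2 * ‖y.1‖ ^ 2)) : ℂ) *
    Complex.exp (2 * Real.pi * Complex.I * ((y.2 * inner ℝ y.1 v : ℝ) : ℂ))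

theorem norm_cexp_two_pi_I_mul (x : ℝ) : ‖Complex.exp (2 * Real.pi * Complex.I * (x : ℂ))‖ = 1 := by
  rw [show 2 * (Real.pi : ℂ) * Complex.I * (x : ℂ) = ((2 * Real.pi * x : ℝ) : ℂ) * Complex.I by
    push_cast; ring, Complex.norm_exp_ofReal_mul_I]

theorem norm_landauPhase_le (β : ℝ) (v : Vel d) (i j : Fin d) (y : Vel d × ℝ) :
    ‖landauPhase β v i j y‖ ≤
      ‖y.1‖ ^ 2 * Real.exp (-(2 * Real.pi ^ 2 / β) * (y.2 ^ 2 * ‖y.1‖ ^ 2)) := by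
  rw [landauPhase, norm_mul, norm_mul, norm_cexp_two_pi_I_mul, mul_one, Complex.norm_real,
    Real.norm_eq_abs, Real.abs_exp]
  exact mul_le_mul_of_nonneg_right (norm_coord_mul_coord_le _ i j) (Real.exp_nonneg _)

theorem continuous_landauPhase (β : ℝ) (i j : Fin d) :
    Continuous fun p : Vel d × (Vel d × ℝ) => landauPhase β p.1 i j p.2 := by
  unfold landauPhase; fun_prop

theorem integrable_weight_mul_landauPhase (hd : 0 < d) {β : ℝ} (hβ : 0 < β) {w : Vel d → ℝ}
    (hw : Continuous w) (hw0 : ∀ k, 0 ≤ w k) (h1 : Integrable fun k => w k * ‖k‖ ^ 1)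
    (h2 : Integrable fun k => w k * ‖k‖ ^ 0) (v : Vel d) (i j : Fin d) :
    Integrable (fun y => (w y.1 : ℂ) * landauPhase β v i j y) (collisionMeasure d) := by
  refine (integrable_gaussian_weight hd hw hw0 h1 h2
    (a := 2 * Real.pi ^ 2 / β) (by positivity)).mono' ?_ ?_
  · have := (continuous_landauPhase β i j).comp (Continuous.prodMk_right v)
    exact Continuous.aestronglyMeasurable (by fun_prop)
  · filter_upwards [ae_collisionMeasure_pos] with y hy
    rw [norm_mul, Complex.norm_real, Real.norm_eq_abs, abs_of_nonneg (hw0 _)]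
    have h := norm_landauPhase_le β v i j y
    have h0 : 0 ≤ w y.1 * ‖y.1‖ ^ 2 * Real.exp (-(2 * Real.pi ^ 2 / β) * (y.2 ^ 2 * ‖y.1‖ ^ 2)) :=
      mul_nonneg (mul_nonneg (hw0 _) (by positivity)) (Real.exp_nonneg _)
    have h3 := mul_le_mul_of_nonneg_left h (hw0 y.1)
    nlinarith

/-- The time integral of `landauPhase`. -/
def landauProfile (β : ℝ) (v : Vel d) (i j : Fin d) (k : Vel d) : ℂ :=
  ∫ t in Ioi (0 : ℝ), landauPhase β v i j (k, t)

/-- The integrand depends on `(k, t)` through `t k` and a factor quadratic in `k`; rescaling time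
takes back one of the two powers of `r`. -/
theorem landauProfile_smul (β : ℝ) (v : Vel d) (i j : Fin d) {r : ℝ} (hr : 0 < r) (k : Vel d) :
    landauProfile β v i j (r • k) = r * landauProfile β v i j k := by
  have e : ∀ t : ℝ, landauPhase β v i j (r • k, t) = (r : ℂ) ^ 2 * landauPhase β v i j (k, r * t) := by
    intro t
    simp only [landauPhase, PiLp.smul_apply, smul_eq_mul, norm_smul, inner_smul_left, mul_pow,
      Real.norm_eq_abs, sq_abs, RCLike.conj_to_real]
    rw [show t * (r * inner ℝ k v) = r * t * inner ℝ k v by ring,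
      show t ^ 2 * (r ^ 2 * ‖k‖ ^ 2) = r ^ 2 * t ^ 2 * ‖k‖ ^ 2 by ring]
    push_cast
    ring
  simp only [landauProfile, e]
  rw [integral_const_mul, integral_comp_mul_left_Ioi (fun t => landauPhase β v i j (k, t)) 0 hr,
    mul_zero, Complex.real_smul]
  have : (r : ℂ) ≠ 0 := by exact_mod_cast hr.ne'
  push_cast
  field_simp

theorem integral_weight_mul_landauPhase (hd : 0 < d) {β : ℝ} (hβ : 0 < β) {w : Vel d → ℝ}
    (hw : Continuous w) (hw0 : ∀ k, 0 ≤ w k) (h1 : Integrable fun k => w k * ‖k‖ ^ 1)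
    (h2 : Integrable fun k => w k * ‖k‖ ^ 0) (v : Vel d) (i j : Fin d) :
    ∫ y, (w y.1 : ℂ) * landauPhase β v i j y ∂collisionMeasure d =
      ∫ k : Vel d, (w k : ℂ) * landauProfile β v i j k := by
  have h := integrable_weight_mul_landauPhase hd hβ hw hw0 h1 h2 v i j
  rw [collisionMeasure] at h ⊢
  rw [integral_prod _ h]
  exact integral_congr_ae (ae_of_all _ fun k => by simp only [landauProfile, integral_const_mul])

/-- The exponential in `t² ‖k‖²` is the characteristic function of `M`. Written as an integral over
`w` and exchanged with the integral over `k`, it leaves the moments of a Gaussian wave of frequency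
`2πt (v - w)`. -/
theorem integral_gaussian_mul_landauPhase {β : ℝ} (hβ : 0 < β) (v : Vel d) (i j : Fin d) (t : ℝ) :
    ∫ k : Vel d, (Real.exp (-(1 / 2) * ‖k‖ ^ 2) : ℂ) * landauPhase β v i j (k, t) =
      ∫ w : Vel d, ((maxwellian d β w * waveMoment i j t (v - w) : ℝ) : ℂ) := by
  have hg : ∀ k w : Vel d, (Real.exp (-(1 / 2) * ‖k‖ ^ 2) : ℂ) * ((k i : ℂ) * (k j : ℂ)) *
      Complex.exp (2 * Real.pi * Complex.I * ((t * inner ℝ k v : ℝ) : ℂ)) * ((maxwellian d β w : ℂ) *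
      Complex.exp (-(2 * Real.pi * Complex.I * ((t * inner ℝ k w : ℝ) : ℂ)))) =
      (maxwellian d β w : ℂ) * ((k i : ℂ) * (k j : ℂ) * gaussWave ((2 * Real.pi * t) • (v - w)) k) := by
    intro k w
    have e : gaussWave ((2 * Real.pi * t) • (v - w)) k = (Real.exp (-(1 / 2) * ‖k‖ ^ 2) : ℂ) *
        Complex.exp (2 * Real.pi * Complex.I * ((t * inner ℝ k v : ℝ) : ℂ)) *
        Complex.exp (-(2 * Real.pi * Complex.I * ((t * inner ℝ k w : ℝ) : ℂ))) := by
      rw [gaussWave, Complex.ofReal_exp, ← Complex.exp_add, ← Complex.exp_add]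
      congr 1
      rw [inner_smul_left, inner_sub_left, real_inner_comm k v, real_inner_comm k w]
      simp only [RCLike.conj_to_real]
      push_cast
      ring
    rw [e]; ring
  have hint : Integrable (fun p : Vel d × Vel d => (maxwellian d β p.2 : ℂ) *
      ((p.1 i : ℂ) * (p.1 j : ℂ) * gaussWave ((2 * Real.pi * t) • (v - p.2)) p.1))
      (volume.prod volume) := by
    refine ((integrable_pow_mul_gaussian 2 (a := 1 / 2) (by norm_num)).mul_prod
      (integrable_maxwellian (d := d) hβ)).mono' ?_ (ae_of_all _ fun p => ?_)
    · have h1 := continuous_maxwellian (d := d) β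
      have h3 : Continuous fun p : Vel d × Vel d => gaussWave ((2 * Real.pi * t) • (v - p.2)) p.1 := by
        unfold gaussWave; fun_prop
      have h4 : Continuous fun p : Vel d × Vel d => (p.1 i : ℂ) * (p.1 j : ℂ) := by fun_prop
      exact ((Complex.continuous_ofReal.comp (h1.comp continuous_snd)).mul (h4.mul h3)).aestronglyMeasurable
    · rw [norm_mul, norm_mul, norm_gaussWave, Complex.norm_real, Real.norm_eq_abs,
        abs_of_nonneg (maxwellian_nonneg hβ _)]
      have h1 := norm_coord_mul_coord_le p.1 i j
      have h2 := maxwellian_nonneg hβ p.2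
      have h3 := mul_le_mul_of_nonneg_right h1 (Real.exp_nonneg (-(1 / 2) * ‖p.1‖ ^ 2))
      nlinarith
  calc _ = ∫ k : Vel d, ∫ w : Vel d, (maxwellian d β w : ℂ) *
        ((k i : ℂ) * (k j : ℂ) * gaussWave ((2 * Real.pi * t) • (v - w)) k) := by
        refine integral_congr_ae (ae_of_all _ fun k => ?_)
        simp only
        rw [← integral_congr_ae (ae_of_all _ fun w => hg k w), integral_const_mul,
          integral_maxwellian_mul_cexp hβ, landauPhase]
        ring
    _ = _ := by
        rw [integral_integral_swap hint]
        refine integral_congr_ae (ae_of_all _ fun w => ?_)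
        simp only
        rw [integral_const_mul, integral_gaussWave_smul]
        push_cast
        ring

theorem integrable_maxwellian_mul_waveMoment (hd : 2 ≤ d) {β : ℝ} (hβ : 0 < β) (v : Vel d) (i j : Fin d) :
    Integrable (fun p : ℝ × Vel d => maxwellian d β p.2 * waveMoment i j p.1 (v - p.2))
      ((volume.restrict (Ioi 0)).prod volume) := by
  have hpi := Real.pi_pos
  set m : ℝ := (β / (2 * Real.pi)) ^ ((d : ℝ) / 2) with hm
  set c : ℝ := 4 * (2 * Real.pi) ^ ((d : ℝ) / 2) with hc
  have hm0 : 0 ≤ m := by positivity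
  have hc0 : 0 ≤ c := by positivity
  have hM0 : 0 ≤ ∫ w : Vel d, maxwellian d β w := integral_nonneg fun w => maxwellian_nonneg hβ w
  have hcont : Continuous fun p : ℝ × Vel d => maxwellian d β p.2 * waveMoment i j p.1 (v - p.2) := by
    have h1 := continuous_maxwellian (d := d) β
    have h3 : Continuous fun p : ℝ × Vel d => waveMoment i j p.1 (v - p.2) :=
      (continuous_waveMoment i j).comp (continuous_fst.prodMk (continuous_const.sub continuous_snd))
    fun_prop
  have hle : ∀ (t : ℝ) (w : Vel d), ‖maxwellian d β w * waveMoment i j t (v - w)‖ ≤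
      maxwellian d β w * (c * Real.exp (-(Real.pi ^ 2 * t ^ 2) * ‖v - w‖ ^ 2)) := fun t w => by
    rw [norm_mul, Real.norm_eq_abs, abs_of_nonneg (maxwellian_nonneg hβ _)]
    exact mul_le_mul_of_nonneg_left (abs_waveMoment_le i j t _) (maxwellian_nonneg hβ _)
  have hle1 : ∀ (t : ℝ) (w : Vel d), ‖maxwellian d β w * waveMoment i j t (v - w)‖ ≤
      c * maxwellian d β w := fun t w => by
    refine (hle t w).trans ?_
    have : Real.exp (-(Real.pi ^ 2 * t ^ 2) * ‖v - w‖ ^ 2) ≤ 1 := Real.exp_le_one_iff.2 (by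
      have : 0 ≤ Real.pi ^ 2 * t ^ 2 * ‖v - w‖ ^ 2 := by positivity
      linarith)
    have h2 := maxwellian_nonneg hβ w
    have h3 : 0 ≤ c * maxwellian d β w := by positivity
    nlinarith
  have hsec : ∀ t : ℝ, Integrable fun w : Vel d => maxwellian d β w * waveMoment i j t (v - w) := fun t =>
    ((integrable_maxwellian hβ).const_mul c).mono'
      (hcont.comp (Continuous.prodMk_right t)).aestronglyMeasurable (ae_of_all _ fun w => hle1 t w)
  rw [integrable_prod_iff hcont.aestronglyMeasurable]
  refine ⟨ae_of_all _ fun t => hsec t, ?_⟩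
  refine ((integrable_inv_one_add_sq.const_mul
    (2 * c * ((∫ w : Vel d, maxwellian d β w) + m))).integrableOn (s := Ioi 0)).mono'
    hcont.norm.aestronglyMeasurable.integral_prod_right' ?_
  refine (ae_restrict_iff' measurableSet_Ioi).2 (ae_of_all _ fun t ht => ?_)
  have ht : (0 : ℝ) < t := ht
  rw [Real.norm_eq_abs, abs_of_nonneg (integral_nonneg fun w => norm_nonneg _)]
  -- For `t ≤ 1` the mass of `M` suffices. For `1 ≤ t` integration over `w` gains `(t²)^(-d/2) ≤
  -- t⁻²`, which is where `2 ≤ d` is needed.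
  rcases le_total t 1 with h | h
  · have h1 : (∫ w : Vel d, ‖maxwellian d β w * waveMoment i j t (v - w)‖) ≤
        c * ∫ w : Vel d, maxwellian d β w := by
      rw [← integral_const_mul]
      exact integral_mono (hsec t).norm ((integrable_maxwellian hβ).const_mul c) fun w => hle1 t w
    refine h1.trans ?_
    have h2 : (1 : ℝ) ≤ 2 * (1 + t ^ 2)⁻¹ := by
      rw [← div_eq_mul_inv, le_div_iff₀ (by positivity)]
      nlinarith
    have h3 : 0 ≤ c * ∫ w : Vel d, maxwellian d β w := by positivity
    have h4 : 0 ≤ c * m * (1 + t ^ 2)⁻¹ := by positivity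
    nlinarith
  · have hgi : Integrable fun w : Vel d => Real.exp (-(Real.pi ^ 2 * t ^ 2) * ‖v - w‖ ^ 2) :=
      (integrable_rexp_neg_mul_norm_sq (a := Real.pi ^ 2 * t ^ 2) (by positivity)).comp_sub_left v
    have hgv : ∫ w : Vel d, Real.exp (-(Real.pi ^ 2 * t ^ 2) * ‖v - w‖ ^ 2) =
        (Real.pi / (Real.pi ^ 2 * t ^ 2)) ^ ((d : ℝ) / 2) := by
      rw [integral_sub_left_eq_self (fun w : Vel d => Real.exp (-(Real.pi ^ 2 * t ^ 2) * ‖w‖ ^ 2)) volume v,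
        GaussianFourier.integral_rexp_neg_mul_sq_norm (by positivity), finrank_euclideanSpace_fin]
    have h1 : (∫ w : Vel d, ‖maxwellian d β w * waveMoment i j t (v - w)‖) ≤
        m * c * (Real.pi / (Real.pi ^ 2 * t ^ 2)) ^ ((d : ℝ) / 2) := by
      rw [← hgv, ← integral_const_mul]
      refine integral_mono (hsec t).norm (hgi.const_mul _) fun w => (hle t w).trans ?_
      rw [mul_assoc m]
      exact mul_le_mul_of_nonneg_right (maxwellian_le hβ w) (mul_nonneg hc0 (Real.exp_nonneg _))
    have h2 : (Real.pi / (Real.pi ^ 2 * t ^ 2)) ^ ((d : ℝ) / 2) ≤ (t ^ 2)⁻¹ := by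
      have hb1 : Real.pi / (Real.pi ^ 2 * t ^ 2) ≤ (t ^ 2)⁻¹ := by
        rw [← one_div, div_le_div_iff₀ (by positivity) (by positivity)]
        have := Real.pi_gt_three
        have : Real.pi ≤ Real.pi ^ 2 := by nlinarith
        nlinarith [sq_nonneg t]
      calc (Real.pi / (Real.pi ^ 2 * t ^ 2)) ^ ((d : ℝ) / 2) ≤ ((t ^ 2)⁻¹) ^ ((d : ℝ) / 2) :=
            Real.rpow_le_rpow (by positivity) hb1 (by positivity)
        _ ≤ ((t ^ 2)⁻¹) ^ (1 : ℝ) := by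
            refine Real.rpow_le_rpow_of_exponent_ge (by positivity) (inv_le_one_of_one_le₀ (by nlinarith)) ?_
            have : (2 : ℝ) ≤ d := by exact_mod_cast hd
            linarith
        _ = _ := Real.rpow_one _
    have h3 : (t ^ 2)⁻¹ ≤ 2 * (1 + t ^ 2)⁻¹ := by
      rw [← div_eq_mul_inv, inv_eq_one_div, div_le_div_iff₀ (by positivity) (by positivity)]
      nlinarith
    have h4 : 0 ≤ m * c := by positivity
    have h5 := mul_le_mul_of_nonneg_left (h2.trans h3) h4
    have h6 : 0 ≤ c * (∫ w : Vel d, maxwellian d β w) * (1 + t ^ 2)⁻¹ := by positivity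
    nlinarith

theorem integral_gaussian_mul_landauProfile (hd : 2 ≤ d) {β : ℝ} (hβ : 0 < β) (v : Vel d) (i j : Fin d) :
    ∫ k : Vel d, (Real.exp (-(1 / 2) * ‖k‖ ^ 2) : ℂ) * landauProfile β v i j k =
      (((2 * Real.pi) ^ ((d : ℝ) / 2) / (2 * √(2 * Real.pi)) * ∫ w : Vel d, maxwellian d β w *
        (1 / ‖v - w‖ * ((if i = j then 1 else 0) - (v - w) i * (v - w) j / ‖v - w‖ ^ 2)) : ℝ) : ℂ) := by
  have hd0 : 0 < d := by omega
  have hwc : Continuous fun k : Vel d => Real.exp (-(1 / 2) * ‖k‖ ^ 2) := by fun_prop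
  have hw0 : ∀ k : Vel d, 0 ≤ Real.exp (-(1 / 2) * ‖k‖ ^ 2) := fun k => Real.exp_nonneg _
  have h1 := integrable_pow_mul_gaussian (d := d) 1 (a := 1 / 2) (by norm_num)
  have h2 := integrable_pow_mul_gaussian (d := d) 0 (a := 1 / 2) (by norm_num)
  rw [← integral_weight_mul_landauPhase hd0 hβ hwc hw0 h1 h2]
  have hi := integrable_weight_mul_landauPhase hd0 hβ hwc hw0 h1 h2 v i j
  rw [collisionMeasure] at hi ⊢
  rw [integral_prod_symm _ hi]
  have e1 : ∀ t : ℝ, (∫ k : Vel d, (Real.exp (-(1 / 2) * ‖(k, t).1‖ ^ 2) : ℂ) *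
      landauPhase β v i j (k, t)) = ((∫ w : Vel d, maxwellian d β w * waveMoment i j t (v - w) : ℝ) : ℂ) :=
    fun t => by rw [integral_gaussian_mul_landauPhase hβ, integral_complex_ofReal]
  simp only [e1]
  rw [integral_complex_ofReal]
  congr 1
  rw [integral_integral_swap (integrable_maxwellian_mul_waveMoment hd hβ v i j), ← integral_const_mul]
  have : Nonempty (Fin d) := ⟨⟨0, hd0⟩⟩
  have hne : ∀ᵐ w : Vel d, w ≠ v := by
    simp [ae_iff]
  refine integral_congr_ae ?_
  filter_upwards [hne] with w hw
  rw [integral_const_mul, integral_waveMoment i j (sub_ne_zero.2 hw.symm)]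
  ring

/-- Against a radial weight, a profile homogeneous of degree one sees the weight only through its
first moment. The constant of proportionality can therefore be computed with a Gaussian weight,
where every integral is explicit, and then used for `potWeight`. -/
theorem landauTensor_eq_integral (hd : 2 ≤ d) {V : Vel d → ℝ} (hV : ContDiff ℝ ∞ V)
    (hc : HasCompactSupport V) (hrad : ∀ x y : Vel d, ‖x‖ = ‖y‖ → V x = V y) {β : ℝ} (hβ : 0 < β)
    (v : Vel d) (i j : Fin d) :
    (landauTensor β V v i j : ℂ) = ∫ y, ((potWeight V y.1 / (4 * Real.pi ^ 2) : ℝ) : ℂ) *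
      landauPhase β v i j y ∂collisionMeasure d := by
  have hpi := Real.pi_pos
  have hd0 : 0 < d := by omega
  have h1 : Integrable fun k => potWeight V k / (4 * Real.pi ^ 2) * ‖k‖ ^ 1 :=
    ((integrable_potWeight_mul_pow hV hc 1).div_const (4 * Real.pi ^ 2)).congr
      (ae_of_all _ fun k => by ring)
  have h2 : Integrable fun k => potWeight V k / (4 * Real.pi ^ 2) * ‖k‖ ^ 0 :=
    ((integrable_potWeight_mul_pow hV hc 0).div_const (4 * Real.pi ^ 2)).congr
      (ae_of_all _ fun k => by ring)
  rw [integral_weight_mul_landauPhase hd0 hβ ((continuous_potWeight hV hc).div_const _)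
    (fun k => div_nonneg (potWeight_nonneg V k) (by positivity)) h1 h2]
  obtain ⟨A, hA⟩ := exists_integral_radial_mul_eq hd0
    (f := landauProfile β v i j) fun r hr k => landauProfile_smul β v i j hr k
  have hg := hA fun r => (Real.exp (-(1 / 2) * r ^ 2) : ℂ)
  rw [integral_gaussian_mul_landauProfile hd hβ] at hg
  -- The radial weight is written as a function of `‖k‖` by evaluating it along a fixed direction.
  have hp := hA fun r => ((potWeight V (r • basisVec ⟨0, hd0⟩) / (4 * Real.pi ^ 2) : ℝ) : ℂ)
  have hrw : ∀ k : Vel d, potWeight V (‖k‖ • basisVec ⟨0, hd0⟩) = potWeight V k := fun k => by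
    rw [potWeight, potWeight, potHat_eq_of_norm_eq hrad (k := ‖k‖ • basisVec ⟨0, hd0⟩) (l := k)]
    simp [norm_smul]
  simp only [hrw] at hp
  rw [hp]
  set J : ℝ := ∫ w : Vel d, maxwellian d β w *
    (1 / ‖v - w‖ * ((if i = j then 1 else 0) - (v - w) i * (v - w) j / ‖v - w‖ ^ 2)) with hJ
  have hL : landauTensor β V v i j = landauPrefactor V * J := by
    rw [landauTensor, hJ, ← integral_const_mul]
    refine integral_congr_ae (ae_of_all _ fun w => ?_)
    simp only [landauKernel]
    ring
  have hI := integral_gaussian_mul_norm hd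
  have e1 : (∫ k : Vel d, (Real.exp (-(1 / 2) * ‖k‖ ^ 2) : ℂ) * (‖k‖ : ℂ)) =
      ((∫ k : Vel d, Real.exp (-(1 / 2) * ‖k‖ ^ 2) * ‖k‖ : ℝ) : ℂ) := by
    rw [← integral_complex_ofReal]
    simp only [Complex.ofReal_mul]
  have e2 : (∫ k : Vel d, ((potWeight V k / (4 * Real.pi ^ 2) : ℝ) : ℂ) * (‖k‖ : ℂ)) =
      ((2 * (((2 * Real.pi) ^ d)⁻¹ * ∫ k : Vel d, ‖k‖ * Real.pi * ‖potHat V k‖ ^ 2) : ℝ) : ℂ) := by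
    rw [← integral_const_mul, ← integral_const_mul, ← integral_complex_ofReal]
    refine integral_congr_ae (ae_of_all _ fun k => ?_)
    simp only [potWeight]
    rw [← Complex.ofReal_mul]
    congr 1
    field_simp
    ring
  rw [e1] at hg
  rw [e2, hL]
  set G : ℝ := ∫ k : Vel d, Real.exp (-(1 / 2) * ‖k‖ ^ 2) * ‖k‖ with hG
  set W : ℝ := ((2 * Real.pi) ^ d)⁻¹ * ∫ k : Vel d, ‖k‖ * Real.pi * ‖potHat V k‖ ^ 2 with hW
  -- The constant produced by the Gaussian computation is the geometric constant times half the
  -- first moment `G`, so `G` cancels in `A`.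
  have hc0 : (2 * Real.pi) ^ ((d : ℝ) / 2) / (2 * √(2 * Real.pi)) =
      unitBallVolume (d - 1) / (d * unitBallVolume d) * G / 2 := by
    rw [hI, Real.sqrt_eq_rpow, show ((d : ℝ) - 1) / 2 = d / 2 - 1 / 2 by ring,
      Real.rpow_sub (by positivity)]
    field_simp
  have hG0 : G ≠ 0 := fun h => by
    rw [h, mul_zero] at hI
    have : 0 < (2 * Real.pi) ^ (((d : ℝ) - 1) / 2) := by positivity
    linarith
  have hG0' : (G : ℂ) ≠ 0 := by exact_mod_cast hG0
  have hAe : A = ((unitBallVolume (d - 1) / (d * unitBallVolume d) / 2 * J : ℝ) : ℂ) := by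
    refine mul_right_cancel₀ hG0' (hg.symm.trans ?_)
    rw [hc0]
    push_cast
    ring
  rw [hAe, ← Complex.ofReal_mul]
  congr 1
  rw [landauPrefactor, ← hW]
  ring

theorem abs_landauTensor_le (hd : 2 ≤ d) {V : Vel d → ℝ} (hV : ContDiff ℝ ∞ V)
    (hc : HasCompactSupport V) (hrad : ∀ x y : Vel d, ‖x‖ = ‖y‖ → V x = V y) {β : ℝ} (hβ : 0 < β) :
    ∃ C : ℝ, ∀ v i j, |landauTensor β V v i j| ≤ C := by
  have hi := (integrable_collisionBound hd hV hc (a := 2 * Real.pi ^ 2 / β) (by positivity)).div_const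
    (4 * Real.pi ^ 2)
  refine ⟨∫ y, collisionBound V (2 * Real.pi ^ 2 / β) y / (4 * Real.pi ^ 2) ∂collisionMeasure d,
    fun v i j => ?_⟩
  rw [← Real.norm_eq_abs, ← Complex.norm_real, landauTensor_eq_integral hd hV hc hrad hβ]
  refine norm_integral_le_of_norm_le hi ?_
  filter_upwards [ae_collisionMeasure_pos] with y hy
  have hw := potWeight_nonneg V y.1
  rw [norm_mul, Complex.norm_real, Real.norm_eq_abs, abs_of_nonneg (by positivity)]
  have h := norm_landauPhase_le β v i j y
  have h0 : 0 ≤ potWeight V y.1 * (‖y.1‖ ^ 2 * Real.exp (-(2 * Real.pi ^ 2 / β) * (y.2 ^ 2 * ‖y.1‖ ^ 2))) := by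
    positivity
  have h3 := mul_le_mul_of_nonneg_left h hw
  rw [div_mul_eq_mul_div]
  refine div_le_div_of_nonneg_right ?_ (by positivity)
  rw [collisionBound]
  nlinarith

theorem measurable_landauTensor (hd : 2 ≤ d) {V : Vel d → ℝ} (hV : ContDiff ℝ ∞ V)
    (hc : HasCompactSupport V) (hrad : ∀ x y : Vel d, ‖x‖ = ‖y‖ → V x = V y) {β : ℝ} (hβ : 0 < β)
    (i j : Fin d) : Measurable fun v => landauTensor β V v i j := by
  have h : StronglyMeasurable fun v : Vel d => ∫ y, ((potWeight V y.1 / (4 * Real.pi ^ 2) : ℝ) : ℂ) *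
      landauPhase β v i j y ∂collisionMeasure d := by
    refine StronglyMeasurable.integral_prod_right' (ν := collisionMeasure d)
      (f := fun p : Vel d × (Vel d × ℝ) => ((potWeight V p.2.1 / (4 * Real.pi ^ 2) : ℝ) : ℂ) *
        landauPhase β p.1 i j p.2) ?_
    have h1 := continuous_landauPhase (d := d) β i j
    have h2 := continuous_potWeight hV hc
    exact Continuous.stronglyMeasurable (by fun_prop)
  have e : (fun v => landauTensor β V v i j) = fun v : Vel d =>
      (∫ y, ((potWeight V y.1 / (4 * Real.pi ^ 2) : ℝ) : ℂ) * landauPhase β v i j y ∂collisionMeasure d).re := by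
    ext v
    rw [← landauTensor_eq_integral hd hV hc hrad hβ, Complex.ofReal_re]
  rw [e]
  exact Complex.measurable_re.comp h.measurable

/-! ### The Fokker–Planck equation on the Fourier side -/

theorem fourier_transportS_neg (k : Vel d) (ψ : 𝓢(Vel d, ℂ)) (h : HasCompactSupport ψ) (t : ℝ) (v : Vel d) :
    (𝓕 (transportS 0 (-k) ψ h t)) v =
      Complex.exp (2 * Real.pi * Complex.I * ((t * inner ℝ k v : ℝ) : ℂ)) * (𝓕 ψ) v := by
  rw [SchwartzMap.fourier_coe, SchwartzMap.fourier_coe, Real.fourier_eq', Real.fourier_eq',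
    ← integral_sub_right_eq_self _ (t • k), ← integral_const_mul]
  refine integral_congr_ae (ae_of_all _ fun ξ => ?_)
  simp only [transportS_apply, transport, smul_eq_mul]
  rw [show ξ - t • k - t • -k = ξ by rw [smul_neg]; abel, inner_sub_left, inner_smul_left]
  simp only [zero_mul, neg_zero, Real.exp_zero, Complex.ofReal_one, one_mul, RCLike.conj_to_real]
  rw [← mul_assoc, ← Complex.exp_add]
  congr 2
  push_cast
  ring

/-- Modulation by `exp (2πi t k · v)` is translation by `t k` on the Fourier side; this is the
undamped counterpart of `integral_sPlus_inner`. -/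
theorem integral_dirGrad_mul_cexp {u : L2 d} {G : Fin d → L2 d} (hG : IsWeakGradient u G)
    {χ : 𝓢(Vel d, ℂ)} (hχ : HasCompactSupport χ) (k : Vel d) (t : ℝ) :
    ∫ v : Vel d, dirGrad k G v * (Complex.exp (2 * Real.pi * Complex.I * ((t * inner ℝ k v : ℝ) : ℂ)) *
        (∂_{k} (𝓕 χ)) v) =
      4 * Real.pi ^ 2 * ∫ ξ, ((inner ℝ k ξ : ℝ) * (inner ℝ k (ξ - t • k) : ℝ) : ℂ) *
          (𝓕 u : L2 d) (ξ - t • k) * χ ξ := by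
  have h0 := hasCompactSupport_innerMul k hχ
  have e : ∀ v : Vel d, Complex.exp (2 * Real.pi * Complex.I * ((t * inner ℝ k v : ℝ) : ℂ)) *
        (∂_{k} (𝓕 χ)) v = (𝓕 (transportS 0 (-k) (innerMul k χ) h0 t)) v := fun v => by
    rw [fourier_transportS_neg, lineDeriv_fourier_apply, innerMul]
  simp only [e]
  rw [integral_mul_fourier, ← integral_sub_right_eq_self _ (t • k), ← integral_const_mul]
  refine integral_congr_ae ?_
  filter_upwards [(measurePreserving_sub_right volume (t • k)).quasiMeasurePreserving.ae
      (fourier_dirGrad hG k)] with ξ h1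
  rw [h1, transportS_apply, transport, innerMul_apply,
      show ξ - t • k - t • -k = ξ by rw [smul_neg]; abel]
  simp only [zero_mul, neg_zero, Real.exp_zero, Complex.ofReal_one, one_mul]
  have hI := Complex.I_sq
  linear_combination (-4 * Real.pi ^ 2 * (inner ℝ k ξ : ℝ) * (inner ℝ k (ξ - t • k) : ℝ) *
      (𝓕 u : L2 d) (ξ - t • k) * χ ξ) * hI

theorem integrable_mul_lineDeriv_fourier (a : L2 d) (χ : 𝓢(Vel d, ℂ)) (m : Vel d) :
    Integrable fun v => a v * (∂_{m} χ) v := by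
  refine (integrable_mul a ((∂_{m} χ).toLp 2 volume)).congr ?_
  filter_upwards [(∂_{m} χ).coeFn_toLp 2 (volume : Measure (Vel d))] with v hv
  rw [hv]

/-- The collision term of the Fokker-Planck equation as a bilinear form on the Fourier side. -/
theorem sum_integral_landauTensor (hd : 2 ≤ d) {V : Vel d → ℝ} (hV : ContDiff ℝ ∞ V)
    (hc : HasCompactSupport V) (hrad : ∀ x y : Vel d, ‖x‖ = ‖y‖ → V x = V y) {β : ℝ} (hβ : 0 < β)
    {u : L2 d} {G : Fin d → L2 d} (hG : IsWeakGradient u G)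
    {χ : 𝓢(Vel d, ℂ)} (hχ : HasCompactSupport χ) :
    ∑ i : Fin d, ∑ j : Fin d, ∫ v : Vel d, (landauTensor β V v i j : ℂ) *
        (G j v * (∂_{basisVec i} (𝓕 χ)) v) =
      form V β 0 0 (𝓕 u : L2 d) χ := by
  have hpi := Real.pi_pos
  have hd0 : 0 < d := by omega
  have h1 : Integrable fun k => potWeight V k / (4 * Real.pi ^ 2) * ‖k‖ ^ 1 :=
    ((integrable_potWeight_mul_pow hV hc 1).div_const (4 * Real.pi ^ 2)).congr
      (ae_of_all _ fun k => by ring)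
  have h2 : Integrable fun k => potWeight V k / (4 * Real.pi ^ 2) * ‖k‖ ^ 0 :=
    ((integrable_potWeight_mul_pow hV hc 0).div_const (4 * Real.pi ^ 2)).congr
      (ae_of_all _ fun k => by ring)
  have hwc := (continuous_potWeight hV hc).div_const (4 * Real.pi ^ 2)
  have hw0 : ∀ k, 0 ≤ potWeight V k / (4 * Real.pi ^ 2) := fun k =>
    div_nonneg (potWeight_nonneg V k) (by positivity)
  have hbound := integrable_gaussian_weight hd0 hwc hw0 h1 h2
    (a := 2 * Real.pi ^ 2 / β) (by positivity)
  set w : Vel d → ℝ := fun k => potWeight V k / (4 * Real.pi ^ 2) with hw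
  have hF : ∀ i j : Fin d, Integrable (fun p : Vel d × (Vel d × ℝ) =>
      ((w p.2.1 : ℂ) * landauPhase β p.1 i j p.2) * (G j p.1 * (∂_{basisVec i} (𝓕 χ)) p.1))
      (volume.prod (collisionMeasure d)) := fun i j => by
    refine ((integrable_mul_lineDeriv_fourier (G j) (𝓕 χ) (basisVec i)).norm.mul_prod hbound).mono' ?_ ?_
    · have m1 := (continuous_landauPhase (d := d) β i j).measurable
      have m2 : Measurable fun p : Vel d × (Vel d × ℝ) => (w p.2.1 : ℂ) :=
        (Complex.continuous_ofReal.comp (hwc.comp (continuous_fst.comp continuous_snd))).measurable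
      have m3 : Measurable fun p : Vel d × (Vel d × ℝ) => G j p.1 := (L2.measurable (G j)).comp measurable_fst
      have m4 : Measurable fun p : Vel d × (Vel d × ℝ) => (∂_{basisVec i} (𝓕 χ)) p.1 :=
        (∂_{basisVec i} (𝓕 χ)).continuous.measurable.comp measurable_fst
      exact ((m2.mul m1).mul (m3.mul m4)).aestronglyMeasurable
    · have hpos : ∀ᵐ p : Vel d × (Vel d × ℝ) ∂(volume.prod (collisionMeasure d)), 0 < p.2.2 :=
        Measure.quasiMeasurePreserving_snd.ae ae_collisionMeasure_pos
      filter_upwards [hpos] with p hp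
      rw [norm_mul, norm_mul (w p.2.1 : ℂ), mul_comm, Complex.norm_real, Real.norm_eq_abs, abs_of_nonneg (hw0 _)]
      refine mul_le_mul_of_nonneg_left ?_ (norm_nonneg _)
      have h := norm_landauPhase_le β p.1 i j p.2
      have h0 : 0 ≤ w p.2.1 * ‖p.2.1‖ ^ 2 * Real.exp (-(2 * Real.pi ^ 2 / β) * (p.2.2 ^ 2 * ‖p.2.1‖ ^ 2)) :=
        mul_nonneg (mul_nonneg (hw0 _) (by positivity)) (Real.exp_nonneg _)
      have h3 := mul_le_mul_of_nonneg_left h (hw0 p.2.1)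
      simp only [hw] at h0 h3 ⊢
      nlinarith
  have hsec : ∀ (y : Vel d × ℝ) (i j : Fin d), Integrable fun v : Vel d =>
      ((w y.1 : ℂ) * landauPhase β v i j y) * (G j v * (∂_{basisVec i} (𝓕 χ)) v) := fun y i j => by
    refine (integrable_mul_lineDeriv_fourier (G j) (𝓕 χ) (basisVec i)).bdd_mul
      (c := w y.1 * (‖y.1‖ ^ 2 * Real.exp (-(2 * Real.pi ^ 2 / β) * (y.2 ^ 2 * ‖y.1‖ ^ 2)))) ?_
      (ae_of_all _ fun v => ?_)
    · exact (continuous_const.mul ((continuous_landauPhase (d := d) β i j).comp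
        (Continuous.prodMk_left y))).aestronglyMeasurable
    · rw [norm_mul, Complex.norm_real, Real.norm_eq_abs, abs_of_nonneg (hw0 _)]
      exact mul_le_mul_of_nonneg_left (norm_landauPhase_le β v i j y) (hw0 _)
  have step : ∀ i j : Fin d, ∫ v : Vel d, (landauTensor β V v i j : ℂ) *
        (G j v * (∂_{basisVec i} (𝓕 χ)) v) =
      ∫ y, (∫ v : Vel d, ((w y.1 : ℂ) * landauPhase β v i j y) *
        (G j v * (∂_{basisVec i} (𝓕 χ)) v)) ∂collisionMeasure d := fun i j => by
    rw [← integral_integral_swap (hF i j)]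
    refine integral_congr_ae (ae_of_all _ fun v => ?_)
    simp only
    rw [integral_mul_const, landauTensor_eq_integral hd hV hc hrad hβ]
  have hint : ∀ i j : Fin d, Integrable (fun y => ∫ v : Vel d, ((w y.1 : ℂ) * landauPhase β v i j y) *
        (G j v * (∂_{basisVec i} (𝓕 χ)) v)) (collisionMeasure d) := fun i j => (hF i j).integral_prod_right
  have hU := formDomain_fourier hG
  have hX := formDomain_of_compact χ.continuous hχ
  have hform := (form_bound hd hV hc hβ (z := 0) (by simp) (s := 0) le_rfl hU.meas hU.memLp_norm hX.meas
    hX.memLp_norm).1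
  rw [form, integral_prod _ hform]
  simp only [step]
  have e1 : (∑ i : Fin d, ∑ j : Fin d, ∫ y, (∫ v : Vel d, ((w y.1 : ℂ) * landauPhase β v i j y) *
        (G j v * (∂_{basisVec i} (𝓕 χ)) v)) ∂collisionMeasure d) =
      ∫ y, (∑ i : Fin d, ∑ j : Fin d, ∫ v : Vel d, ((w y.1 : ℂ) * landauPhase β v i j y) *
        (G j v * (∂_{basisVec i} (𝓕 χ)) v)) ∂collisionMeasure d := by
    rw [integral_finsetSum _ fun i _ => integrable_finsetSum _ fun j _ => hint i j]
    refine Finset.sum_congr rfl fun i _ => ?_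
    rw [integral_finsetSum _ fun j _ => hint i j]
  rw [e1]
  refine integral_congr_ae (ae_of_all _ fun y => ?_)
  simp only
  have e2 : (∑ i : Fin d, ∑ j : Fin d, ∫ v : Vel d, ((w y.1 : ℂ) * landauPhase β v i j y) *
        (G j v * (∂_{basisVec i} (𝓕 χ)) v)) =
      ∫ v : Vel d, ∑ i : Fin d, ∑ j : Fin d, ((w y.1 : ℂ) * landauPhase β v i j y) *
        (G j v * (∂_{basisVec i} (𝓕 χ)) v) := by
    rw [integral_finsetSum _ fun i _ => integrable_finsetSum _ fun j _ => hsec y i j]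
    refine Finset.sum_congr rfl fun i _ => ?_
    rw [integral_finsetSum _ fun j _ => hsec y i j]
  have e3 : (∫ v : Vel d, ∑ i : Fin d, ∑ j : Fin d, ((w y.1 : ℂ) * landauPhase β v i j y) *
        (G j v * (∂_{basisVec i} (𝓕 χ)) v)) =
      ∫ v : Vel d, ((w y.1 : ℂ) * (Real.exp (-(2 * Real.pi ^ 2 / β) * (y.2 ^ 2 * ‖y.1‖ ^ 2)) : ℂ)) *
        (dirGrad y.1 G v * (Complex.exp (2 * Real.pi * Complex.I * ((y.2 * inner ℝ y.1 v : ℝ) : ℂ)) *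
        (∂_{y.1} (𝓕 χ)) v)) := by
    refine integral_congr_ae ?_
    filter_upwards [coeFn_sum_smul y.1 G] with v hv
    rw [hv, ← sum_lineDeriv, Finset.mul_sum, Finset.mul_sum, Finset.mul_sum]
    refine Finset.sum_congr rfl fun i _ => ?_
    rw [Finset.sum_mul, Finset.mul_sum]
    refine Finset.sum_congr rfl fun j _ => ?_
    rw [landauPhase]
    ring
  rw [e2, e3, integral_const_mul, integral_dirGrad_mul_cexp hG hχ, ← mul_assoc, ← integral_const_mul]
  refine integral_congr_ae (ae_of_all _ fun ξ => ?_)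
  -- The Gaussian in `landauPhase` is the undamped overlap `mcorr_zero`, and the `4π²` of the
  -- derivatives cancels the normalisation of `w`.
  simp only [formIntegrand, kernel, hw, damp, shift, mcorr_zero hβ, zero_mul, mul_zero, neg_zero, Real.exp_zero,
    Complex.exp_zero, Complex.ofReal_one, one_mul, mul_one]
  have : (Real.pi : ℂ) ≠ 0 := by exact_mod_cast hpi.ne'
  push_cast
  field_simp

/-- The Laplace transform of a primitive. -/
theorem laplace_primitive {w : ℂ} (hw : 0 < w.re) {b : ℝ → ℂ}
    (hb : IntegrableOn (fun s : ℝ => Complex.exp (-(w * s)) * b s) (Ioi 0)) :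
    IntegrableOn (fun τ : ℝ => Complex.exp (-(w * τ)) * ∫ s in (0 : ℝ)..τ, b s) (Ioi 0) ∧
      w * (∫ τ in Ioi (0 : ℝ), Complex.exp (-(w * τ)) * ∫ s in (0 : ℝ)..τ, b s) =
        ∫ s in Ioi (0 : ℝ), Complex.exp (-(w * s)) * b s := by
  have hw' : (-w).re < 0 := by simpa using hw
  have hw0 : w ≠ 0 := fun h => by simp [h] at hw
  set μ : Measure ℝ := volume.restrict (Ioi 0) with hμ
  have hexp : ∀ τ : ℝ, ‖Complex.exp (-(w * τ))‖ = Real.exp (-w.re * τ) := fun τ => by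
    rw [Complex.norm_exp]; simp
  have hbm : AEStronglyMeasurable b μ := by
    have h1 : Continuous fun s : ℝ => Complex.exp (w * s) := by fun_prop
    refine (h1.aestronglyMeasurable.mul hb.aestronglyMeasurable).congr (ae_of_all _ fun s => ?_)
    simp only [Pi.mul_apply]
    rw [← mul_assoc, ← Complex.exp_add, add_neg_cancel, Complex.exp_zero, one_mul]
  -- Fubini on the triangle `s ≤ τ`: integrating first in `s` gives the primitive, first in `τ` the
  -- factor `w⁻¹`.
  set F : ℝ × ℝ → ℂ := {p : ℝ × ℝ | p.1 ≤ p.2}.indicator fun p => Complex.exp (-(w * p.2)) * b p.1 with hF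
  have hS : MeasurableSet {p : ℝ × ℝ | p.1 ≤ p.2} := measurableSet_le measurable_fst measurable_snd
  have hFm : AEStronglyMeasurable F (μ.prod μ) := by
    have h1 : Continuous fun p : ℝ × ℝ => Complex.exp (-(w * p.2)) := by fun_prop
    exact (h1.aestronglyMeasurable.mul hbm.comp_fst).indicator hS
  have hsec : ∀ s τ : ℝ, F (s, τ) = (Ici s).indicator (fun τ : ℝ => Complex.exp (-(w * τ))) τ * b s := by
    intro s τ
    by_cases h : s ≤ τ
    · rw [hF, indicator_of_mem (show (s, τ) ∈ {p : ℝ × ℝ | p.1 ≤ p.2} from h),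
        indicator_of_mem (show τ ∈ Ici s from h)]
    · rw [hF, indicator_of_notMem (show (s, τ) ∉ {p : ℝ × ℝ | p.1 ≤ p.2} from h),
        indicator_of_notMem (show τ ∉ Ici s from h), zero_mul]
  have hIci : ∀ s : ℝ, 0 < s → Ici s ∩ Ioi 0 = Ici s := fun s hs =>
    inter_eq_left.2 fun x hx => lt_of_lt_of_le hs hx
  have hint : Integrable F (μ.prod μ) := by
    rw [integrable_prod_iff hFm]
    refine ⟨ae_of_all _ fun s => ?_, ?_⟩
    · simp only [hsec]
      refine Integrable.mul_const ?_ _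
      have h1 := integrableOn_exp_mul_complex_Ioi hw' 0
      simp only [neg_mul] at h1
      exact h1.indicator measurableSet_Ici
    · refine (hb.norm.const_mul w.re⁻¹).congr ?_
      filter_upwards [ae_restrict_mem measurableSet_Ioi] with s hs
      simp only [hsec, norm_mul, hexp]
      rw [integral_mul_const]
      have e : ∀ τ : ℝ, ‖(Ici s).indicator (fun τ : ℝ => Complex.exp (-(w * τ))) τ‖ =
          (Ici s).indicator (fun τ : ℝ => Real.exp (-w.re * τ)) τ := fun τ => by
        rw [norm_indicator_eq_indicator_norm]
        simp only [hexp]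
      simp only [e]
      rw [integral_indicator measurableSet_Ici, hμ, Measure.restrict_restrict measurableSet_Ici, hIci s hs,
        integral_Ici_eq_integral_Ioi, integral_exp_mul_Ioi (by linarith)]
      field_simp
  have hin : ∀ τ : ℝ, 0 < τ → ∫ s, F (s, τ) ∂μ = Complex.exp (-(w * τ)) * ∫ s in (0 : ℝ)..τ, b s := by
    intro τ hτ
    have e : ∀ s : ℝ, F (s, τ) = (Iic τ).indicator (fun s => Complex.exp (-(w * τ)) * b s) s := by
      intro s
      rw [hsec]
      by_cases h : s ≤ τ
      · rw [indicator_of_mem (show τ ∈ Ici s from h), indicator_of_mem (show s ∈ Iic τ from h)]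
      · rw [indicator_of_notMem (show τ ∉ Ici s from h), indicator_of_notMem (show s ∉ Iic τ from h), zero_mul]
    simp only [e]
    rw [integral_indicator measurableSet_Iic, hμ, Measure.restrict_restrict measurableSet_Iic,
      inter_comm, Ioi_inter_Iic, intervalIntegral.integral_of_le hτ.le, integral_const_mul]
  have hout : ∀ s : ℝ, 0 < s → ∫ τ, F (s, τ) ∂μ = w⁻¹ * (Complex.exp (-(w * s)) * b s) := by
    intro s hs
    simp only [hsec]
    have h1 := integral_exp_mul_complex_Ioi hw' s
    simp only [neg_mul] at h1
    rw [integral_mul_const, integral_indicator measurableSet_Ici, hμ, Measure.restrict_restrict measurableSet_Ici,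
      hIci s hs, integral_Ici_eq_integral_Ioi, h1]
    field_simp
  refine ⟨hint.integral_prod_right.congr ?_, ?_⟩
  · filter_upwards [ae_restrict_mem measurableSet_Ioi] with τ hτ using hin τ hτ
  · have h1 : (∫ τ in Ioi (0 : ℝ), Complex.exp (-(w * τ)) * ∫ s in (0 : ℝ)..τ, b s) =
        ∫ s, ∫ τ, F (s, τ) ∂μ ∂μ := by
      rw [integral_integral_swap (f := fun s τ => F (s, τ)) hint]
      exact setIntegral_congr_fun measurableSet_Ioi fun τ hτ => (hin τ hτ).symm
    rw [h1, setIntegral_congr_fun measurableSet_Ioi fun s hs => hout s hs, integral_const_mul, ← mul_assoc,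
      mul_inv_cancel₀ hw0, one_mul]

theorem LaplaceTransformable.integrable {g : ℝ → L2 d} (hg : LaplaceTransformable g) (α : ℝ) :
    IntegrableOn (fun τ : ℝ => Complex.exp (-((1 + Complex.I * (α : ℂ)) * (τ : ℂ))) • g τ) (Ioi 0) := by
  have h1 : Continuous fun τ : ℝ => Complex.exp (-(Complex.I * (α : ℂ) * (τ : ℂ))) := by fun_prop
  have h2 := Integrable.bdd_smul (φ := fun τ : ℝ => Complex.exp (-(Complex.I * (α : ℂ) * (τ : ℂ))))
    (f := fun τ : ℝ => Real.exp (-τ) • g τ) hg 1 h1.aestronglyMeasurable (ae_of_all _ fun τ => by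
      rw [Complex.norm_exp]; simp)
  refine h2.congr (ae_of_all _ fun τ => ?_)
  simp only [Pi.smul_apply']
  rw [show Real.exp (-τ) • g τ = (Real.exp (-τ) : ℂ) • g τ from (Complex.coe_smul _ _).symm, smul_smul,
    Complex.ofReal_exp, ← Complex.exp_add]
  congr 2
  push_cast
  ring

theorem LaplaceTransformable.pairing_laplace {g : ℝ → L2 d} (hg : LaplaceTransformable g) (α : ℝ) (a : L2 d) :
    IntegrableOn (fun τ : ℝ => Complex.exp (-((1 + Complex.I * (α : ℂ)) * (τ : ℂ))) * pairing a (g τ))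
        (Ioi 0) ∧
      pairing a (laplace g α) =
        ∫ τ in Ioi (0 : ℝ), Complex.exp (-((1 + Complex.I * (α : ℂ)) * (τ : ℂ))) * pairing a (g τ) := by
  have h := hg.integrable α
  have h1 := (pairing a).integrable_comp h
  simp only [map_smul, smul_eq_mul] at h1
  refine ⟨h1, ?_⟩
  rw [laplace, ← (pairing a).integral_comp_comm h]
  simp only [map_smul, smul_eq_mul]

theorem pairing_schwartz (f : 𝓢(Vel d, ℂ)) (a : L2 d) :
    pairing (f.toLp 2 volume) a = ∫ x, a x * f x := by
  rw [← pairing_toLp, pairing_apply, pairing_apply]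
  simp only [mul_comm]

/-- Bounded functionals commute with Bochner integrals, so in this form the weak gradient passes
through the Laplace transform. -/
theorem isWeakGradient_iff {u : L2 d} {G : Fin d → L2 d} : IsWeakGradient u G ↔
    ∀ j (φ : 𝓢(Vel d, ℂ)), pairing ((∂_{basisVec j} φ).toLp 2 volume) u = -pairing (φ.toLp 2 volume) (G j) := by
  simp only [pairing_schwartz]
  constructor
  · intro h j φ
    have h1 := congrArg (fun T : 𝓢'(Vel d, ℂ) => T φ) (h j)
    simp only [TemperedDistribution.lineDerivOp_apply_apply, Lp.toTemperedDistribution_apply,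
      smul_eq_mul] at h1
    rw [show (∫ x, G j x * φ x) = ∫ x, φ x * G j x by simp only [mul_comm], ← h1, ← integral_neg]
    congr 1; ext v; simp [mul_comm]
  · intro h j
    ext φ
    simp only [TemperedDistribution.lineDerivOp_apply_apply, Lp.toTemperedDistribution_apply, smul_eq_mul]
    have h1 := h j φ
    rw [show (∫ x, φ x * G j x) = ∫ x, G j x * φ x by simp only [mul_comm], ← neg_eq_iff_eq_neg.2 h1, ← integral_neg]
    congr 1; ext v; simp [mul_comm]

theorem isWeakGradient_laplace {g : ℝ → L2 d} (hg : LaplaceTransformable g) {G : ℝ → Fin d → L2 d}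
    (hG : ∀ j, LaplaceTransformable fun τ => G τ j)
    (h : ∀ᵐ τ ∂(volume.restrict (Ioi (0 : ℝ))), IsWeakGradient (g τ) (G τ)) (α : ℝ) :
    IsWeakGradient (laplace g α) fun j => laplace (fun τ => G τ j) α := by
  rw [isWeakGradient_iff]
  intro j φ
  rw [(hg.pairing_laplace α _).2, ((hG j).pairing_laplace α _).2, ← integral_neg]
  refine integral_congr_ae ?_
  filter_upwards [h] with τ hτ
  rw [isWeakGradient_iff.1 hτ j φ, mul_neg]

/-- The time-integrated weak formulation is Laplace transformed: the primitive contributes `w⁻¹` by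
`laplace_primitive`, and the datum, constant in time, also contributes `w⁻¹`. The Landau tensor then
becomes the form at `z = 0`, `s = 0`. -/
theorem IsFokkerPlanckSolution.fourierSolution (hd : 2 ≤ d) {V : Vel d → ℝ} (hV : ContDiff ℝ ∞ V)
    (hc : HasCompactSupport V) (hrad : ∀ x y : Vel d, ‖x‖ = ‖y‖ → V x = V y) {β : ℝ} (hβ : 0 < β)
    {κ : ℝ} {𝔤 : L2 d} {g : ℝ → L2 d}
    (h : IsFokkerPlanckSolution κ (landauTensor β V) 𝔤 g) (α : ℝ) :
    FourierSolution V β κ α 0 0 (𝓕 𝔤 : L2 d) (𝓕 (laplace g α) : L2 d) := by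
  obtain ⟨-, -, hg, G, hG, hgrad, heq⟩ := h
  have hW := isWeakGradient_laplace hg hG hgrad α
  refine fourierSolution_of_test hd hV hc hβ (by simp) le_rfl (Lp.memLp _)
    (formDomain_fourier hW) fun χ hχ => ?_
  obtain ⟨CA, hCA⟩ := abs_landauTensor_le hd hV hc hrad hβ
  set w : ℂ := 1 + Complex.I * (α : ℂ) with hwdef
  have hw : 0 < w.re := by simp [hwdef]
  have hw0 : w ≠ 0 := fun h => by simp [h] at hw
  set φ : 𝓢(Vel d, ℂ) := 𝓕 χ with hφ
  -- Boundedness of the tensor makes the coefficient times the test gradient an `L²` function, so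
  -- the flux term is a bounded functional of `∇g` and commutes with the time integral.
  have hm : ∀ i j : Fin d, MemLp (fun v => (((if i = j then κ else 0) + landauTensor β V v i j : ℝ) : ℂ) *
      (∂_{basisVec i} φ) v) 2 volume := fun i j => by
    refine ((∂_{basisVec i} φ).memLp 2 volume).of_le_mul (c := |κ| + CA) ?_ (ae_of_all _ fun v => ?_)
    · exact ((Complex.measurable_ofReal.comp ((measurable_landauTensor hd hV hc hrad hβ i j).const_add _)).mul
        (∂_{basisVec i} φ).continuous.measurable).aestronglyMeasurable
    · rw [norm_mul, Complex.norm_real, Real.norm_eq_abs]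
      refine mul_le_mul_of_nonneg_right ((abs_add_le _ _).trans (add_le_add ?_ (hCA v i j))) (norm_nonneg _)
      split_ifs
      · exact le_rfl
      · simp
  have hpair : ∀ (i j : Fin d) (a : L2 d), pairing (hm i j).toLp a = ∫ v : Vel d,
      (((if i = j then κ else 0) + landauTensor β V v i j : ℝ) : ℂ) * a v * (∂_{basisVec i} φ) v := by
    intro i j a
    rw [pairing_apply]
    refine integral_congr_ae ?_
    filter_upwards [(hm i j).coeFn_toLp] with v hv
    rw [hv]; ring
  have hpint : ∀ (i j : Fin d) (a : L2 d), Integrable fun v : Vel d =>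
      (((if i = j then κ else 0) + landauTensor β V v i j : ℝ) : ℂ) * a v * (∂_{basisVec i} φ) v := by
    intro i j a
    refine (integrable_mul (hm i j).toLp a).congr ?_
    filter_upwards [(hm i j).coeFn_toLp] with v hv
    rw [hv]; ring
  have hb : ∀ a : Fin d → L2 d, (∫ v : Vel d, ∑ i : Fin d, ∑ j : Fin d,
      (((if i = j then κ else 0) + landauTensor β V v i j : ℝ) : ℂ) * a j v * (∂_{basisVec i} φ) v) =
      ∑ i : Fin d, ∑ j : Fin d, pairing (hm i j).toLp (a j) := by
    intro a
    rw [integral_finsetSum _ fun i _ => integrable_finsetSum _ fun j _ => hpint i j (a j)]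
    refine Finset.sum_congr rfl fun i _ => ?_
    rw [integral_finsetSum _ fun j _ => hpint i j (a j)]
    exact Finset.sum_congr rfl fun j _ => (hpair i j (a j)).symm
  set b : ℝ → ℂ := fun s => ∑ i : Fin d, ∑ j : Fin d, pairing (hm i j).toLp (G s j) with hbdef
  have e1 : ∀ s : ℝ, Complex.exp (-(w * s)) * b s = ∑ i : Fin d, ∑ j : Fin d,
      Complex.exp (-(w * s)) * pairing (hm i j).toLp (G s j) := fun s => by
    simp only [hbdef, Finset.mul_sum]
  have hij := fun i j : Fin d => (hG j).pairing_laplace α (hm i j).toLp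
  have hbi : IntegrableOn (fun s : ℝ => Complex.exp (-(w * s)) * b s) (Ioi 0) := by
    simp only [e1]
    exact integrable_finsetSum _ fun i _ => integrable_finsetSum _ fun j _ => (hij i j).1
  have hbint : ∫ s in Ioi (0 : ℝ), Complex.exp (-(w * s)) * b s =
      ∑ i : Fin d, ∑ j : Fin d, pairing (hm i j).toLp (laplace (fun τ => G τ j) α) := by
    simp only [e1]
    rw [integral_finsetSum _ fun i _ => integrable_finsetSum _ fun j _ => (hij i j).1]
    refine Finset.sum_congr rfl fun i _ => ?_
    rw [integral_finsetSum _ fun j _ => (hij i j).1]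
    exact Finset.sum_congr rfl fun j _ => (hij i j).2.symm
  obtain ⟨hP1, hP2⟩ := laplace_primitive hw hbi
  have hlap : w * (∫ v : Vel d, laplace g α v * φ v) =
      (∫ v : Vel d, 𝔤 v * φ v) - ∑ i : Fin d, ∑ j : Fin d,
        pairing (hm i j).toLp (laplace (fun τ => G τ j) α) := by
    rw [← pairing_schwartz, (hg.pairing_laplace α _).2, ← hbint, ← hP2]
    have e2 : ∫ τ in Ioi (0 : ℝ), Complex.exp (-(w * τ)) * pairing (φ.toLp 2 volume) (g τ) =
        ∫ τ in Ioi (0 : ℝ), (Complex.exp (-(w * τ)) * (∫ v : Vel d, 𝔤 v * φ v) -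
          Complex.exp (-(w * τ)) * ∫ s in (0 : ℝ)..τ, b s) := by
      refine setIntegral_congr_fun measurableSet_Ioi fun τ hτ => ?_
      have h1 := heq φ τ (le_of_lt hτ)
      simp only [hb] at h1
      rw [pairing_schwartz, h1, mul_sub]
    have hei := integrableOn_exp_mul_complex_Ioi (a := -w) (by simpa using hw) 0
    have hev := integral_exp_mul_complex_Ioi (a := -w) (by simpa using hw) 0
    simp only [neg_mul] at hei hev
    rw [e2, integral_sub (hei.mul_const _) hP1, integral_mul_const, hev, mul_sub]
    simp only [Complex.ofReal_zero, mul_zero, neg_zero, Complex.exp_zero]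
    field_simp
  rw [integral_symbol_mul_eq hW κ α hχ, ← sum_integral_landauTensor hd hV hc hrad hβ hW hχ, ← integral_mul_fourier 𝔤,
    ← hφ, ← hwdef, hlap]
  have hA : ∀ i j : Fin d, Integrable fun v : Vel d => (landauTensor β V v i j : ℂ) *
      (laplace (fun τ => G τ j) α v * (∂_{basisVec i} φ) v) := fun i j => by
    refine (integrable_mul_lineDeriv_fourier (laplace (fun τ => G τ j) α) φ (basisVec i)).bdd_mul (c := CA)
      (Complex.measurable_ofReal.comp (measurable_landauTensor hd hV hc hrad hβ i j)).aestronglyMeasurable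
      (ae_of_all _ fun v => ?_)
    rw [Complex.norm_real, Real.norm_eq_abs]
    exact hCA v i j
  have hsplit : ∀ i j : Fin d, pairing (hm i j).toLp (laplace (fun τ => G τ j) α) =
      (if i = j then (κ : ℂ) else 0) * (∫ v : Vel d, laplace (fun τ => G τ j) α v * (∂_{basisVec i} φ) v) +
      ∫ v : Vel d, (landauTensor β V v i j : ℂ) *
        (laplace (fun τ => G τ j) α v * (∂_{basisVec i} φ) v) := fun i j => by
    rw [hpair, ← integral_const_mul, ← integral_add
      ((integrable_mul_lineDeriv_fourier _ φ (basisVec i)).const_mul _) (hA i j)]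
    refine integral_congr_ae (ae_of_all _ fun v => ?_)
    simp only
    split_ifs <;> push_cast <;> ring
  simp only [hsplit, Finset.sum_add_distrib, ite_mul, zero_mul, Finset.sum_ite_eq, Finset.mem_univ, if_true,
    ← Finset.mul_sum]
  ring

/-! ### Integration over the Laplace frequency -/

theorem eLpNorm_two_sq {X E : Type*} [MeasurableSpace X] [NormedAddCommGroup E] {μ : Measure X} (f : X → E) :
    eLpNorm f 2 μ ^ 2 = ∫⁻ x, ENNReal.ofReal (‖f x‖ ^ 2) ∂μ := by
  have h := eLpNorm_nnreal_pow_eq_lintegral (f := f) (μ := μ) (p := 2) (by norm_num)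
  have e : (((2 : NNReal) : ℝ)) = ((2 : ℕ) : ℝ) := by norm_num
  rw [e] at h
  simp only [ENNReal.rpow_natCast] at h
  refine Eq.trans (by norm_cast) (h.trans (lintegral_congr fun x => ?_))
  rw [ENNReal.ofReal_pow (norm_nonneg _), ofReal_norm]

theorem lintegral_inv_sq_add_sq {a : ℝ} (ha : 0 < a) :
    ∫⁻ x : ℝ, ENNReal.ofReal ((a ^ 2 + x ^ 2)⁻¹) = ENNReal.ofReal (Real.pi / a) := by
  have e : ∀ x : ℝ, (a ^ 2 + x ^ 2)⁻¹ = (a ^ 2)⁻¹ * (1 + (x / a) ^ 2)⁻¹ := fun x => by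
    rw [← mul_inv]
    congr 1
    field_simp
  have hi : Integrable fun x : ℝ => (1 + (x / a) ^ 2)⁻¹ := integrable_inv_one_add_sq.comp_div ha.ne'
  simp only [e]
  rw [← ofReal_integral_eq_lintegral_ofReal (hi.const_mul _) (ae_of_all _ fun x => by positivity),
    integral_const_mul, Measure.integral_comp_div (fun x : ℝ => (1 + x ^ 2)⁻¹) a,
    integral_univ_inv_one_add_sq, abs_of_pos ha, smul_eq_mul]
  congr 1
  field_simp

theorem norm_symbol_sq (κ α : ℝ) (ξ : Vel d) :
    ‖symbol κ α ξ‖ ^ 2 = (1 + 4 * Real.pi ^ 2 * κ * ‖ξ‖ ^ 2) ^ 2 + α ^ 2 := by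
  rw [← Complex.normSq_eq_norm_sq, Complex.normSq_apply, symbol_re, symbol_im]
  ring

/-- With `a = 1 + 4π²κ ‖ξ‖²`, integrating `(a² + α²)⁻¹` over `α` gives `π / a`, and `π κ ‖ξ‖² ≤ a`.
This absorbs both the derivative in the Dirichlet norm and the factor `κ`, uniformly in `κ`. -/
theorem lintegral_dirichlet_div_symbol {g : Vel d → ℂ} (hg : Measurable g) (hg2 : MemLp g 2 volume) {κ : ℝ}
    (hκ : 0 < κ) :
    ∫⁻ α : ℝ, ENNReal.ofReal (κ * dirichlet (fun ξ => g ξ / symbol κ α ξ) ^ 2) ≤ eLpNorm g 2 volume ^ 2 := by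
  have hpi := Real.pi_pos
  have e1 : ∀ α : ℝ, ENNReal.ofReal (κ * dirichlet (fun ξ => g ξ / symbol κ α ξ) ^ 2) =
      ∫⁻ ξ : Vel d, ENNReal.ofReal (κ * (‖ξ‖ * ‖g ξ‖) ^ 2) *
        ENNReal.ofReal (((1 + 4 * Real.pi ^ 2 * κ * ‖ξ‖ ^ 2) ^ 2 + α ^ 2)⁻¹) := fun α => by
    rw [dirichlet, l2n_sq, ← integral_const_mul,
      ofReal_integral_eq_lintegral_ofReal
        ((formDomain_div_symbol hg hg2 hκ α).memLp_norm.integrable_sq.const_mul κ)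
        (ae_of_all _ fun ξ => by positivity)]
    refine lintegral_congr fun ξ => ?_
    rw [← ENNReal.ofReal_mul (by positivity), norm_div, ← norm_symbol_sq, ← mul_div_assoc, div_pow]
    congr 1
    ring
  simp only [e1]
  have hm : Measurable (Function.uncurry fun (α : ℝ) (ξ : Vel d) => ENNReal.ofReal (κ * (‖ξ‖ * ‖g ξ‖) ^ 2) *
        ENNReal.ofReal (((1 + 4 * Real.pi ^ 2 * κ * ‖ξ‖ ^ 2) ^ 2 + α ^ 2)⁻¹)) := by
    have hg' : Measurable fun p : ℝ × Vel d => ‖g p.2‖ := hg.norm.comp measurable_snd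
    have h1 : Measurable fun p : ℝ × Vel d => κ * (‖p.2‖ * ‖g p.2‖) ^ 2 := by fun_prop
    have h2 : Measurable fun p : ℝ × Vel d =>
      ((1 + 4 * Real.pi ^ 2 * κ * ‖p.2‖ ^ 2) ^ 2 + p.1 ^ 2)⁻¹ := by fun_prop
    exact h1.ennreal_ofReal.mul h2.ennreal_ofReal
  rw [lintegral_lintegral_swap hm.aemeasurable, eLpNorm_two_sq]
  refine lintegral_mono fun ξ => ?_
  rw [lintegral_const_mul' _ _ ENNReal.ofReal_ne_top, lintegral_inv_sq_add_sq (by positivity),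
    ← ENNReal.ofReal_mul (by positivity)]
  refine ENNReal.ofReal_le_ofReal ?_
  rw [mul_div_assoc', div_le_iff₀ (by positivity)]
  have h3 : κ * ‖ξ‖ ^ 2 * Real.pi ≤ 1 + 4 * Real.pi ^ 2 * κ * ‖ξ‖ ^ 2 := by
    have h4 : 0 ≤ κ * ‖ξ‖ ^ 2 * Real.pi := by positivity
    have h5 := Real.pi_gt_three
    nlinarith
  have h6 := mul_le_mul_of_nonneg_left h3 (sq_nonneg ‖g ξ‖)
  nlinarith

/-- The squared distance of the Laplace transforms, frequency by frequency. -/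
theorem exists_norm_sub_sq_bound (hd : 2 ≤ d) {V : Vel d → ℝ} (hV : ContDiff ℝ ∞ V)
    (hc : HasCompactSupport V) (hrad : ∀ x y : Vel d, ‖x‖ = ‖y‖ → V x = V y) {β : ℝ} (hβ : 0 < β)
    {κ₀ : ℝ} (hκ₀ : 0 < κ₀) : ∃ K : ℝ, 0 ≤ K ∧ ∀ κ α N : ℝ, κ₀ ≤ κ → 1 ≤ N → ∀ 𝔤 u u₀ : L2 d,
      MemLp (fun ξ => ((1 + ‖ξ‖ ^ 2 : ℝ) : ℂ) * (𝓕 𝔤 : L2 d) ξ) 2 volume →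
      SolvesHatEquation β κ V N N 𝔤 α u →
      FourierSolution V β κ α 0 0 (𝓕 𝔤 : L2 d) (𝓕 u₀ : L2 d) →
      ‖u - u₀‖ ^ 2 ≤ K / N ^ 2 * (κ * dirichlet (fun ξ =>
        ((1 + ‖ξ‖ ^ 2 : ℝ) : ℂ) * (𝓕 𝔤 : L2 d) ξ / symbol κ α ξ) ^ 2) := by
  obtain ⟨C, μ, hC, hμ, hw⟩ := exists_weighted_bound hd hV hc hβ hκ₀
  obtain ⟨E, hE, he⟩ := exists_energy_bound hd hV hc hβ hκ₀
  refine ⟨E * (C * μ ^ 2) ^ 2, by positivity, fun κ α N hκ hN 𝔤 u u₀ hg hu hu₀ => ?_⟩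
  have hκ0 : 0 < κ := hκ₀.trans_le hκ
  have hN0 : 0 < N := by linarith
  have hgm := L2.measurable (𝓕 𝔤 : L2 d)
  have hPm : Measurable fun ξ : Vel d => ((1 + ‖ξ‖ ^ 2 : ℝ) : ℂ) * (𝓕 𝔤 : L2 d) ξ := by fun_prop
  have hD := formDomain_div_symbol hPm hg hκ0 α
  set X := dirichlet fun ξ : Vel d => ((1 + ‖ξ‖ ^ 2 : ℝ) : ℂ) * (𝓕 𝔤 : L2 d) ξ / symbol κ α ξ with hX
  have hX0 : 0 ≤ X := l2n_nonneg _
  have hμ0 : 0 ≤ μ ^ 2 := sq_nonneg _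
  -- The regularised weight is at most `μ² (1 + ‖ξ‖²)`, so the bound on the data no longer depends
  -- on `ε`.
  have hb : ∀ ε : ℝ, 0 < ε → dirichlet (fun ξ => (weight μ ε ξ : ℂ) * (𝓕 u₀ : L2 d) ξ) ≤
      C * (μ ^ 2 * X) := fun ε hε => by
    refine (hw κ α hκ _ _ hgm (Lp.memLp _) hu₀ ε hε).trans (mul_le_mul_of_nonneg_left ?_ hC)
    rw [hX, dirichlet, dirichlet, ← l2n_const_mul hμ0]
    refine l2n_le (hD.memLp_norm.const_mul (μ ^ 2)) fun ξ => ?_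
    have h1 := weight_le' hμ hε.le ξ
    have h2 := weight_nonneg μ hε.le ξ
    rw [abs_of_nonneg (by positivity), mul_div_assoc, norm_mul, norm_mul, Complex.norm_real, Complex.norm_real,
      Real.norm_eq_abs, Real.norm_eq_abs, abs_of_nonneg h2, abs_of_nonneg (by positivity)]
    calc ‖ξ‖ * (weight μ ε ξ * ‖(𝓕 𝔤 : L2 d) ξ / symbol κ α ξ‖) ≤
        ‖ξ‖ * (μ ^ 2 * (1 + ‖ξ‖ ^ 2) * ‖(𝓕 𝔤 : L2 d) ξ / symbol κ α ξ‖) := by gcongr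
      _ = _ := by ring
  obtain ⟨hm, hl⟩ := memLp_of_weight_bound hu₀.dom hμ (by positivity) hb
  have hfin := he κ α N hκ hN _ _ _ (hu.fourierSolution hd hV hc hrad hβ hκ0.le hN0) hu₀ hm
  have hnorm : ‖u - u₀‖ ^ 2 = l2n (fun ξ => ‖(𝓕 u : L2 d) ξ - (𝓕 u₀ : L2 d) ξ‖) ^ 2 := by
    rw [← Lp.norm_fourier_eq (u - u₀), L2_norm_sq, l2n_sq, show (𝓕 (u - u₀) : L2 d) = 𝓕 u - 𝓕 u₀ from
      map_sub (FourierTransform.fourierCLM ℂ (L2 d)) u u₀]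
    refine integral_congr_ae ?_
    filter_upwards [Lp.coeFn_sub (𝓕 u : L2 d) (𝓕 u₀)] with ξ hξ
    rw [hξ, Pi.sub_apply]
  rw [hnorm]
  refine hfin.trans ?_
  have h3 : l2n (fun ξ => (1 + ‖ξ‖ ^ 2) * ‖ξ‖ * ‖(𝓕 u₀ : L2 d) ξ‖) ^ 2 ≤ (C * (μ ^ 2 * X)) ^ 2 :=
    pow_le_pow_left₀ (l2n_nonneg _) hl 2
  calc _ ≤ E * κ / N ^ 2 * (C * (μ ^ 2 * X)) ^ 2 := by gcongr
    _ = _ := by ring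

/-- The symbol of `⟨∇⟩²` carries `2π ‖ξ‖`, and `1 ≤ (2π)²`. -/
theorem eLpNorm_weight_fourier_le (𝔤 : L2 d) :
    eLpNorm (fun ξ => ((1 + ‖ξ‖ ^ 2 : ℝ) : ℂ) * (𝓕 𝔤 : L2 d) ξ) 2 volume ≤ japaneseNorm 2 𝔤 := by
  rw [japaneseNorm]
  refine eLpNorm_mono fun ξ => ?_
  have h1 : (1 : ℝ) ≤ (2 * Real.pi) ^ 2 := by nlinarith [Real.pi_gt_three]
  have h2 : ((1 : ℝ) + (2 * Real.pi * ‖ξ‖) ^ 2) ^ ((2 : ℝ) / 2) = 1 + (2 * Real.pi * ‖ξ‖) ^ 2 := by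
    rw [div_self two_ne_zero, Real.rpow_one]
  rw [h2, norm_mul, norm_mul, Complex.norm_real, Complex.norm_real, Real.norm_eq_abs, Real.norm_eq_abs,
    abs_of_nonneg (by positivity), abs_of_nonneg (by positivity), mul_pow _ ‖ξ‖]
  refine mul_le_mul_of_nonneg_right ?_ (norm_nonneg _)
  have := mul_le_mul_of_nonneg_right h1 (sq_nonneg ‖ξ‖)
  linarith

end Thermalization

end

theorem mainTheorem5 (d : ℕ) (hd : 2 ≤ d) (β : ℝ) (hβ : 0 < β)
    (V : Thermalization.Vel d → ℝ) (hVsmooth : ContDiff ℝ ∞ V) (hVsupp : HasCompactSupport V)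
    (hVrad : ∀ x y : Thermalization.Vel d, ‖x‖ = ‖y‖ → V x = V y)
    (κ₀ : ℝ) (hκ₀ : 0 < κ₀) :
    ∃ C : ℝ, 0 < C ∧
      ∀ κ : ℝ, κ₀ ≤ κ → ∀ N : ℕ, 1 ≤ N →
      ∀ 𝔤 : Thermalization.L2 d,
        TemperedDistribution.MemSobolev 2 2 (𝔤 : 𝓢'(Thermalization.Vel d, ℂ)) →
      ∀ gN : ℝ → Thermalization.L2 d,
        Thermalization.IsAnsatz β κ V (N : ℝ) (N : ℝ) 𝔤 gN →
      ∀ g₀ : ℝ → Thermalization.L2 d,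
        Thermalization.IsFokkerPlanckSolution κ (Thermalization.landauTensor β V) 𝔤 g₀ →
      eLpNorm (fun α : ℝ => Thermalization.laplace gN α - Thermalization.laplace g₀ α) 2 volume
        ≤ ENNReal.ofReal (C / (N : ℝ)) * Thermalization.japaneseNorm 2 𝔤 := by
  obtain ⟨K, hK, hbound⟩ := Thermalization.exists_norm_sub_sq_bound hd hVsmooth hVsupp hVrad hβ hκ₀
  -- The summand `1` only makes the constant strictly positive.
  refine ⟨√K + 1, by positivity, fun κ hκ N hN 𝔤 _ gN hgN g₀ hg₀ => ?_⟩
  have hN1 : (1 : ℝ) ≤ N := by exact_mod_cast hN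
  have hN0 : (0 : ℝ) < N := by linarith
  have hle := Thermalization.eLpNorm_weight_fourier_le 𝔤
  -- If the norm on the right is infinite the bound is trivial; otherwise its finiteness gives `(1 +
  -- ‖ξ‖²) 𝓕 𝔤 ∈ L²`.
  by_cases htop : Thermalization.japaneseNorm 2 𝔤 = ⊤
  · rw [htop, ENNReal.mul_top (by simpa using by positivity)]
    exact le_top
  have hgm := Thermalization.L2.measurable (𝓕 𝔤 : Thermalization.L2 d)
  have hPm : Measurable fun ξ : Thermalization.Vel d =>
    ((1 + ‖ξ‖ ^ 2 : ℝ) : ℂ) * (𝓕 𝔤 : Thermalization.L2 d) ξ := by fun_prop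
  have hmem : MemLp (fun ξ : Thermalization.Vel d =>
      ((1 + ‖ξ‖ ^ 2 : ℝ) : ℂ) * (𝓕 𝔤 : Thermalization.L2 d) ξ) 2 volume :=
    ⟨hPm.aestronglyMeasurable, hle.trans_lt (lt_top_iff_ne_top.2 htop)⟩
  have hsq : eLpNorm (fun α : ℝ => Thermalization.laplace gN α - Thermalization.laplace g₀ α) 2 volume ^ 2 ≤
      (ENNReal.ofReal ((√K + 1) / (N : ℝ)) * Thermalization.japaneseNorm 2 𝔤) ^ 2 := by
    rw [Thermalization.eLpNorm_two_sq, mul_pow, ← ENNReal.ofReal_pow (by positivity)]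
    calc _ ≤ ∫⁻ α : ℝ, ENNReal.ofReal (K / (N : ℝ) ^ 2) * ENNReal.ofReal (κ * Thermalization.dirichlet (fun ξ =>
            ((1 + ‖ξ‖ ^ 2 : ℝ) : ℂ) * (𝓕 𝔤 : Thermalization.L2 d) ξ / Thermalization.symbol κ α ξ) ^ 2) := by
          refine lintegral_mono fun α => ?_
          rw [← ENNReal.ofReal_mul (by positivity)]
          exact ENNReal.ofReal_le_ofReal (hbound κ α N hκ hN1 𝔤 _ _ hmem (hgN.equation α)
            (hg₀.fourierSolution hd hVsmooth hVsupp hVrad hβ α))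
      _ ≤ ENNReal.ofReal (((√K + 1) / (N : ℝ)) ^ 2) * Thermalization.japaneseNorm 2 𝔤 ^ 2 := by
          rw [lintegral_const_mul' _ _ ENNReal.ofReal_ne_top]
          refine mul_le_mul' (ENNReal.ofReal_le_ofReal ?_)
            ((Thermalization.lintegral_dirichlet_div_symbol hPm hmem (hκ₀.trans_le hκ)).trans (by gcongr))
          rw [div_pow]
          refine div_le_div_of_nonneg_right ?_ (by positivity)
          nlinarith [Real.sq_sqrt hK, Real.sqrt_nonneg K]
  exact (ENNReal.pow_le_pow_left_iff two_ne_zero).1 hsq
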